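/- All graphs are finite and simple. An \emph{identification} of two distinct vertices $u,v$ of a graph replaces $u$ and $v$ with a new vertex adjacent to all the other neighbours of $u$ and of $v$. A graph $G$ \emph{can be identified to} a graph $H$ if some finite (possibly empty) sequence of identifications transforms $G$ into a graph isomorphic to $H$. The problem \textsc{Identification} has as input two graphs $G$ and $H$ and asks whether $G$ can be identified to $H$. A \emph{leaf} of a forest is a vertex of degree at most $1$ (so isolated vertices are leaves). \textbf{Theorem.} \textsc{Identification} is solvable in time $n^{\mathcal{O}(\ell^2)}$ on instances $(G,F)$ where $G$ is an arbitrary graph, $n=|V(G)|$, and $F$ is a forest with $\ell$ leaves. That is, there are a constant $c$ and a single program of a unit-cost random access machine (natural-number cells, indirect addressing, constants, addition and truncated subtraction) which, given $|V(G)|$, $|V(F)|$ and the adjacency matrices of a graph $G$ and a forest $F$, halts after at most $c\cdot \max\{n,1\}^{c\,\ell^2}$ steps with the answer $1$ if $G$ can be identified to $F$ and $0$ otherwise. -/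

import Mathlib

/-! ### Vertex identifications -/

/-- The graph obtained from `G` by identifying `u` and `v`: the two vertices are replaced with a
new vertex `none`, adjacent to all the other neighbours of `u` and of `v`. The remaining vertices
and the edges among them are kept. (`u` and `v` may or may not be adjacent in `G`.) -/
def SimpleGraph.identify {V : Type} (G : SimpleGraph V) (u v : V) :
    SimpleGraph (Option {x : V // x ≠ u ∧ x ≠ v}) where
  Adj a b :=
    match a, b with
    | none, none => False
    | none, some y => G.Adj u y.1 ∨ G.Adj v y.1
    | some x, none => G.Adj u x.1 ∨ G.Adj v x.1
    | some x, some y => G.Adj x.1 y.1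
  symm := ⟨by
    rintro (_ | x) (_ | y) h
    · exact h
    · exact h
    · exact h
    · exact SimpleGraph.Adj.symm h⟩
  loopless := ⟨by
    rintro (_ | x) h
    · exact h
    · exact G.loopless.irrefl x.1 h⟩

/-- `G` can be identified to `H`: a (possibly empty) finite sequence of identifications of two
distinct vertices transforms `G` into (an isomorphic copy of) `H`. -/
inductive CanBeIdentifiedTo : {V : Type} → SimpleGraph V → {W : Type} → SimpleGraph W → Prop
  | iso {V W : Type} {G : SimpleGraph V} {H : SimpleGraph W} (e : G ≃g H) :
      CanBeIdentifiedTo G H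
  | step {V W : Type} {G : SimpleGraph V} {H : SimpleGraph W} (u v : V) (huv : u ≠ v)
      (h : CanBeIdentifiedTo (G.identify u v) H) : CanBeIdentifiedTo G H

/-- The number of leaves of a forest: vertices of degree at most `1`, so that isolated vertices
count as leaves. -/
noncomputable def numLeaves {k : ℕ} (F : SimpleGraph (Fin k)) : ℕ :=
  {x : Fin k | (F.neighborSet x).ncard ≤ 1}.ncard

/-! ### Random access machines

The unit-cost RAM over the natural numbers: finitely many registers per program, an unbounded
memory with indirect addressing, constants, addition and truncated subtraction (no multiplication),
and structured control flow. -/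

/-- Arithmetic expressions. -/
inductive RamExpr : Type
  /-- a constant -/
  | lit (c : ℕ)
  /-- the content of register `r` -/
  | reg (r : ℕ)
  /-- the content of the memory cell whose address is the value of `e` -/
  | load (e : RamExpr)
  | add (e₁ e₂ : RamExpr)
  /-- truncated subtraction -/
  | sub (e₁ e₂ : RamExpr)

/-- Programs. -/
inductive RamProg : Type
  | skip
  /-- write the value of `e` to register `r` -/
  | assign (r : ℕ) (e : RamExpr)
  /-- write the value of `e` to the memory cell whose address is the value of `a` -/
  | store (a e : RamExpr)
  /-- run `p`, then `q` -/
  | seq (p q : RamProg)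
  /-- run `p` if the value of `e` is nonzero, and `q` otherwise -/
  | cond (e : RamExpr) (p q : RamProg)
  /-- run `p` as long as the value of `e` is nonzero -/
  | loop (e : RamExpr) (p : RamProg)

/-- The contents of the registers and of the memory. -/
structure RamState where
  regs : ℕ → ℕ
  mem : ℕ → ℕ

/-- The value of an expression in a state. -/
def RamExpr.value (s : RamState) : RamExpr → ℕ
  | lit c => c
  | reg r => s.regs r
  | load e => s.mem (e.value s)
  | add e₁ e₂ => e₁.value s + e₂.value s
  | sub e₁ e₂ => e₁.value s - e₂.value s

/-- The number of elementary operations in the evaluation of an expression. -/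
def RamExpr.cost : RamExpr → ℕ
  | lit _ => 1
  | reg _ => 1
  | load e => e.cost + 1
  | add e₁ e₂ => e₁.cost + e₂.cost + 1
  | sub e₁ e₂ => e₁.cost + e₂.cost + 1

/-- `RamExec p s s' t`: the program `p`, started in the state `s`, halts in the state `s'` after
exactly `t` elementary steps. -/
inductive RamExec : RamProg → RamState → RamState → ℕ → Prop
  | skip (s : RamState) : RamExec .skip s s 1
  | assign (s : RamState) (r : ℕ) (e : RamExpr) :
      RamExec (.assign r e) s ⟨Function.update s.regs r (e.value s), s.mem⟩ (e.cost + 1)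
  | store (s : RamState) (a e : RamExpr) :
      RamExec (.store a e) s ⟨s.regs, Function.update s.mem (a.value s) (e.value s)⟩
        (a.cost + e.cost + 1)
  | seq {p q : RamProg} {s s₁ s₂ : RamState} {t₁ t₂ : ℕ}
      (h₁ : RamExec p s s₁ t₁) (h₂ : RamExec q s₁ s₂ t₂) :
      RamExec (.seq p q) s s₂ (t₁ + t₂)
  | cond_true {e : RamExpr} {p q : RamProg} {s s' : RamState} {t : ℕ}
      (he : e.value s ≠ 0) (h : RamExec p s s' t) :
      RamExec (.cond e p q) s s' (e.cost + 1 + t)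
  | cond_false {e : RamExpr} {p q : RamProg} {s s' : RamState} {t : ℕ}
      (he : e.value s = 0) (h : RamExec q s s' t) :
      RamExec (.cond e p q) s s' (e.cost + 1 + t)
  | loop_done {e : RamExpr} {p : RamProg} {s : RamState} (he : e.value s = 0) :
      RamExec (.loop e p) s s (e.cost + 1)
  | loop_step {e : RamExpr} {p : RamProg} {s s₁ s₂ : RamState} {t₁ t₂ : ℕ}
      (he : e.value s ≠ 0) (h₁ : RamExec p s s₁ t₁) (h₂ : RamExec (.loop e p) s₁ s₂ t₂) :
      RamExec (.loop e p) s s₂ (e.cost + 1 + t₁ + t₂)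

/-- The initial state on an input word: the input is in the first memory cells, and all the other
memory cells and all registers hold `0`. -/
def RamState.init (w : List ℕ) : RamState where
  regs := fun _ => 0
  mem := fun i => w.getD i 0

/-- The decision problem `yes`, restricted to the instances that satisfy `promise` and given by the
encoding `encode`, is solved by one program that halts on every such instance `I` after at most
`T I` steps, with the answer (`1` for yes, `0` for no) in register `0`. -/
def SolvableInTime {ι : Type} (encode : ι → List ℕ) (promise yes : ι → Prop) (T : ι → ℕ) : Prop :=
  ∃ p : RamProg, ∀ I : ι, promise I →
    ∃ (s : RamState) (t : ℕ), RamExec p (RamState.init (encode I)) s t ∧ t ≤ T I ∧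
      (yes I → s.regs 0 = 1) ∧ (¬ yes I → s.regs 0 = 0)

/-! ### The problem Identification -/

/-- An instance of Identification: two finite graphs. -/
structure IdInstance where
  /-- the number of vertices of the input graph -/
  n : ℕ
  /-- the number of vertices of the target graph -/
  k : ℕ
  /-- the input graph -/
  G : SimpleGraph (Fin n)
  /-- the target graph -/
  F : SimpleGraph (Fin k)

open Classical in
/-- The adjacency matrix of a graph, row by row. -/
noncomputable def adjWord {n : ℕ} (G : SimpleGraph (Fin n)) : List ℕ :=
  (List.finRange n).flatMap fun i => (List.finRange n).map fun j => if G.Adj i j then 1 else 0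

/-- The input word of an instance: the two numbers of vertices, then the two adjacency matrices. -/
noncomputable def IdInstance.encode (I : IdInstance) : List ℕ :=
  I.n :: I.k :: (adjWord I.G ++ adjWord I.F)

/-!
A graph `G` can be identified to `F` if and only if there is a map from `G` onto `F` along which
every edge of `G` is contracted or mapped to an edge of `F`, and which reaches every vertex and every
edge of `F` (`canBeIdentifiedTo_iff`). If `F` is a forest with `ℓ` leaves, then the existence of such
a map is equivalent to the existence of a certificate that consists of `O(ℓ ^ 2)` vertices, together
with the solution of a packing problem.

The certificate has a partial map from `G` to `F` with at most `9 ℓ ^ 2` pairs `(u i, a i)` that does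
not increase distances, and `9 ℓ ^ 2` paths in `F`, such that each edge of `F` either lies on one of
the paths or separates two values `a i`, `a j` whose arguments lie in the same component of `G`; the
isolated vertices of `F` are values too. The components of `G` that contain no `u i` are called free.
It is required that they can be distributed to the paths in such a way that the paths can be cut into
pieces, one for each component, no longer than the diameter of the component.

A certificate suffices (`IsOutline.exists_isIdentificationMap`), because the ends of the pieces may
be added to the partial map, and because a partial map into a forest that does not increase distances
extends to all vertices: in a rooted forest, a vertex `x` is sent to the deepest of the vertices that
are reached from the `a i` by `dist (u i) x` steps towards the root (`Rooting.exists_extension`). The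
image of a connected graph contains every edge that separates two of its vertices.

A certificate is also necessary (`IsIdentificationMap.exists_certificate`). A rooted forest with `ℓ`
leaves consists of at most `2 ℓ` segments, that is, of downward chains between branchings. The image
of a component of `G` that meets edges of several segments contains, along with an edge of a segment,
one of the two parts into which the edge divides the segment (`Rooting.IsBent.covers`). So `4 ℓ`
such components suffice to cover all that they cover together (`Rooting.exists_bent_selection`), and
the edges covered by one component are separated by the images of `ℓ + 1` vertices
(`Rooting.exists_anchors`). What remains of a segment is a path, and the components that cover it
serve for this segment only.

The machine tries all codes of partial maps and paths, which are numbers below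
`N = (n + 1) ^ (9 ℓ ^ 2)`, and solves the packing problem by dynamic programming: the loads of the
paths that can be reached with the first `t` components form a set of codes below `N`
(`exists_of_inSet_loadSet`, `inSet_loadSet`). All this is polynomial in `N`. The running time is
bounded by a calculus of functions that are computable in polynomial time (`PolyComputable`), which is
closed under primitive recursion of polynomial length without any bound on the values, as the machine
has unit costs. It is applied to the computation of `N`, with the size `n + 9`, and then to the search
for a certificate, with the size `N`.
-/

/-! ### Functions computed by random access machines in polynomial time -/

/-- A type of inputs of a machine: each input comes with a size, to which running times refer, and
with the word that is found in the memory. -/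
class MachineInput (B : Type) where
  /-- the size parameter -/
  size : B → ℕ
  /-- the contents of the memory -/
  word : B → ℕ → ℕ
  size_pos : ∀ I, 0 < size I

/-- A type of contexts over a type of inputs: a context consists of an input and of the values of
finitely many local variables. -/
class MachineCtx (α : Type) (B : outParam Type) where
  /-- the input -/
  base : α → B
  /-- the number of local variables -/
  arity (α) : ℕ
  /-- the values of the local variables, numbered from `0` to `arity - 1` -/
  var : α → ℕ → ℕ

open MachineInput MachineCtx

instance MachineInput.instCtx {B : Type} [MachineInput B] : MachineCtx B B where
  base := id
  arity := 0
  var _ _ := 0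

/-- A context extended with one more variable. -/
instance MachineCtx.instProd {B α : Type} [MachineCtx α B] : MachineCtx (α × ℕ) B where
  base p := base p.1
  arity := arity α + 1
  var p i := if i < arity α then var p.1 i else p.2

/-- A context extended with one more variable, whose value is bounded. -/
instance MachineCtx.instSigma {B α : Type} [MachineCtx α B] {b : α → ℕ} :
    MachineCtx ((x : α) × Fin (b x)) B where
  base p := base p.1
  arity := arity α + 1
  var p i := if i < arity α then var p.1 i else p.2

/-- `f` is computed by a machine in time polynomial in the size of the input. The program may be
placed anywhere: given a register `ρ i` for each variable `i` and a bound `d` of these registers,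
it leaves the memory and the registers below `d` unchanged and puts the result into register `d`.
The size of the input is kept in register `0`. -/
def PolyComputable {B α : Type} [MachineInput B] [MachineCtx α B] (f : α → ℕ) : Prop :=
  ∃ C D : ℕ, ∀ (ρ : ℕ → ℕ) (d : ℕ), 0 < d → (∀ i < arity α, ρ i < d) → ∃ p : RamProg,
    ∀ (x : α) (s : RamState), s.regs 0 = size (base x) → s.mem = word (base x) →
      (∀ i < arity α, s.regs (ρ i) = var x i) →
      ∃ (r : ℕ → ℕ) (t : ℕ), RamExec p s ⟨r, s.mem⟩ t ∧ (∀ i < d, r i = s.regs i) ∧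
        r d = f x ∧ t ≤ C * (size (base x) + 1) ^ D

theorem poly_add_bound {C₁ D₁ C₂ D₂ t₁ t₂ n : ℕ} (h₁ : t₁ ≤ C₁ * (n + 1) ^ D₁)
    (h₂ : t₂ ≤ C₂ * (n + 1) ^ D₂) : t₁ + t₂ ≤ (C₁ + C₂) * (n + 1) ^ (D₁ + D₂) := by
  have e₁ : (n + 1) ^ D₁ ≤ (n + 1) ^ (D₁ + D₂) := Nat.pow_le_pow_right (by omega) (by omega)
  have e₂ : (n + 1) ^ D₂ ≤ (n + 1) ^ (D₁ + D₂) := Nat.pow_le_pow_right (by omega) (by omega)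
  calc t₁ + t₂ ≤ C₁ * (n + 1) ^ (D₁ + D₂) + C₂ * (n + 1) ^ (D₁ + D₂) :=
        Nat.add_le_add (h₁.trans (Nat.mul_le_mul_left _ e₁)) (h₂.trans (Nat.mul_le_mul_left _ e₂))
    _ = _ := by ring

theorem const_poly_bound {c n : ℕ} : c ≤ c * (n + 1) ^ 0 := by simp

/-- The value of the primitive recursion of length `n` that starts with `a` and has the step
function `f`. -/
def iterFrom (a : ℕ) (f : ℕ → ℕ → ℕ) (n : ℕ) : ℕ := Nat.rec a f n

@[simp] theorem iterFrom_zero (a : ℕ) (f : ℕ → ℕ → ℕ) : iterFrom a f 0 = a := rfl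

@[simp] theorem iterFrom_succ (a : ℕ) (f : ℕ → ℕ → ℕ) (n : ℕ) :
    iterFrom a f (n + 1) = f n (iterFrom a f n) := rfl

namespace PolyComputable

variable {B α : Type} [MachineInput B] [MachineCtx α B]

theorem lit (c : ℕ) : PolyComputable (fun _ : α => c) := by
  refine ⟨2, 0, fun ρ d _ _ => ⟨.assign d (.lit c), fun x s _ _ _ => ?_⟩⟩
  refine ⟨_, _, .assign s d (.lit c), fun i hi => ?_, ?_, by simp [RamExpr.cost]⟩
  · simp [Function.update_of_ne hi.ne]
  · simp [RamExpr.value]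

theorem inputSize : PolyComputable (fun x : α => size (base x)) := by
  refine ⟨2, 0, fun ρ d _ _ => ⟨.assign d (.reg 0), fun x s h _ _ => ?_⟩⟩
  refine ⟨_, _, .assign s d (.reg 0), fun i hi => ?_, ?_, by simp [RamExpr.cost]⟩
  · simp [Function.update_of_ne hi.ne]
  · simp [RamExpr.value, h]

theorem newVar : PolyComputable (fun p : α × ℕ => p.2) := by
  refine ⟨2, 0, fun ρ d _ _ => ⟨.assign d (.reg (ρ (arity α))), fun x s _ _ h => ?_⟩⟩
  refine ⟨_, _, .assign s d (.reg (ρ (arity α))), fun i hi => ?_, ?_, by simp [RamExpr.cost]⟩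
  · simp [Function.update_of_ne hi.ne]
  · have := h (arity α) (Nat.lt_succ_self _)
    simp [RamExpr.value, this, var]

theorem newBoundedVar {b : α → ℕ} : PolyComputable (fun p : (x : α) × Fin (b x) => (p.2 : ℕ)) := by
  refine ⟨2, 0, fun ρ d _ _ => ⟨.assign d (.reg (ρ (arity α))), fun x s _ _ h => ?_⟩⟩
  refine ⟨_, _, .assign s d (.reg (ρ (arity α))), fun i hi => ?_, ?_, by simp [RamExpr.cost]⟩
  · simp [Function.update_of_ne hi.ne]
  · have := h (arity α) (Nat.lt_succ_self _)
    simp [RamExpr.value, this, var]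

/-- A function of some of the variables of a context is a function of the context. -/
theorem extend {β : Type} [MachineCtx β B] {f : α → ℕ} (hf : PolyComputable f) (π : β → α)
    (hle : arity α ≤ arity β) (hb : ∀ y, base (π y) = base y)
    (hv : ∀ y, ∀ i < arity α, var (π y) i = var y i) : PolyComputable (fun y => f (π y)) := by
  obtain ⟨C, D, h⟩ := hf
  refine ⟨C, D, fun ρ d hd hρ => ?_⟩
  obtain ⟨p, hp⟩ := h ρ d hd (fun i hi => hρ i (by omega))
  refine ⟨p, fun y s h0 hm hr => ?_⟩
  have := hp (π y) s (by rw [hb, h0]) (by rw [hb, hm])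
    (fun i hi => by rw [hv y i hi]; exact hr i (by omega))
  rwa [hb] at this

theorem weak {f : α → ℕ} (hf : PolyComputable f) : PolyComputable (fun p : α × ℕ => f p.1) :=
  hf.extend (fun p : α × ℕ => p.1) (Nat.le_succ _) (fun _ => rfl) (fun y i hi => by simp [var, hi])

theorem weakB {f : α → ℕ} (hf : PolyComputable f) {b : α → ℕ} :
    PolyComputable (fun p : (x : α) × Fin (b x) => f p.1) :=
  hf.extend (fun p : (x : α) × Fin (b x) => p.1) (Nat.le_succ _) (fun _ => rfl)
    (fun y i hi => by simp [var, hi])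

theorem wordAt {f : α → ℕ} (hf : PolyComputable f) :
    PolyComputable (fun x => word (base x) (f x)) := by
  obtain ⟨C, D, h⟩ := hf
  refine ⟨C + 3, D + 0, fun ρ d hd hρ => ?_⟩
  obtain ⟨p, hp⟩ := h ρ d hd hρ
  refine ⟨.seq p (.assign d (.load (.reg d))), fun x s h0 hm hr => ?_⟩
  obtain ⟨r, t, he, hlt, hd, ht⟩ := hp x s h0 hm hr
  refine ⟨_, _, .seq he (.assign _ d (.load (.reg d))), fun i hi => ?_, ?_,
    poly_add_bound ht const_poly_bound⟩
  · simp [Function.update_of_ne hi.ne, hlt i hi]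
  · simp [RamExpr.value, hd, hm]

/-- Two results in adjacent registers can be combined by one expression. -/
theorem combine {f g : α → ℕ} (hf : PolyComputable f) (hg : PolyComputable g) (op : ℕ → ℕ → ℕ)
    (e : ℕ → RamExpr) (he : ∀ d s, (e d).value s = op (s.regs d) (s.regs (d + 1)))
    (hc : ∀ d, (e d).cost = 3) : PolyComputable (fun x => op (f x) (g x)) := by
  obtain ⟨C₁, D₁, h₁⟩ := hf
  obtain ⟨C₂, D₂, h₂⟩ := hg
  refine ⟨C₁ + (C₂ + 4), D₁ + (D₂ + 0), fun ρ d hd hρ => ?_⟩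
  obtain ⟨p, hp⟩ := h₁ ρ d hd hρ
  obtain ⟨q, hq⟩ := h₂ ρ (d + 1) (by omega) (fun i hi => (hρ i hi).trans (Nat.lt_succ_self d))
  refine ⟨.seq p (.seq q (.assign d (e d))), fun x s h0 hm hr => ?_⟩
  obtain ⟨r, t, hex, hlt, hrd, ht⟩ := hp x s h0 hm hr
  obtain ⟨r', t', hex', hlt', hrd', ht'⟩ := hq x ⟨r, s.mem⟩ (by simp [hlt 0 hd, h0]) hm
    (fun i hi => by simp [hlt _ (hρ i hi), hr i hi])
  refine ⟨_, _, .seq hex (.seq hex' (.assign _ d (e d))), fun i hi => ?_, ?_,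
    poly_add_bound ht (poly_add_bound ht' ?_)⟩
  · simp [Function.update_of_ne hi.ne, hlt' i (by omega), hlt i hi]
  · simp [he, hlt' d (by omega), hrd, hrd']
  · rw [hc]; exact const_poly_bound

theorem add {f g : α → ℕ} (hf : PolyComputable f) (hg : PolyComputable g) :
    PolyComputable (fun x => f x + g x) :=
  hf.combine hg (· + ·) (fun d => .add (.reg d) (.reg (d + 1))) (fun _ _ => rfl) (fun _ => rfl)

theorem sub {f g : α → ℕ} (hf : PolyComputable f) (hg : PolyComputable g) :
    PolyComputable (fun x => f x - g x) :=
  hf.combine hg (· - ·) (fun d => .sub (.reg d) (.reg (d + 1))) (fun _ _ => rfl) (fun _ => rfl)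

/-- Primitive recursion whose length is at most the size of the input. There is no restriction on
the size of the values. -/
theorem iterFrom {b a : α → ℕ} {f : α → ℕ → ℕ → ℕ} (hb : PolyComputable b)
    (hle : ∀ x, b x ≤ MachineInput.size (base x)) (ha : PolyComputable a)
    (hf : PolyComputable (fun p : ((x : α) × Fin (b x)) × ℕ => f p.1.1 p.1.2 p.2)) :
    PolyComputable (fun x => iterFrom (a x) (f x) (b x)) := by
  obtain ⟨C₁, D₁, h₁⟩ := hb
  obtain ⟨C₂, D₂, h₂⟩ := ha
  obtain ⟨C₃, D₃, h₃⟩ := hf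
  refine ⟨C₁ + (2 + (C₂ + ((4 + (C₃ + 6) + 4) + 2))),
    D₁ + (0 + (D₂ + ((0 + (D₃ + 0) + 1) + 0))), fun ρ d hd hρ => ?_⟩
  obtain ⟨p₁, hp₁⟩ := h₁ ρ d hd hρ
  obtain ⟨p₂, hp₂⟩ := h₂ ρ (d + 2) (by omega) (fun i hi => (hρ i hi).trans (by omega))
  obtain ⟨p₃, hp₃⟩ := h₃ (fun i => if i < arity α then ρ i else if i = arity α then d + 1 else d + 2)
    (d + 3) (by omega) (fun i hi => by
      split_ifs with h h'
      · exact (hρ i h).trans (by omega)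
      · omega
      · omega)
  -- register `d` holds the length, `d + 1` the counter, `d + 2` the current value
  set body : RamProg := .seq p₃ (.seq (.assign (d + 2) (.reg (d + 3)))
    (.assign (d + 1) (.add (.reg (d + 1)) (.lit 1)))) with hbody
  set guard : RamExpr := .sub (.reg d) (.reg (d + 1)) with hguard
  refine ⟨.seq p₁ (.seq (.assign (d + 1) (.lit 0)) (.seq p₂ (.seq (.loop guard body)
    (.assign d (.reg (d + 2)))))), fun x s h0 hm hr => ?_⟩
  obtain ⟨r₁, t₁, hex₁, hlt₁, hrd₁, ht₁⟩ := hp₁ x s h0 hm hr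
  obtain ⟨r₂, t₂, hex₂, hlt₂, hrd₂, ht₂⟩ := hp₂ x ⟨Function.update r₁ (d + 1) 0, s.mem⟩
    (by simp [hlt₁ 0 hd, h0]) hm
    (fun i hi => by
      have := hρ i hi
      simp [Function.update_of_ne (show ρ i ≠ d + 1 by omega), hlt₁ _ this, hr i hi])
  replace hlt₂ : ∀ i < d + 2, r₂ i = Function.update r₁ (d + 1) 0 i := hlt₂
  have key : ∀ (j i : ℕ), i + j = b x → ∀ r : ℕ → ℕ, (∀ c < d, r c = s.regs c) → r d = b x →
      r (d + 1) = i → r (d + 2) = _root_.iterFrom (a x) (f x) i →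
      ∃ (r' : ℕ → ℕ) (t : ℕ), RamExec (.loop guard body) ⟨r, s.mem⟩ ⟨r', s.mem⟩ t ∧
        (∀ c < d, r' c = s.regs c) ∧ r' (d + 2) = _root_.iterFrom (a x) (f x) (b x) ∧
        t ≤ j * ((4 + (C₃ + 6)) * (MachineInput.size (base x) + 1) ^ (0 + (D₃ + 0))) + 4 := by
    intro j
    induction j with
    | zero =>
      intro i hi r hr₁ hr₂ hr₃ hr₄
      refine ⟨r, _, .loop_done ?_, hr₁, ?_, ?_⟩
      · simp [hguard, RamExpr.value, hr₂, hr₃]; omega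
      · rw [hr₄, ← hi]; rfl
      · simp [hguard, RamExpr.cost]
    | succ j ih =>
      intro i hi r hr₁ hr₂ hr₃ hr₄
      obtain ⟨r₃, t₃, hex₃, hlt₃, hrd₃, ht₃⟩ := hp₃ ((⟨x, ⟨i, by omega⟩⟩ : (x : α) × Fin (b x)),
          _root_.iterFrom (a x) (f x) i) ⟨r, s.mem⟩ ((hr₁ 0 hd).trans h0) hm (fun c hc => by
        have hc' : c < arity α + 1 + 1 := hc
        by_cases h : c < arity α
        · have h'' : c < arity ((x : α) × Fin (b x)) := Nat.lt_succ_of_lt h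
          simp [h, h'', var, hr₁ _ (hρ c h), hr c h]
        · by_cases h' : c = arity α
          · subst h'
            have h'' : arity α < arity ((x : α) × Fin (b x)) := Nat.lt_succ_self _
            simp [h'', var, hr₃]
          · have h'' : ¬ c < arity ((x : α) × Fin (b x)) := fun h'' => by
              have : c < arity α + 1 := h''
              omega
            simp [h, h', h'', var, hr₄])
      have hex₄ : RamExec body ⟨r, s.mem⟩ ⟨Function.update (Function.update r₃ (d + 2) (r₃ (d + 3)))
          (d + 1) (Function.update r₃ (d + 2) (r₃ (d + 3)) (d + 1) + 1), s.mem⟩ _ := .seq hex₃ (.seq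
        (.assign _ (d + 2) (.reg (d + 3))) (.assign _ (d + 1) (.add (.reg (d + 1)) (.lit 1))))
      dsimp only at hlt₃ hrd₃
      obtain ⟨r', t', hex', hlt', hrd', ht'⟩ := ih (i + 1) (by omega)
        (Function.update (Function.update r₃ (d + 2) (r₃ (d + 3)))
          (d + 1) (Function.update r₃ (d + 2) (r₃ (d + 3)) (d + 1) + 1))
        (fun c hc => by
          rw [Function.update_of_ne (by omega), Function.update_of_ne (by omega),
            hlt₃ c (by omega), hr₁ c hc])
        (by rw [Function.update_of_ne (by omega), Function.update_of_ne (by omega),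
            hlt₃ d (by omega), hr₂])
        (by simp [hlt₃ (d + 1) (by omega), hr₃])
        (by
          rw [Function.update_of_ne (by omega)]
          simp [hrd₃])
      refine ⟨r', _, .loop_step ?_ hex₄ hex', hlt', hrd', ?_⟩
      · simp [hguard, RamExpr.value, hr₂, hr₃]; omega
      · have hb := poly_add_bound (const_poly_bound (c := 4) (n := MachineInput.size (base x)))
          (poly_add_bound ht₃ (const_poly_bound (c := 6)))
        rw [Nat.succ_mul]
        simp only [hguard, RamExpr.cost] at ht' ⊢
        change t₃ ≤ _ at ht₃
        omega
  obtain ⟨r₃, t₃, hex₃, hlt₃, hrd₃, ht₃⟩ := key (b x) 0 (by omega) r₂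
    (fun c hc => by rw [hlt₂ c (by omega), Function.update_of_ne (by omega), hlt₁ c hc])
    (by rw [hlt₂ d (by omega), Function.update_of_ne (by omega), hrd₁])
    (by rw [hlt₂ (d + 1) (by omega), Function.update_self])
    (by rw [hrd₂]; rfl)
  refine ⟨_, _, .seq hex₁ (.seq (.assign _ (d + 1) (.lit 0)) (.seq hex₂ (.seq hex₃
    (.assign _ d (.reg (d + 2)))))), fun c hc => ?_, ?_, poly_add_bound ht₁
    (poly_add_bound const_poly_bound (poly_add_bound ht₂ (poly_add_bound ?_ const_poly_bound)))⟩
  · simp only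
    rw [Function.update_of_ne (by omega), hlt₃ c hc]
  · simp [RamExpr.value, hrd₃]
  · refine ht₃.trans ?_
    have h1 : b x * ((4 + (C₃ + 6)) * (MachineInput.size (base x) + 1) ^ (0 + (D₃ + 0))) ≤
        (4 + (C₃ + 6)) * (MachineInput.size (base x) + 1) ^ (0 + (D₃ + 0) + 1) := by
      rw [pow_succ, ← mul_assoc (4 + (C₃ + 6)), mul_comm (b x)]
      exact Nat.mul_le_mul_left _ ((hle x).trans (Nat.le_succ _))
    have h2 : 4 ≤ 4 * (MachineInput.size (base x) + 1) ^ (0 + (D₃ + 0) + 1) :=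
      Nat.le_mul_of_pos_right _ (by positivity)
    calc _ ≤ _ := Nat.add_le_add h1 h2
      _ = _ := by ring

end PolyComputable

/-- The truth value of a proposition as a number. -/
noncomputable def truth (P : Prop) : ℕ := open Classical in if P then 1 else 0

theorem truth_true {P : Prop} (h : P) : truth P = 1 := if_pos h

theorem truth_false {P : Prop} (h : ¬ P) : truth P = 0 := if_neg h

theorem truth_le_one (P : Prop) : truth P ≤ 1 := by
  by_cases h : P <;> simp [truth, h]

theorem truth_congr {P Q : Prop} (h : P ↔ Q) : truth P = truth Q := by rw [propext h]

/-- The set of the numbers `i < n` that satisfy `P`, encoded in the binary digits of a number. A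
unit-cost machine can keep a set of polynomial size in a single register in this way. -/
noncomputable def bitSet (n : ℕ) (P : ℕ → Prop) : ℕ := ∑ i ∈ Finset.range n, truth (P i) * 2 ^ i

theorem bitSet_lt (n : ℕ) (P : ℕ → Prop) : bitSet n P < 2 ^ n := by
  induction n with
  | zero => simp [bitSet]
  | succ n ih =>
    rw [bitSet, Finset.sum_range_succ, pow_succ]
    have := Nat.mul_le_mul_right (2 ^ n) (truth_le_one (P n))
    rw [bitSet] at ih
    omega

theorem testBit_bitSet (n : ℕ) (P : ℕ → Prop) (j : ℕ) :
    (bitSet n P).testBit j = true ↔ j < n ∧ P j := by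
  induction n with
  | zero => simp [bitSet]
  | succ n ih =>
    have e : bitSet (n + 1) P = truth (P n) * 2 ^ n + bitSet n P := by
      rw [bitSet, Finset.sum_range_succ, add_comm]; rfl
    rw [e]
    have hlt := bitSet_lt n P
    by_cases h : P n
    · rw [truth_true h, one_mul]
      rcases lt_trichotomy j n with hj | rfl | hj
      · rw [Nat.testBit_two_pow_add_gt hj, ih]
        exact and_congr_left fun _ => by omega
      · rw [Nat.testBit_two_pow_add_eq, Nat.testBit_lt_two_pow hlt]
        simp [h]
      · rw [Nat.testBit_lt_two_pow]
        · simp; omega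
        · calc 2 ^ n + bitSet n P < 2 ^ (n + 1) := by rw [pow_succ]; omega
            _ ≤ 2 ^ j := Nat.pow_le_pow_right (by omega) hj
    · rw [truth_false h, zero_mul, zero_add, ih]
      constructor
      · rintro ⟨h1, h2⟩; exact ⟨by omega, h2⟩
      · rintro ⟨h1, h2⟩
        refine ⟨?_, h2⟩
        have : j ≠ n := fun hjn => h (hjn ▸ h2)
        omega

namespace PolyComputable

variable {B α : Type} [MachineInput B] [MachineCtx α B]

theorem congr {f g : α → ℕ} (hf : PolyComputable f) (h : ∀ x, g x = f x) : PolyComputable g := by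
  rwa [show g = f from funext h]

/-- Multiplication by repeated addition, whence the bound on the first factor. -/
theorem mul {f g : α → ℕ} (hf : PolyComputable f) (hg : PolyComputable g)
    (hle : ∀ x, f x ≤ MachineInput.size (base x)) : PolyComputable (fun x => f x * g x) := by
  refine (iterFrom (f := fun x _ acc => acc + g x) hf hle (lit 0)
    (newVar.add hg.weakB.weak)).congr fun x => ?_
  generalize f x = n
  induction n with
  | zero => simp
  | succ n ih => rw [iterFrom_succ, ← ih, Nat.succ_mul]

theorem sum {b : α → ℕ} {f : α → ℕ → ℕ} (hb : PolyComputable b)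
    (hle : ∀ x, b x ≤ MachineInput.size (base x))
    (hf : PolyComputable (fun p : (x : α) × Fin (b x) => f p.1 p.2)) :
    PolyComputable (fun x => ∑ i ∈ Finset.range (b x), f x i) := by
  refine (iterFrom (f := fun x i acc => acc + f x i) hb hle (lit 0)
    (newVar.add hf.weak)).congr fun x => ?_
  generalize b x = n
  induction n with
  | zero => simp
  | succ n ih => rw [Finset.sum_range_succ, iterFrom_succ, ih]

theorem pow {f g : α → ℕ} (hf : PolyComputable f) (hg : PolyComputable g)
    (hle : ∀ x, f x ≤ MachineInput.size (base x)) (hle' : ∀ x, g x ≤ MachineInput.size (base x)) :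
    PolyComputable (fun x => f x ^ g x) := by
  refine (iterFrom (f := fun x _ acc => f x * acc) hg hle' (lit 1)
    (hf.weakB.weak.mul newVar fun p => hle p.1.1)).congr fun x => ?_
  generalize g x = n
  induction n with
  | zero => simp
  | succ n ih => rw [iterFrom_succ, ← ih, pow_succ, mul_comm]

end PolyComputable

/-- `P` is decided by a machine in time polynomial in the size of the input. -/
def PolyDecidable {B α : Type} [MachineInput B] [MachineCtx α B] (P : α → Prop) : Prop :=
  PolyComputable (fun x => truth (P x))

namespace PolyDecidable

variable {B α : Type} [MachineInput B] [MachineCtx α B]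

open PolyComputable

theorem congr {P Q : α → Prop} (hP : PolyDecidable P) (h : ∀ x, Q x ↔ P x) : PolyDecidable Q := by
  rwa [show Q = P from funext fun x => propext (h x)]

theorem not {P : α → Prop} (hP : PolyDecidable P) : PolyDecidable (fun x => ¬ P x) :=
  ((lit 1).sub hP).congr fun x => by by_cases h : P x <;> simp [truth, h]

theorem and {P Q : α → Prop} (hP : PolyDecidable P) (hQ : PolyDecidable Q) :
    PolyDecidable (fun x => P x ∧ Q x) :=
  ((hP.add hQ).sub (lit 1)).congr fun x => by
    by_cases h : P x <;> by_cases h' : Q x <;> simp [truth, h, h']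

theorem or {P Q : α → Prop} (hP : PolyDecidable P) (hQ : PolyDecidable Q) :
    PolyDecidable (fun x => P x ∨ Q x) :=
  (hP.not.and hQ.not).not.congr fun x => by tauto

theorem imp {P Q : α → Prop} (hP : PolyDecidable P) (hQ : PolyDecidable Q) :
    PolyDecidable (fun x => P x → Q x) :=
  (hP.not.or hQ).congr fun x => by tauto

theorem le {f g : α → ℕ} (hf : PolyComputable f) (hg : PolyComputable g) :
    PolyDecidable (fun x => f x ≤ g x) :=
  ((lit 1).sub (hf.sub hg)).congr fun x => by
    by_cases h : f x ≤ g x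
    · rw [truth_true h]; omega
    · rw [truth_false h]; omega

theorem lt {f g : α → ℕ} (hf : PolyComputable f) (hg : PolyComputable g) :
    PolyDecidable (fun x => f x < g x) := le (hf.add (lit 1)) hg

theorem eq {f g : α → ℕ} (hf : PolyComputable f) (hg : PolyComputable g) :
    PolyDecidable (fun x => f x = g x) :=
  ((le hf hg).and (le hg hf)).congr fun x => by omega

/-- A bounded quantifier is decided by counting. -/
theorem exists_lt {b : α → ℕ} {P : α → ℕ → Prop} (hb : PolyComputable b)
    (hle : ∀ x, b x ≤ MachineInput.size (base x))
    (hP : PolyDecidable (fun p : (x : α) × Fin (b x) => P p.1 p.2)) :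
    PolyDecidable (fun x => ∃ i < b x, P x i) := by
  refine (lt (lit 0) (PolyComputable.sum (f := fun x i => truth (P x i)) hb hle hP)).congr
    fun x => ?_
  rw [Finset.sum_pos_iff]
  refine exists_congr fun i => and_congr Finset.mem_range.symm ?_
  by_cases h : P x i <;> simp [truth, h]

theorem forall_lt {b : α → ℕ} {P : α → ℕ → Prop} (hb : PolyComputable b)
    (hle : ∀ x, b x ≤ MachineInput.size (base x))
    (hP : PolyDecidable (fun p : (x : α) × Fin (b x) => P p.1 p.2)) :
    PolyDecidable (fun x => ∀ i < b x, P x i) :=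
  (exists_lt (P := fun x i => ¬ P x i) hb hle hP.not).not.congr fun x => by push Not; rfl

end PolyDecidable

namespace PolyComputable

variable {B α : Type} [MachineInput B] [MachineCtx α B]

open PolyDecidable

/-- A case distinction is an iteration of length `0` or `1`. -/
theorem ite {P : α → Prop} [∀ x, Decidable (P x)] {f g : α → ℕ} (hP : PolyDecidable P)
    (hf : PolyComputable f) (hg : PolyComputable g) :
    PolyComputable (fun x => if P x then f x else g x) := by
  refine (iterFrom (f := fun x _ _ => f x) hP
    (fun x => (truth_le_one _).trans (MachineInput.size_pos (base x))) hg hf.weakB.weak).congr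
    fun x => ?_
  by_cases h : P x <;> simp [h, truth]

/-- Division by counting the multiples of the divisor. -/
theorem div {f g : α → ℕ} (hf : PolyComputable f) (hg : PolyComputable g)
    (hle : ∀ x, f x ≤ MachineInput.size (base x)) (hpos : ∀ x, 0 < g x) :
    PolyComputable (fun x => f x / g x) := by
  refine (sum (f := fun x q => truth ((q + 1) * g x ≤ f x)) hf hle
    (PolyDecidable.le ((newBoundedVar.add (lit 1)).mul hg.weakB fun p => ?_) hf.weakB)).congr
    fun x => ?_
  · exact (Nat.succ_le_of_lt p.2.2).trans (hle p.1)
  · have h : ∀ n, ∑ q ∈ Finset.range n, truth ((q + 1) * g x ≤ f x) = min n (f x / g x) := by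
      intro n
      induction n with
      | zero => simp
      | succ n ih =>
        rw [Finset.sum_range_succ, ih]
        have := Nat.le_div_iff_mul_le (x := n + 1) (y := f x) (hpos x)
        by_cases h : (n + 1) * g x ≤ f x
        · rw [truth_true h]; omega
        · rw [truth_false h]; omega
    rw [h, min_eq_right (Nat.div_le_self _ _)]

theorem mod {f g : α → ℕ} (hf : PolyComputable f) (hg : PolyComputable g)
    (hle : ∀ x, f x ≤ MachineInput.size (base x)) (hpos : ∀ x, 0 < g x) :
    PolyComputable (fun x => f x % g x) := by
  refine (hf.sub ((hf.div hg hle hpos).mul hg fun x => (Nat.div_le_self _ _).trans (hle x))).congr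
    fun x => ?_
  have := Nat.mod_add_div (f x) (g x)
  rw [mul_comm]
  omega

theorem two_pow {f : α → ℕ} (hf : PolyComputable f)
    (hle : ∀ x, f x ≤ MachineInput.size (base x)) : PolyComputable (fun x => 2 ^ f x) := by
  refine (iterFrom (f := fun _ _ acc => acc + acc) hf hle (lit 1) (newVar.add newVar)).congr
    fun x => ?_
  generalize f x = n
  induction n with
  | zero => simp
  | succ n ih => rw [iterFrom_succ, ← ih, pow_succ]; ring

theorem bitSet {b : α → ℕ} {P : α → ℕ → Prop} (hb : PolyComputable b)
    (hle : ∀ x, b x ≤ MachineInput.size (base x))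
    (hP : PolyDecidable (fun p : (x : α) × Fin (b x) => P p.1 p.2)) :
    PolyComputable (fun x => bitSet (b x) (P x)) :=
  sum (f := fun x i => truth (P x i) * 2 ^ i) hb hle (hP.mul (newBoundedVar.two_pow
    fun p => p.2.2.le.trans (hle p.1))
    fun p => (truth_le_one _).trans (MachineInput.size_pos (base p)))

end PolyComputable

/-- Reduction modulo `2 ^ (i + 1)` of a number below `2 ^ N`, by subtracting powers of two. -/
theorem iterFrom_sub_two_pow {X N i : ℕ} (hX : X < 2 ^ N) (hi : i < N) :
    iterFrom X (fun j acc => if i < N - 1 - j ∧ 2 ^ (N - 1 - j) ≤ acc then acc - 2 ^ (N - 1 - j)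
      else acc) N = X % 2 ^ (i + 1) := by
  have h : ∀ j ≤ N, iterFrom X (fun j acc => if i < N - 1 - j ∧ 2 ^ (N - 1 - j) ≤ acc then
      acc - 2 ^ (N - 1 - j) else acc) j = X % 2 ^ max (N - j) (i + 1) := by
    intro j hj
    induction j with
    | zero =>
      rw [iterFrom_zero, Nat.sub_zero, max_eq_left (by omega), Nat.mod_eq_of_lt hX]
    | succ j ih =>
      rw [iterFrom_succ, ih (by omega)]
      by_cases hij : i < N - 1 - j
      · rw [max_eq_left (show i + 1 ≤ N - j by omega), max_eq_left (show i + 1 ≤ N - (j + 1) by omega)]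
        obtain ⟨e, he⟩ : ∃ e, e = N - 1 - j := ⟨_, rfl⟩
        rw [show N - j = e + 1 by omega, show N - (j + 1) = e by omega, ← he]
        have h1 : X % 2 ^ (e + 1) % 2 ^ e = X % 2 ^ e :=
          Nat.mod_mod_of_dvd _ (pow_dvd_pow _ (Nat.le_succ e))
        have h2 : X % 2 ^ (e + 1) < 2 ^ (e + 1) := Nat.mod_lt _ (by positivity)
        have h3 : 2 ^ (e + 1) = 2 * 2 ^ e := by ring
        rw [← h1]
        generalize X % 2 ^ (e + 1) = Y at h2 ⊢
        by_cases hc : 2 ^ e ≤ Y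
        · rw [if_pos ⟨by omega, hc⟩, Nat.mod_eq_sub_mod hc, Nat.mod_eq_of_lt (by omega)]
        · rw [if_neg (fun h => hc h.2), Nat.mod_eq_of_lt (by omega)]
      · rw [if_neg (fun h => hij h.1), max_eq_right (by omega), max_eq_right (by omega)]
  rw [h N le_rfl, Nat.sub_self, max_eq_right (by omega)]

theorem testBit_iff_le_mod (X i : ℕ) : X.testBit i = true ↔ 2 ^ i ≤ X % 2 ^ (i + 1) := by
  have h : (X % 2 ^ (i + 1)).testBit i = X.testBit i := by simp [Nat.testBit_mod_two_pow]
  rw [← h]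
  constructor
  · exact Nat.ge_two_pow_of_testBit
  · intro hle
    by_contra hb
    have hlt : X % 2 ^ (i + 1) < 2 ^ (i + 1) := Nat.mod_lt _ (by positivity)
    have := Nat.lt_pow_two_of_testBit (n := i) (X % 2 ^ (i + 1)) fun j hj => by
      rcases hj.lt_or_eq with hj | rfl
      · exact Nat.testBit_lt_two_pow (hlt.trans_le (Nat.pow_le_pow_right (by omega) hj))
      · simpa using hb
    omega

/-- A bit of a number with polynomially many binary digits. Division would take too long for such a
number, but its higher bits can be subtracted one after the other. -/
theorem PolyDecidable.testBit {B α : Type} [MachineInput B] [MachineCtx α B] {f g : α → ℕ}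
    (hf : PolyComputable f) (hg : PolyComputable g)
    (hlt : ∀ x, f x < 2 ^ MachineInput.size (base x)) (hlt' : ∀ x, g x < MachineInput.size (base x)) :
    PolyDecidable (fun x => (f x).testBit (g x) = true) := by
  have hpos : PolyComputable fun p : ((x : α) × Fin (MachineInput.size (base x))) × ℕ =>
      MachineInput.size (base p.1.1) - 1 - p.1.2 :=
    (PolyComputable.inputSize.sub (.lit 1)).weakB.sub .newBoundedVar |>.weak
  have hpow := hpos.two_pow fun p => (Nat.sub_le _ _).trans (Nat.sub_le _ _)
  refine (PolyDecidable.le (hg.two_pow fun x => (hlt' x).le) (PolyComputable.iterFrom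
    (f := fun x j acc => if g x < MachineInput.size (base x) - 1 - j ∧
      2 ^ (MachineInput.size (base x) - 1 - j) ≤ acc then
      acc - 2 ^ (MachineInput.size (base x) - 1 - j) else acc)
    .inputSize (fun _ => le_rfl) hf (.ite ((lt hg.weakB.weak hpos).and (le hpow .newVar))
      (.sub .newVar hpow) .newVar))).congr fun x => ?_
  rw [iterFrom_sub_two_pow (hlt x) (hlt' x), testBit_iff_le_mod]

/-! ### Identifications as maps onto the target graph -/

/-- A map onto `H` along which `G` can be identified to `H`: every edge of `G` is contracted or
mapped to an edge of `H`, and every vertex and every edge of `H` is reached. -/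
structure IsIdentificationMap {V W : Type} (G : SimpleGraph V) (H : SimpleGraph W) (f : V → W) :
    Prop where
  surjective : Function.Surjective f
  adj_or_eq : ∀ ⦃u v⦄, G.Adj u v → f u = f v ∨ H.Adj (f u) (f v)
  exists_adj : ∀ ⦃a b⦄, H.Adj a b → ∃ u v, f u = a ∧ f v = b ∧ G.Adj u v

section Identify

variable {V W : Type} {G : SimpleGraph V} {H : SimpleGraph W} {u v : V}

open Classical in
/-- The map from the vertices of `G` to those of `G.identify u v`. -/
noncomputable def identifyMap (u v : V) (x : V) : Option {x : V // x ≠ u ∧ x ≠ v} :=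
  if h : x ≠ u ∧ x ≠ v then some ⟨x, h⟩ else none

theorem identifyMap_left : identifyMap u v u = none := dif_neg (by simp)

theorem identifyMap_right : identifyMap u v v = none := dif_neg (by simp)

theorem identifyMap_of_ne (x : {x : V // x ≠ u ∧ x ≠ v}) : identifyMap u v x = some x :=
  dif_pos x.2

theorem identifyMap_eq_none {x : V} (h : identifyMap u v x = none) : x = u ∨ x = v := by
  by_contra hx
  push Not at hx
  simp [identifyMap, hx] at h

theorem isIdentificationMap_identifyMap (u v : V) :
    IsIdentificationMap G (G.identify u v) (identifyMap u v) where
  surjective := by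
    rintro (_ | x)
    · exact ⟨u, identifyMap_left⟩
    · exact ⟨x, identifyMap_of_ne x⟩
  adj_or_eq := by
    intro a b hab
    rcases ha : identifyMap u v a with _ | x <;> rcases hb : identifyMap u v b with _ | y
    · exact Or.inl rfl
    · right
      have hy : y.1 = b := by
        by_cases h : b ≠ u ∧ b ≠ v
        · simp only [identifyMap, dif_pos h, Option.some.injEq] at hb; rw [← hb]
        · simp [identifyMap, dif_neg h] at hb
      rcases identifyMap_eq_none ha with rfl | rfl
      · exact Or.inl (hy ▸ hab)
      · exact Or.inr (hy ▸ hab)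
    · right
      have hx : x.1 = a := by
        by_cases h : a ≠ u ∧ a ≠ v
        · simp only [identifyMap, dif_pos h, Option.some.injEq] at ha; rw [← ha]
        · simp [identifyMap, dif_neg h] at ha
      rcases identifyMap_eq_none hb with rfl | rfl
      · exact Or.inl (hx ▸ hab.symm)
      · exact Or.inr (hx ▸ hab.symm)
    · right
      have hx : x.1 = a := by
        by_cases h : a ≠ u ∧ a ≠ v
        · simp only [identifyMap, dif_pos h, Option.some.injEq] at ha; rw [← ha]
        · simp [identifyMap, dif_neg h] at ha
      have hy : y.1 = b := by
        by_cases h : b ≠ u ∧ b ≠ v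
        · simp only [identifyMap, dif_pos h, Option.some.injEq] at hb; rw [← hb]
        · simp [identifyMap, dif_neg h] at hb
      change G.Adj x.1 y.1
      rwa [hx, hy]
  exists_adj := by
    rintro (_ | x) (_ | y) h
    · exact absurd h (SimpleGraph.irrefl _)
    · rcases h with h | h
      · exact ⟨u, y, identifyMap_left, identifyMap_of_ne y, h⟩
      · exact ⟨v, y, identifyMap_right, identifyMap_of_ne y, h⟩
    · rcases h with h | h
      · exact ⟨x, u, identifyMap_of_ne x, identifyMap_left, h.symm⟩
      · exact ⟨x, v, identifyMap_of_ne x, identifyMap_right, h.symm⟩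
    · exact ⟨x, y, identifyMap_of_ne x, identifyMap_of_ne y, h⟩

theorem IsIdentificationMap.comp {U : Type} {K : SimpleGraph U} {f : V → W} {g : W → U}
    (hg : IsIdentificationMap H K g) (hf : IsIdentificationMap G H f) :
    IsIdentificationMap G K (g ∘ f) where
  surjective := hg.surjective.comp hf.surjective
  adj_or_eq := by
    intro a b hab
    rcases hf.adj_or_eq hab with h | h
    · exact Or.inl (congrArg g h)
    · exact hg.adj_or_eq h
  exists_adj := by
    intro a b hab
    obtain ⟨x, y, rfl, rfl, hxy⟩ := hg.exists_adj hab
    obtain ⟨x', y', rfl, rfl, hxy'⟩ := hf.exists_adj hxy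
    exact ⟨x', y', rfl, rfl, hxy'⟩

/-- If an identification map is not injective, then the identification of two vertices with the same
image leaves a smaller graph, which has an identification map again. -/
theorem IsIdentificationMap.canBeIdentifiedTo [Finite V] {f : V → W}
    (hf : IsIdentificationMap G H f) : CanBeIdentifiedTo G H := by
  obtain ⟨n, hn⟩ : ∃ n, Nat.card V = n := ⟨_, rfl⟩
  induction n using Nat.strong_induction_on generalizing V with
  | _ n ih =>
    by_cases hinj : Function.Injective f
    · refine .iso ⟨Equiv.ofBijective f ⟨hinj, hf.surjective⟩, @fun a b => ⟨fun h => ?_, fun h => ?_⟩⟩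
      · obtain ⟨x, y, hx, hy, hxy⟩ := hf.exists_adj h
        rwa [hinj hx, hinj hy] at hxy
      · exact (hf.adj_or_eq h).resolve_left fun e => h.ne (hinj e)
    · obtain ⟨u, v, huv, hne⟩ : ∃ u v, f u = f v ∧ u ≠ v := by
        simpa [Function.Injective] using hinj
      let g : Option {x : V // x ≠ u ∧ x ≠ v} → W := fun x => x.elim (f u) fun y => f y
      have hgf : ∀ x, g (identifyMap u v x) = f x := by
        intro x
        by_cases h : x ≠ u ∧ x ≠ v
        · rw [show identifyMap u v x = some ⟨x, h⟩ from dif_pos h]; rfl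
        · rw [show identifyMap u v x = none from dif_neg h]
          by_cases hxu : x = u
          · rw [hxu]; rfl
          · have hxv : x = v := by
              by_contra hxv
              exact h ⟨hxu, hxv⟩
            rw [hxv]; exact huv
      have hq := isIdentificationMap_identifyMap (G := G) u v
      have hg : IsIdentificationMap (G.identify u v) H g := by
        refine ⟨fun w => ?_, fun a b hab => ?_, fun a b hab => ?_⟩
        · obtain ⟨x, rfl⟩ := hf.surjective w
          exact ⟨_, hgf x⟩
        · obtain ⟨x, y, rfl, rfl, hxy⟩ := hq.exists_adj hab
          rw [hgf, hgf]
          exact hf.adj_or_eq hxy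
        · obtain ⟨x, y, rfl, rfl, hxy⟩ := hf.exists_adj hab
          refine ⟨_, _, hgf x, hgf y, (hq.adj_or_eq hxy).resolve_left fun e => ?_⟩
          have := congrArg g e
          rw [hgf, hgf] at this
          exact hab.ne this
      have hcard : Nat.card (Option {x : V // x ≠ u ∧ x ≠ v}) < n := by
        rw [← hn]
        have := Fintype.ofFinite V
        have := Fintype.ofFinite (Option {x : V // x ≠ u ∧ x ≠ v})
        rw [Nat.card_eq_fintype_card, Nat.card_eq_fintype_card]
        exact Fintype.card_lt_of_surjective_not_injective _ hq.surjective fun hi =>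
          hne (hi (identifyMap_left.trans identifyMap_right.symm))
      exact .step u v hne (ih _ hcard hg rfl)

theorem canBeIdentifiedTo_iff [Finite V] :
    CanBeIdentifiedTo G H ↔ ∃ f, IsIdentificationMap G H f := by
  refine ⟨fun h => ?_, fun ⟨f, hf⟩ => hf.canBeIdentifiedTo⟩
  induction h with
  | iso e =>
    refine ⟨e, e.surjective, fun u v h => Or.inr (e.map_rel_iff.mpr h), fun a b h =>
      ⟨e.symm a, e.symm b, e.apply_symm_apply a, e.apply_symm_apply b, ?_⟩⟩
    exact e.symm.map_rel_iff.mpr h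
  | step u v _ _ ih =>
    obtain ⟨f, hf⟩ := ih
    exact ⟨_, hf.comp (isIdentificationMap_identifyMap u v)⟩

end Identify

/-! ### Rooted forests -/

/-- A rooting of a forest: every vertex has a depth, and a parent unless its depth is `0`. The edges
are the pairs of a vertex and its parent; the function `par` fixes the roots. -/
structure Rooting {W : Type} (F : SimpleGraph W) where
  dep : W → ℕ
  par : W → W
  dep_par : ∀ v, dep (par v) = dep v - 1
  par_root : ∀ v, dep v = 0 → par v = v
  adj_par : ∀ v, dep v ≠ 0 → F.Adj v (par v)
  of_adj : ∀ v w, F.Adj v w → (dep w = dep v + 1 ∧ par w = v) ∨ (dep v = dep w + 1 ∧ par v = w)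

/-- The depth of a vertex is its distance from a vertex chosen in its component. -/
theorem SimpleGraph.IsAcyclic.exists_rooting {W : Type} {F : SimpleGraph W} (hF : F.IsAcyclic) :
    Nonempty (Rooting F) := by
  classical
  let root : W → W := fun v => (F.connectedComponentMk v).out
  have hr : ∀ v, F.Reachable (root v) v := fun v =>
    SimpleGraph.ConnectedComponent.exact (Quot.out_eq (F.connectedComponentMk v))
  have hroot : ∀ v w, F.Adj v w → root v = root w := fun v w h =>
    congrArg Quot.out (SimpleGraph.ConnectedComponent.sound h.reachable)
  let dep : W → ℕ := fun v => F.dist (root v) v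
  have hex : ∀ v, ∃ w, (dep v = 0 → w = v) ∧ (dep v ≠ 0 → F.Adj v w ∧ dep v = dep w + 1) := by
    intro v
    by_cases h0 : dep v = 0
    · exact ⟨v, fun _ => rfl, fun h => absurd h0 h⟩
    obtain ⟨p, hp⟩ := (hr v).exists_walk_length_eq_dist
    have hnil : ¬ p.Nil := fun h => h0 (by
      exact hp.symm.trans (SimpleGraph.Walk.length_eq_zero_iff.mpr h))
    have hadj := p.adj_penultimate hnil
    refine ⟨p.penultimate, fun h => absurd h h0, fun _ => ⟨hadj.symm, ?_⟩⟩
    have hdrop := SimpleGraph.dist_le p.dropLast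
    have hlen : p.dropLast.length + 1 = p.length := SimpleGraph.Walk.length_dropLast_add_one hnil
    have hrt : root p.penultimate = root v := hroot _ _ hadj
    have := hadj.diff_dist_adj (u := root v)
    change F.dist (root v) v = F.dist (root p.penultimate) p.penultimate + 1
    change ¬ F.dist (root v) v = 0 at h0
    rw [hrt]
    rcases this with h | h | h <;> omega
  choose par hpar0 hpar1 using hex
  refine ⟨⟨dep, par, fun v => ?_, hpar0, fun v h => (hpar1 v h).1, fun v w hvw => ?_⟩⟩
  · by_cases h : dep v = 0
    · rw [hpar0 v h]; omega
    · have := (hpar1 v h).2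
      omega
  · have key : ∀ v w, F.Adj v w → dep w = dep v + 1 → par w = v := by
      intro v w hvw hd
      have hw := hpar1 w (by omega)
      -- both vertices are the penultimate vertex of the path from the root
      have hpath : ∀ z, F.Adj w z → dep w = dep z + 1 → ∃ p : F.Walk (root w) w, p.IsPath ∧
          p.penultimate = z := by
        intro z hz hdz
        have e := hroot _ _ hz
        obtain ⟨p, hp⟩ := (hr z).exists_walk_length_eq_dist
        refine ⟨(p.concat hz.symm).copy e.symm rfl, ?_, ?_⟩
        · apply SimpleGraph.Walk.isPath_of_length_eq_dist
          rw [SimpleGraph.Walk.length_copy, SimpleGraph.Walk.length_concat, hp]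
          exact hdz.symm
        · rw [SimpleGraph.Walk.penultimate, SimpleGraph.Walk.getVert_copy,
            SimpleGraph.Walk.length_copy]
          exact SimpleGraph.Walk.penultimate_concat p hz.symm
      obtain ⟨p, hp, h1⟩ := hpath _ hw.1 hw.2
      obtain ⟨q, hq, h2⟩ := hpath v hvw.symm hd
      have := (hF.subsingleton_path _ _).elim ⟨p, hp⟩ ⟨q, hq⟩
      have hpq : p = q := congrArg Subtype.val this
      rw [← h1, ← h2, hpq]
    have h1 := hF.dist_eq_dist_add_one_of_adj_of_reachable (root v) hvw (hr v)
    have h2 : dep w = F.dist (root v) w := by rw [hroot v w hvw]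
    rcases h1 with h | h
    · exact Or.inr ⟨h2 ▸ h, key w v hvw.symm (h2 ▸ h)⟩
    · exact Or.inl ⟨h2 ▸ h, key v w hvw (h2 ▸ h)⟩

namespace Rooting

variable {W : Type} {F : SimpleGraph W} (R : Rooting F)

theorem dep_iterate (i : ℕ) (x : W) : R.dep (R.par^[i] x) = R.dep x - i := by
  induction i generalizing x with
  | zero => rfl
  | succ i ih => rw [Function.iterate_succ_apply, ih, R.dep_par]; omega

/-- The ancestor of `x` at depth `h`, for `h ≤ dep x`. -/
def anc (h : ℕ) (x : W) : W := R.par^[R.dep x - h] x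

theorem anc_dep (x : W) : R.anc (R.dep x) x = x := by simp [anc]

theorem dep_anc {h : ℕ} {x : W} (hx : h ≤ R.dep x) : R.dep (R.anc h x) = h := by
  rw [anc, dep_iterate]; omega

theorem anc_par {h : ℕ} {x : W} (hx : h < R.dep x) : R.anc h (R.par x) = R.anc h x := by
  rw [anc, anc, R.dep_par, show R.dep x - h = R.dep x - 1 - h + 1 by omega,
    Function.iterate_succ_apply]

theorem par_anc {h : ℕ} {x : W} (hx : h + 1 ≤ R.dep x) :
    R.par (R.anc (h + 1) x) = R.anc h x := by
  rw [anc, anc, show R.dep x - h = R.dep x - (h + 1) + 1 by omega, Function.iterate_succ_apply']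

theorem anc_anc {g h : ℕ} {x : W} (hg : g ≤ h) (hx : h ≤ R.dep x) :
    R.anc g (R.anc h x) = R.anc g x := by
  rw [anc, R.dep_anc hx, anc, anc, ← Function.iterate_add_apply]
  congr 2
  omega

/-- `x` lies in the subtree of `v`. -/
def Below (x v : W) : Prop := R.dep v ≤ R.dep x ∧ R.anc (R.dep v) x = v

theorem below_refl (v : W) : R.Below v v := ⟨le_rfl, R.anc_dep v⟩

theorem not_below_par {v : W} (hv : R.dep v ≠ 0) : ¬ R.Below (R.par v) v := fun h => by
  have := h.1
  rw [R.dep_par] at this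
  omega

theorem Below.trans {x y z : W} (h : R.Below x y) (h' : R.Below y z) : R.Below x z :=
  ⟨h'.1.trans h.1, by rw [← R.anc_anc h'.1 h.1, h.2, h'.2]⟩

theorem below_anc {h : ℕ} {x : W} (hx : h ≤ R.dep x) : R.Below x (R.anc h x) := by
  refine ⟨by rwa [R.dep_anc hx], by rw [R.dep_anc hx]⟩

/-- Ancestors of the same vertex are comparable. -/
theorem Below.of_dep_le {x v w : W} (hv : R.Below x v) (hw : R.Below x w)
    (h : R.dep w ≤ R.dep v) : R.Below v w :=
  ⟨h, by rw [← hv.2, R.anc_anc h hv.1, hw.2]⟩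

theorem below_antisymm {v w : W} (h : R.Below v w) (h' : R.Below w v) : v = w := by
  rw [← h.2, ← le_antisymm h'.1 h.1, R.anc_dep]

/-- The only edge that leaves the subtree of `v` joins `v` to its parent. -/
theorem eq_of_adj_of_below {x y v : W} (h : F.Adj x y) (hx : R.Below x v) (hy : ¬ R.Below y v) :
    x = v ∧ y = R.par v ∧ R.dep v ≠ 0 := by
  rcases R.of_adj x y h with ⟨hd, hp⟩ | ⟨hd, hp⟩
  · exact absurd ⟨by have := hx.1; omega, by
      rw [← R.anc_par (by have := hx.1; omega), hp, hx.2]⟩ hy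
  · rcases hx.1.eq_or_lt with he | hlt
    · have : x = v := by rw [← hx.2, he, R.anc_dep]
      subst this
      exact ⟨rfl, hp.symm, by omega⟩
    · exact absurd ⟨by omega, by rw [← hp, R.anc_par hlt, hx.2]⟩ hy

theorem reachable_anc (h : ℕ) (x : W) : F.Reachable x (R.anc h x) := by
  rw [anc]
  induction R.dep x - h with
  | zero => exact SimpleGraph.Reachable.refl _
  | succ n ih =>
    rw [Function.iterate_succ_apply']
    by_cases h0 : R.dep (R.par^[n] x) = 0
    · rwa [R.par_root _ h0]
    · exact ih.trans (R.adj_par _ h0).reachable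

theorem Below.reachable {x v : W} (h : R.Below x v) : F.Reachable x v := by
  have := R.reachable_anc (R.dep v) x
  rwa [h.2] at this

theorem dep_le_of_walk {a b : W} (p : F.Walk a b) : R.dep a ≤ R.dep b + p.length := by
  induction p with
  | nil => simp
  | cons h p ih =>
    rw [SimpleGraph.Walk.length_cons]
    rcases R.of_adj _ _ h with h | h <;> omega

/-- Two vertices joined by a walk have the same ancestor at every depth that a walk of its length
cannot pass. -/
theorem anc_eq_of_walk {a b : W} (p : F.Walk a b) {h : ℕ} (ha : h ≤ R.dep a) (hb : h ≤ R.dep b)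
    (hp : h = 0 ∨ 2 * h + p.length ≤ R.dep a + R.dep b + 1) : R.anc h a = R.anc h b := by
  induction p with
  | nil => rfl
  | @cons a c b hac p ih =>
    have hlen := R.dep_le_of_walk p.reverse
    simp only [SimpleGraph.Walk.length_reverse, SimpleGraph.Walk.length_cons] at hlen hp
    rcases R.of_adj _ _ hac with ⟨hd, hpar⟩ | ⟨hd, hpar⟩
    · rw [← ih (by omega) hb (by omega), ← hpar, R.anc_par (by omega)]
    · rw [← ih (by omega) hb (by omega), ← hpar, R.anc_par (by omega)]

/-- A walk that leaves the subtree of `v` passes the edge from `v` to its parent. -/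
theorem exists_walks_of_below {a b v : W} (p : F.Walk a b) (ha : R.Below a v)
    (hb : ¬ R.Below b v) :
    ∃ (q : F.Walk a v) (r : F.Walk (R.par v) b), q.length + 1 + r.length = p.length := by
  induction p with
  | nil => exact absurd ha hb
  | @cons a c b hac p ih =>
    by_cases hc : R.Below c v
    · obtain ⟨q, r, h⟩ := ih hc hb
      exact ⟨.cons hac q, r, by simp only [SimpleGraph.Walk.length_cons]; omega⟩
    · obtain ⟨rfl, rfl, -⟩ := R.eq_of_adj_of_below hac ha hc
      exact ⟨.nil, p, by simp only [SimpleGraph.Walk.length_cons, SimpleGraph.Walk.length_nil]; omega⟩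

end Rooting

/-- The distance of two vertices, where vertices in different components have distance `N`. (The
distance `SimpleGraph.dist` of such vertices is `0`.) -/
noncomputable def truncDist {W : Type} (N : ℕ) (F : SimpleGraph W) (a b : W) : ℕ :=
  open Classical in if F.Reachable a b then F.dist a b else N

theorem truncDist_of_reachable {W : Type} {N : ℕ} {F : SimpleGraph W} {a b : W}
    (h : F.Reachable a b) : truncDist N F a b = F.dist a b := if_pos h

theorem truncDist_of_not_reachable {W : Type} {N : ℕ} {F : SimpleGraph W} {a b : W}
    (h : ¬ F.Reachable a b) : truncDist N F a b = N := if_neg h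

theorem SimpleGraph.Reachable.dist_lt_card {W : Type} [Fintype W] {F : SimpleGraph W} {a b : W}
    (h : F.Reachable a b) : F.dist a b < Fintype.card W := by
  obtain ⟨p, hp, hl⟩ := h.exists_path_of_dist
  rw [← hl]
  exact hp.length_lt

namespace Rooting

variable {W : Type} {F : SimpleGraph W} (R : Rooting F) {N : ℕ} {a v : W}

theorem truncDist_lt_of_below (hv : R.dep v ≠ 0) (h : R.Below a v) :
    truncDist N F a v < truncDist N F a (R.par v) := by
  have hr := h.reachable
  have hr' := hr.trans (R.adj_par v hv).reachable
  obtain ⟨p, hp⟩ := hr'.exists_walk_length_eq_dist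
  obtain ⟨q, r, hqr⟩ := R.exists_walks_of_below p h (R.not_below_par hv)
  rw [truncDist_of_reachable hr, truncDist_of_reachable hr']
  have := SimpleGraph.dist_le q
  omega

theorem truncDist_lt_of_not_below (hv : R.dep v ≠ 0) (hr : F.Reachable a v) (h : ¬ R.Below a v) :
    truncDist N F a (R.par v) < truncDist N F a v := by
  have hr' := hr.trans (R.adj_par v hv).reachable
  obtain ⟨p, hp⟩ := hr.symm.exists_walk_length_eq_dist
  obtain ⟨q, r, hqr⟩ := R.exists_walks_of_below p (R.below_refl v) h
  rw [truncDist_of_reachable hr, truncDist_of_reachable hr', F.dist_comm]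
  have := SimpleGraph.dist_le r
  rw [F.dist_comm] at hp
  rw [F.dist_comm (u := a) (v := v), F.dist_comm (u := v) (v := a)] at *
  omega

theorem reachable_of_truncDist_ne (hv : R.dep v ≠ 0)
    (h : truncDist N F a v ≠ truncDist N F a (R.par v)) : F.Reachable a v := by
  by_contra hr
  have hr' : ¬ F.Reachable a (R.par v) := fun h' => hr (h'.trans (R.adj_par v hv).symm.reachable)
  rw [truncDist_of_not_reachable hr, truncDist_of_not_reachable hr'] at h
  exact h rfl

/-- Distances tell on which side of an edge a vertex lies. -/
theorem truncDist_lt_iff (hv : R.dep v ≠ 0) :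
    truncDist N F a v < truncDist N F a (R.par v) ↔ R.Below a v := by
  refine ⟨fun h => ?_, R.truncDist_lt_of_below hv⟩
  by_contra hb
  have := R.truncDist_lt_of_not_below (N := N) hv (R.reachable_of_truncDist_ne hv h.ne) hb
  omega

theorem truncDist_lt_iff' (hv : R.dep v ≠ 0) :
    truncDist N F a (R.par v) < truncDist N F a v ↔ F.Reachable a v ∧ ¬ R.Below a v := by
  refine ⟨fun h => ⟨R.reachable_of_truncDist_ne hv h.ne', fun hb => ?_⟩, fun h =>
    R.truncDist_lt_of_not_below hv h.1 h.2⟩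
  have := R.truncDist_lt_of_below (N := N) hv hb
  omega

end Rooting

/-! ### Extending partial maps into a forest -/

namespace Rooting

variable {V W ι : Type} {G : SimpleGraph V} {F : SimpleGraph W} (R : Rooting F)

/-- Two deepest lower bounds on the image of a vertex, for adjacent or equal vertices `x` and `y`:
the shallower one is an ancestor of the other one, at most one step above it. -/
theorem anc_eq_of_extremal {u : ι → V} {a : ι → W}
    (hlip : ∀ i j, G.Reachable (u i) (u j) → ∃ p : F.Walk (a i) (a j), p.length ≤ G.dist (u i) (u j))
    {i j : ι} {x y : V} (hx : G.Reachable (u i) x) (hy : G.Reachable (u j) y)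
    (q : G.Walk x y) (hq : q.length ≤ 1)
    (hle : R.dep (a j) - G.dist (u j) y ≤ R.dep (a i) - G.dist (u i) x) :
    R.anc (R.dep (a j) - G.dist (u j) y) (a i) = R.anc (R.dep (a j) - G.dist (u j) y) (a j) := by
  obtain ⟨p₁, hp₁⟩ := hx.exists_walk_length_eq_dist
  obtain ⟨p₂, hp₂⟩ := hy.exists_walk_length_eq_dist
  obtain ⟨p, hp⟩ := hlip i j ((hx.trans q.reachable).trans hy.symm)
  have h := SimpleGraph.dist_le ((p₁.append q).append p₂.reverse)
  simp only [SimpleGraph.Walk.length_append, SimpleGraph.Walk.length_reverse] at h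
  exact R.anc_eq_of_walk p (by omega) (by omega) (by omega)

/-- A partial map into a forest that does not increase distances extends to all vertices. Each
vertex `x` is sent to the deepest one of the vertices that are reached from some `a i` by
`dist (u i) x` steps towards the root. -/
theorem exists_extension (R : Rooting F) [Finite ι] [Nonempty W] (u : ι → V) (a : ι → W)
    (hlip : ∀ i j, G.Reachable (u i) (u j) →
      ∃ p : F.Walk (a i) (a j), p.length ≤ G.dist (u i) (u j)) :
    ∃ f : V → W, (∀ x y, G.Adj x y → f x = f y ∨ F.Adj (f x) (f y)) ∧ ∀ i, f (u i) = a i := by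
  classical
  have hex : ∀ x, ∃ w : W, ((∀ i, ¬ G.Reachable (u i) x) → w = Classical.arbitrary W) ∧
      ∀ i, G.Reachable (u i) x → ∃ j, G.Reachable (u j) x ∧
        w = R.anc (R.dep (a j) - G.dist (u j) x) (a j) ∧
        ∀ i, G.Reachable (u i) x → R.dep (a i) - G.dist (u i) x ≤ R.dep (a j) - G.dist (u j) x := by
    intro x
    by_cases h : ∃ i, G.Reachable (u i) x
    · have : Nonempty {i // G.Reachable (u i) x} := ⟨⟨_, h.choose_spec⟩⟩
      obtain ⟨j, hj⟩ := Finite.exists_max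
        fun i : {i // G.Reachable (u i) x} => R.dep (a i) - G.dist (u i) x
      exact ⟨_, fun h' => absurd h (by simpa using h'), fun _ _ => ⟨j, j.2, rfl, fun i hi =>
        hj ⟨i, hi⟩⟩⟩
    · exact ⟨_, fun _ => rfl, fun i hi => absurd ⟨i, hi⟩ h⟩
  choose f hf₀ hf using hex
  have key : ∀ x y, G.Adj x y → ∀ i j, G.Reachable (u i) x → G.Reachable (u j) y →
      (f x = R.anc (R.dep (a i) - G.dist (u i) x) (a i)) →
      (f y = R.anc (R.dep (a j) - G.dist (u j) y) (a j)) →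
      R.dep (a i) - G.dist (u i) y ≤ R.dep (a j) - G.dist (u j) y →
      R.dep (a j) - G.dist (u j) y ≤ R.dep (a i) - G.dist (u i) x →
      f x = f y ∨ F.Adj (f x) (f y) := by
    intro x y hxy i j hi hj hfx hfy hmax hle
    have h := R.anc_eq_of_extremal hlip hi hj (SimpleGraph.Walk.cons hxy .nil) le_rfl hle
    have hd : G.dist (u i) y ≤ G.dist (u i) x + 1 := by
      have := hxy.diff_dist_adj (u := u i)
      omega
    rw [hfx, hfy, ← h]
    rcases hle.eq_or_lt with he | hlt
    · left; rw [he]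
    · right
      have he : R.dep (a i) - G.dist (u i) x = R.dep (a j) - G.dist (u j) y + 1 := by
        clear h hfx hfy hf hf₀ hlip
        omega
      rw [he, ← R.par_anc (h := R.dep (a j) - G.dist (u j) y) (x := a i) (by omega)]
      exact R.adj_par _ (by rw [R.dep_anc (by omega)]; omega)
  refine ⟨f, fun x y hxy => ?_, fun k => ?_⟩
  · by_cases h : ∃ i, G.Reachable (u i) x
    · obtain ⟨i₀, hi₀⟩ := h
      obtain ⟨i, hi, hfx, hmx⟩ := hf x i₀ hi₀
      obtain ⟨j, hj, hfy, hmy⟩ := hf y i₀ (hi₀.trans hxy.reachable)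
      rcases le_total (R.dep (a j) - G.dist (u j) y) (R.dep (a i) - G.dist (u i) x) with hle | hle
      · exact key x y hxy i j hi hj hfx hfy (hmy i (hi.trans hxy.reachable)) hle
      · rcases key y x hxy.symm j i hj hi hfy hfx (hmx j (hj.trans hxy.symm.reachable)) hle with h | h
        · exact Or.inl h.symm
        · exact Or.inr h.symm
    · left
      rw [hf₀ x (by simpa using h), hf₀ y fun i hi => h ⟨i, hi.trans hxy.symm.reachable⟩]
  · obtain ⟨i, hi, hfx, hmx⟩ := hf (u k) k (SimpleGraph.Reachable.refl _)
    have hk := hmx k (SimpleGraph.Reachable.refl _)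
    obtain ⟨p, hp⟩ := hlip i k hi
    have hlen := R.dep_le_of_walk p
    have h := R.anc_eq_of_extremal hlip hi (SimpleGraph.Reachable.refl (u k)) .nil (by simp) hk
    rw [SimpleGraph.dist_self, Nat.sub_zero] at hk h
    rw [hfx, show R.dep (a i) - G.dist (u i) (u k) = R.dep (a k) by omega, h, R.anc_dep]

/-- Along a walk whose image leaves the subtree of `v`, some edge is mapped to the edge from `v` to
its parent. -/
theorem exists_adj_of_below {f : V → W} (hf : ∀ x y, G.Adj x y → f x = f y ∨ F.Adj (f x) (f y))
    {x y : V} (p : G.Walk x y) {v : W} (hx : R.Below (f x) v) (hy : ¬ R.Below (f y) v) :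
    R.dep v ≠ 0 ∧ ∃ x' y', f x' = v ∧ f y' = R.par v ∧ G.Adj x' y' ∧ G.Reachable x x' := by
  induction p with
  | nil => exact absurd hx hy
  | @cons x z y hxz p ih =>
    by_cases hz : R.Below (f z) v
    · obtain ⟨h0, x', y', h1, h2, h3, h4⟩ := ih hz hy
      exact ⟨h0, x', y', h1, h2, h3, hxz.reachable.trans h4⟩
    · rcases hf x z hxz with h | h
      · exact absurd (h ▸ hx) hz
      · obtain ⟨h1, h2, h0⟩ := R.eq_of_adj_of_below h hx hz
        exact ⟨h0, x, z, h1, h2, hxz, SimpleGraph.Reachable.refl _⟩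

/-- A partial map that does not increase distances extends to an identification map if the pairs of
its values whose arguments lie in a common component separate the ends of every edge, and every
isolated vertex is one of its values. -/
theorem exists_isIdentificationMap (R : Rooting F) [Finite ι] [Nonempty W] (u : ι → V) (a : ι → W)
    (hlip : ∀ i j, G.Reachable (u i) (u j) →
      ∃ p : F.Walk (a i) (a j), p.length ≤ G.dist (u i) (u j))
    (hcov : ∀ v, R.dep v ≠ 0 → ∃ i j, G.Reachable (u i) (u j) ∧ R.Below (a i) v ∧
      ¬ R.Below (a j) v)
    (hiso : ∀ v, (∀ w, ¬ F.Adj v w) → ∃ i, a i = v) :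
    ∃ f : V → W, IsIdentificationMap G F f := by
  obtain ⟨f, hf, hfa⟩ := R.exists_extension u a hlip
  have hedge : ∀ v, R.dep v ≠ 0 → ∃ x y, f x = v ∧ f y = R.par v ∧ G.Adj x y := by
    intro v hv
    obtain ⟨i, j, ⟨p⟩, hi, hj⟩ := hcov v hv
    obtain ⟨-, x, y, h1, h2, h3, -⟩ :=
      R.exists_adj_of_below hf p (by rwa [hfa]) (by rwa [hfa])
    exact ⟨x, y, h1, h2, h3⟩
  refine ⟨f, fun v => ?_, hf, fun v w hvw => ?_⟩
  · by_cases h : ∀ w, ¬ F.Adj v w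
    · obtain ⟨i, rfl⟩ := hiso v h
      exact ⟨_, hfa i⟩
    · push Not at h
      obtain ⟨w, hvw⟩ := h
      rcases R.of_adj v w hvw with ⟨hd, rfl⟩ | ⟨hd, rfl⟩
      · obtain ⟨x, y, -, h2, -⟩ := hedge w (by omega)
        exact ⟨y, h2⟩
      · obtain ⟨x, y, h1, -, -⟩ := hedge v (by omega)
        exact ⟨x, h1⟩
  · rcases R.of_adj v w hvw with ⟨hd, rfl⟩ | ⟨hd, rfl⟩
    · obtain ⟨x, y, h1, h2, h3⟩ := hedge w (by omega)
      exact ⟨y, x, h2, h1, h3.symm⟩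
    · exact hedge v (by omega)

end Rooting

/-! ### Certificates -/

/-- `a` is closer to `p` than to `q`. For an edge `pq` of a forest this says that `a` lies on the
side of `p` when the edge is removed. -/
def Closer {W : Type} (N : ℕ) (F : SimpleGraph W) (a p q : W) : Prop :=
  truncDist N F a p < truncDist N F a q

/-- The component of `i` may be used to cover a piece of length `d` of a path: `i` is the smallest
vertex of its component, which contains none of the vertices `u 0, …, u (m - 1)`, and two vertices
of the component have distance at least `d`. -/
structure IsFreePiece {n : ℕ} (G : SimpleGraph (Fin n)) (m : ℕ) (u : ℕ → Fin n) (i : Fin n) (d : ℕ) :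
    Prop where
  untouched : ∀ j < m, ¬ truncDist n G (u j) i < n
  minimal : ∀ i' < i, ¬ truncDist n G i' i < n
  long : ∃ v w, truncDist n G i v < n ∧ truncDist n G i w < n ∧ d ≤ truncDist n G v w

/-- The edge `pq` is covered, in this direction, by two of the pairs `(u i, a i)`, or by one of the
paths from `x j` to `y j`. -/
def IsCovered {n k : ℕ} (G : SimpleGraph (Fin n)) (F : SimpleGraph (Fin k)) (m₁ m : ℕ)
    (u : ℕ → Fin n) (a x y : ℕ → Fin k) (p q : Fin k) : Prop :=
  (∃ i < m₁, ∃ j < m₁, truncDist n G (u i) (u j) < n ∧ Closer n F (a i) p q ∧ Closer n F (a j) q p) ∨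
    ∃ j < m, Closer n F (x j) p q ∧ Closer n F (y j) q p

/-- The part of a certificate that is guessed: a partial map with the `m₁` pairs `(u i, a i)`, which
does not increase distances, and `m` paths in the forest, given by their ends `x j` and `y j`. The
partial map and the paths cover the forest. -/
structure IsOutline {n k : ℕ} (G : SimpleGraph (Fin n)) (F : SimpleGraph (Fin k)) (m₁ m : ℕ)
    (u : ℕ → Fin n) (a x y : ℕ → Fin k) : Prop where
  lipschitz : ∀ i < m₁, ∀ j < m₁, truncDist n F (a i) (a j) ≤ truncDist n G (u i) (u j)
  path : ∀ j < m, truncDist n F (x j) (y j) < n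
  covered : ∀ p q, F.Adj p q →
    IsCovered G F m₁ m u a x y p q ∨ IsCovered G F m₁ m u a x y q p
  isolated : ∀ v, (∀ w, ¬ F.Adj v w) → ∃ i < m₁, a i = v

/-- A distribution of components of `G` to the paths of an outline: the component of `i` covers a
piece of length `δ i` of the path number `b i`. -/
structure IsDistribution {n k : ℕ} (G : SimpleGraph (Fin n)) (F : SimpleGraph (Fin k)) (m₁ m : ℕ)
    (u : ℕ → Fin n) (x y : ℕ → Fin k) (b δ : ℕ → ℕ) : Prop where
  lt : ∀ i < n, b i < m
  free : ∀ i : Fin n, δ i = 0 ∨ IsFreePiece G m₁ u i (δ i)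
  sum : ∀ j < m, ∑ i ∈ Finset.range n, (if b i = j then δ i else 0) = truncDist n F (x j) (y j)

theorem truncDist_lt_iff_reachable {n k : ℕ} {F : SimpleGraph (Fin k)} (hk : k ≤ n) {a b : Fin k} :
    truncDist n F a b < n ↔ F.Reachable a b := by
  constructor
  · intro h
    by_contra hr
    rw [truncDist_of_not_reachable hr] at h
    exact lt_irrefl _ h
  · intro h
    have := h.dist_lt_card
    rw [Fintype.card_fin] at this
    rw [truncDist_of_reachable h]
    omega

theorem SimpleGraph.Walk.exists_walk_getVert {W : Type} {F : SimpleGraph W} {a b : W}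
    (p : F.Walk a b) (s d : ℕ) :
    ∃ q : F.Walk (p.getVert s) (p.getVert (s + d)), q.length ≤ d := by
  induction d with
  | zero => exact ⟨.nil, le_rfl⟩
  | succ d ih =>
    obtain ⟨q, hq⟩ := ih
    by_cases h : s + d < p.length
    · exact ⟨q.concat (p.adj_getVert_succ h), by rw [SimpleGraph.Walk.length_concat]; omega⟩
    · refine ⟨q.copy rfl ?_, by rw [SimpleGraph.Walk.length_copy]; omega⟩
      rw [p.getVert_of_length_le (by omega), p.getVert_of_length_le (by omega)]

theorem exists_last_of_not {P : ℕ → Prop} {n : ℕ} (h0 : P 0) (hn : ¬ P n) :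
    ∃ t < n, P t ∧ ¬ P (t + 1) := by
  induction n with
  | zero => exact absurd h0 hn
  | succ n ih =>
    by_cases h : P n
    · exact ⟨n, Nat.lt_succ_self n, h, hn⟩
    · obtain ⟨t, ht, h'⟩ := ih h
      exact ⟨t, ht.trans (Nat.lt_succ_self n), h'⟩

/-- An outline whose paths can be covered by the free components gives an identification map: the
components distributed to a path cover consecutive pieces of it. -/
theorem IsOutline.exists_isIdentificationMap {n k : ℕ} {G : SimpleGraph (Fin n)}
    {F : SimpleGraph (Fin k)} {m₁ m : ℕ} {u : ℕ → Fin n} {a x y : ℕ → Fin k} {b δ : ℕ → ℕ}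
    (R : Rooting F) (hk : k ≤ n) (hk0 : 0 < k) (h : IsOutline G F m₁ m u a x y)
    (hb : IsDistribution G F m₁ m u x y b δ) : ∃ f : Fin n → Fin k, IsIdentificationMap G F f := by
  have : Nonempty (Fin k) := ⟨⟨0, hk0⟩⟩
  have hG : ∀ {v w : Fin n}, truncDist n G v w < n ↔ G.Reachable v w :=
    truncDist_lt_iff_reachable le_rfl
  have hF : ∀ {v w : Fin k}, truncDist n F v w < n ↔ F.Reachable v w :=
    truncDist_lt_iff_reachable hk
  have hγ : ∀ j : Fin m, ∃ p : F.Walk (x j) (y j), p.length = truncDist n F (x j) (y j) := by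
    intro j
    have hr := hF.mp (h.path j j.2)
    rw [truncDist_of_reachable hr]
    exact hr.exists_walk_length_eq_dist
  choose γ hγ using hγ
  have hends : ∀ i : {i : Fin n // δ i ≠ 0}, ∃ e : Bool → Fin n, (∀ t, G.Reachable i.1 (e t)) ∧
      δ i.1 ≤ G.dist (e false) (e true) := by
    intro i
    obtain ⟨v, w, hv, hw, hvw⟩ := ((hb.free i.1).resolve_left i.2).long
    rw [hG] at hv hw
    rw [truncDist_of_reachable (hv.symm.trans hw)] at hvw
    exact ⟨fun t => if t then w else v, fun t => by cases t <;> simpa, by simpa⟩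
  choose e he hδ using hends
  -- the place on its path where the piece of a component begins
  let start : ℕ → ℕ → ℕ := fun j t => ∑ i ∈ Finset.range t, if b i = j then δ i else 0
  let point : {i : Fin n // δ i ≠ 0} → Bool → Fin k := fun i t =>
    (γ ⟨b i.1, hb.lt _ i.1.2⟩).getVert (start (b i.1) i.1 + if t then δ i.1 else 0)
  have hpoint : ∀ i, ∃ p : F.Walk (point i false) (point i true), p.length ≤ δ i.1 :=
    fun i => (γ ⟨b i.1, hb.lt _ i.1.2⟩).exists_walk_getVert _ _
  refine R.exists_isIdentificationMap (ι := Fin m₁ ⊕ {i : Fin n // δ i ≠ 0} × Bool)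
    (Sum.elim (fun i => u i) fun i => e i.1 i.2) (Sum.elim (fun i => a i) fun i => point i.1 i.2)
    ?_ ?_ ?_
  · -- two arguments in one component of `G` are both guessed, or both belong to one free component
    rintro (i | ⟨i, s⟩) (j | ⟨j, t⟩) hr
    · have hr' : G.Reachable (u i) (u j) := hr
      have hle := h.lipschitz i i.2 j j.2
      have hF' := hF.mp (hle.trans_lt (hG.mpr hr'))
      rw [truncDist_of_reachable hr', truncDist_of_reachable hF'] at hle
      obtain ⟨p, hp⟩ := hF'.exists_walk_length_eq_dist
      exact ⟨p, hp.trans_le hle⟩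
    · exact absurd (hG.mpr (hr.trans (he j t).symm))
        (((hb.free j.1).resolve_left j.2).untouched i i.2)
    · exact absurd (hG.mpr (hr.symm.trans (he i s).symm))
        (((hb.free i.1).resolve_left i.2).untouched j j.2)
    · have hij : i = j := by
        have hr' : G.Reachable i.1 j.1 := ((he i s).trans hr).trans (he j t).symm
        apply Subtype.ext
        rcases lt_trichotomy i.1 j.1 with hlt | heq | hlt
        · exact absurd (hG.mpr hr') (((hb.free j.1).resolve_left j.2).minimal _ hlt)
        · exact heq
        · exact absurd (hG.mpr hr'.symm) (((hb.free i.1).resolve_left i.2).minimal _ hlt)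
      subst hij
      obtain ⟨p, hp⟩ := hpoint i
      cases s <;> cases t
      · exact ⟨.nil, Nat.zero_le _⟩
      · exact ⟨p, hp.trans (hδ i)⟩
      · exact ⟨p.reverse, (SimpleGraph.Walk.length_reverse p).trans_le
          ((hp.trans (hδ i)).trans_eq SimpleGraph.dist_comm)⟩
      · exact ⟨.nil, Nat.zero_le _⟩
  · intro v hv
    -- a path that crosses an edge crosses it within one of its pieces
    have hpath : ∀ j < m, ∀ P : Fin k → Prop, P (x j) → ¬ P (y j) →
        ∃ i s t, P (point i s) ∧ ¬ P (point i t) := by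
      intro j hj P hx hy
      have h0 : P ((γ ⟨j, hj⟩).getVert (start j 0)) := by simpa [start] using hx
      have hn : ¬ P ((γ ⟨j, hj⟩).getVert (start j n)) := by
        have : start j n = (γ ⟨j, hj⟩).length := (hb.sum j hj).trans (hγ ⟨j, hj⟩).symm
        rwa [this, SimpleGraph.Walk.getVert_length]
      obtain ⟨t, ht, h1, h2⟩ := exists_last_of_not (P := fun t => P ((γ ⟨j, hj⟩).getVert (start j t)))
        h0 hn
      have hs : start j (t + 1) = start j t + if b t = j then δ t else 0 :=
        Finset.sum_range_succ _ _
      rw [hs] at h2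
      by_cases hbt : b t = j
      · subst hbt
        rw [if_pos rfl] at h2
        have hδt : δ t ≠ 0 := fun h0 => h2 (by rwa [h0])
        exact ⟨⟨⟨t, ht⟩, hδt⟩, false, true, h1, h2⟩
      · rw [if_neg hbt] at h2
        exact absurd h1 h2
    have hcov : ∃ p q : Fin k, (IsCovered G F m₁ m u a x y p q) ∧
        ((p = v ∧ q = R.par v) ∨ (p = R.par v ∧ q = v)) := by
      rcases h.covered v _ (R.adj_par v hv) with hc | hc
      · exact ⟨_, _, hc, Or.inl ⟨rfl, rfl⟩⟩
      · exact ⟨_, _, hc, Or.inr ⟨rfl, rfl⟩⟩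
    obtain ⟨p, q, hc, ⟨rfl, rfl⟩ | ⟨rfl, rfl⟩⟩ := hcov
    · rcases hc with ⟨i, hi, j, hj, hr, h1, h2⟩ | ⟨j, hj, h1, h2⟩
      · exact ⟨.inl ⟨i, hi⟩, .inl ⟨j, hj⟩, hG.mp hr, (R.truncDist_lt_iff hv).mp h1,
          ((R.truncDist_lt_iff' hv).mp h2).2⟩
      · obtain ⟨i, s, t, h1, h2⟩ := hpath j hj (fun z => R.Below z p)
          ((R.truncDist_lt_iff hv).mp h1) ((R.truncDist_lt_iff' hv).mp h2).2
        exact ⟨.inr (i, s), .inr (i, t), (he i s).symm.trans (he i t), h1, h2⟩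
    · rcases hc with ⟨i, hi, j, hj, hr, h1, h2⟩ | ⟨j, hj, h1, h2⟩
      · exact ⟨.inl ⟨j, hj⟩, .inl ⟨i, hi⟩, (hG.mp hr).symm, (R.truncDist_lt_iff hv).mp h2,
          ((R.truncDist_lt_iff' hv).mp h1).2⟩
      · obtain ⟨i, s, t, h1, h2⟩ := hpath j hj (fun z => ¬ R.Below z q)
          ((R.truncDist_lt_iff' hv).mp h1).2 (not_not.mpr ((R.truncDist_lt_iff hv).mp h2))
        exact ⟨.inr (i, t), .inr (i, s), (he i t).symm.trans (he i s), not_not.mp h2, h1⟩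
  · intro v hv
    obtain ⟨i, hi, hiv⟩ := h.isolated v hv
    exact ⟨.inl ⟨i, hi⟩, hiv⟩

/-! ### Segments of a rooted forest -/

namespace Rooting

variable {W : Type} [Fintype W] {F : SimpleGraph W} (R : Rooting F)

open Classical in
/-- The children of a vertex. -/
noncomputable def children (v : W) : Finset W :=
  Finset.univ.filter fun w => R.dep w ≠ 0 ∧ R.par w = v

theorem mem_children {v w : W} : w ∈ R.children v ↔ R.dep w ≠ 0 ∧ R.par w = v := by
  simp [children]

theorem dep_of_mem_children {v w : W} (h : w ∈ R.children v) : R.dep w = R.dep v + 1 := by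
  obtain ⟨h0, rfl⟩ := R.mem_children.mp h
  have := R.dep_par w
  omega

/-- The vertices without children. -/
noncomputable def tips : Finset W := Finset.univ.filter fun v => (R.children v).card = 0

/-- The vertices at which a segment ends: those that do not have exactly one child. -/
noncomputable def stops : Finset W := Finset.univ.filter fun v => (R.children v).card ≠ 1

/-- As in a tree with `t` leaves, the number of branchings is less than the number of tips. -/
theorem card_stops_le : R.stops.card ≤ 2 * R.tips.card := by
  classical
  have hsum : ∑ v, (R.children v).card ≤ Fintype.card W := by
    calc ∑ v, (R.children v).card = (Finset.univ.biUnion R.children).card := by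
          rw [Finset.card_biUnion]
          intro v _ w _ hvw
          rw [Function.onFun, Finset.disjoint_left]
          intro x hx hx'
          exact hvw ((R.mem_children.mp hx).2.symm.trans (R.mem_children.mp hx').2)
      _ ≤ _ := Finset.card_le_univ _
  -- a vertex with at least two children is paid by the children, one without children by the tips
  have hpt : ∀ v : W, (if (R.children v).card ≠ 1 then 1 else 0) + 1 ≤
      (R.children v).card + 2 * (if (R.children v).card = 0 then 1 else 0) := by
    intro v
    split_ifs <;> omega
  have := Finset.sum_le_sum fun v (_ : v ∈ Finset.univ) => hpt v
  rw [Finset.sum_add_distrib, Finset.sum_add_distrib, ← Finset.mul_sum, ← Finset.card_filter,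
    ← Finset.card_filter] at this
  simp only [Finset.sum_const, Finset.card_univ, smul_eq_mul, mul_one] at this
  rw [stops, tips]
  omega

theorem exists_dep_lt : ∃ K, ∀ x : W, R.dep x < K :=
  ⟨(Finset.univ.sup R.dep) + 1, fun x => Nat.lt_succ_of_le (Finset.le_sup (Finset.mem_univ x))⟩

theorem exists_tip_below (v : W) : ∃ t ∈ R.tips, R.Below t v := by
  obtain ⟨K, hK⟩ := R.exists_dep_lt
  obtain ⟨n, hn⟩ : ∃ n, n = K - R.dep v := ⟨_, rfl⟩
  induction n generalizing v with
  | zero => have := hK v; omega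
  | succ n ih =>
    by_cases h : (R.children v).card = 0
    · exact ⟨v, by simp [tips, h], R.below_refl v⟩
    · obtain ⟨w, hw⟩ := Finset.card_pos.mp (Nat.pos_of_ne_zero h)
      have hd := R.dep_of_mem_children hw
      obtain ⟨t, ht, htw⟩ := ih w (by omega)
      refine ⟨t, ht, htw.trans R ⟨by omega, ?_⟩⟩
      rw [← (R.mem_children.mp hw).2, R.dep_par, anc]
      rw [show R.dep w - (R.dep w - 1) = 1 by omega]
      rfl

/-- The segments of a rooted forest partition its vertices, and so its edges from a vertex to its
parent. A segment is named by its lowest vertex `bot v`, which is a stop. A vertex in the subtree of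
`v` that is not in the segment of `v` lies below the whole segment. -/
theorem exists_bot : ∃ bot : W → W, ∀ v, bot v ∈ R.stops ∧ R.Below (bot v) v ∧
    ∀ v', R.Below v' v → R.Below v' (bot v) ∨ bot v' = bot v := by
  obtain ⟨K, hK⟩ := R.exists_dep_lt
  suffices h : ∀ n, ∃ bot : W → W, ∀ v, K - R.dep v ≤ n → bot v ∈ R.stops ∧ R.Below (bot v) v ∧
      ∀ v', R.Below v' v → R.Below v' (bot v) ∨ bot v' = bot v by
    obtain ⟨bot, h⟩ := h K
    exact ⟨bot, fun v => h v (Nat.sub_le _ _)⟩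
  intro n
  induction n with
  | zero => exact ⟨id, fun v hv => by have := hK v; omega⟩
  | succ n ih =>
    classical
    obtain ⟨bot, hbot⟩ := ih
    refine ⟨fun v => if K - R.dep v = n + 1 then
      (if h : ∃ w, R.children v = {w} then bot h.choose else v) else bot v, fun v hv => ?_⟩
    have hbelow : ∀ {v'}, R.Below v' v → v' ≠ v → K - R.dep v = n + 1 → K - R.dep v' ≠ n + 1 := by
      intro v' hv' hne he he'
      have h1 := hv'.1
      have h2 := hK v'
      have h3 := hK v
      have : R.dep v' = R.dep v := by omega
      exact hne (by rw [← hv'.2, ← this, R.anc_dep])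
    by_cases he : K - R.dep v = n + 1
    · by_cases h : ∃ w, R.children v = {w}
      · have hw := h.choose_spec
        simp only [he, if_true, dif_pos h]
        generalize h.choose = w at hw
        have hwv : w ∈ R.children v := by rw [hw]; exact Finset.mem_singleton_self w
        have hd := R.dep_of_mem_children hwv
        obtain ⟨h1, h2, h3⟩ := hbot w (by omega)
        have hwb : R.Below w v := by
          refine ⟨by omega, ?_⟩
          rw [← (R.mem_children.mp hwv).2, R.dep_par, anc, show R.dep w - (R.dep w - 1) = 1 by omega]
          rfl
        refine ⟨h1, h2.trans R hwb, fun v' hv' => ?_⟩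
        by_cases hv'v : v' = v
        · right
          subst hv'v
          rw [if_pos he, dif_pos h]
          exact congrArg bot (Finset.singleton_inj.mp (h.choose_spec.symm.trans hw))
        · rw [if_neg (hbelow hv' hv'v he)]
          refine h3 v' ?_
          -- the ancestor of `v'` one step below `v` is the only child of `v`
          have hlt : R.dep v + 1 ≤ R.dep v' := by
            rcases hv'.1.eq_or_lt with heq | hlt
            · exact absurd (by rw [← hv'.2, heq, R.anc_dep]) hv'v
            · exact hlt
          have hc : R.anc (R.dep v + 1) v' ∈ R.children v := by
            rw [R.mem_children, R.dep_anc hlt, R.par_anc hlt, hv'.2]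
            exact ⟨by omega, rfl⟩
          rw [hw, Finset.mem_singleton] at hc
          exact hc ▸ R.below_anc hlt
      · simp only [he, if_true, dif_neg h]
        refine ⟨?_, R.below_refl v, fun v' hv' => Or.inl hv'⟩
        simp only [stops, Finset.mem_filter, Finset.mem_univ, true_and]
        rwa [Ne, Finset.card_eq_one]
    · simp only [he, if_false]
      obtain ⟨h1, h2, h3⟩ := hbot v (by omega)
      refine ⟨h1, h2, fun v' hv' => ?_⟩
      rw [if_neg]
      · exact h3 v' hv'
      · have := hv'.1
        omega

end Rooting

/-- A vertex without children has no neighbour but its parent. -/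
theorem Rooting.card_tips_le {k : ℕ} {F : SimpleGraph (Fin k)} (R : Rooting F) :
    R.tips.card ≤ numLeaves F := by
  rw [numLeaves, ← Set.ncard_coe_finset]
  refine Set.ncard_le_ncard (fun v hv => ?_) (Set.toFinite _)
  have hv' : R.children v = ∅ := by simpa [Rooting.tips] using hv
  have hsub : F.neighborSet v ⊆ {R.par v} := by
    intro w hw
    rcases R.of_adj v w hw with ⟨hd, hp⟩ | ⟨-, hp⟩
    · have : w ∈ R.children v := R.mem_children.mpr ⟨by omega, hp⟩
      rw [hv'] at this
      simp at this
    · exact hp.symm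
  exact (Set.ncard_le_ncard hsub (Set.toFinite _)).trans_eq (Set.ncard_singleton _)

/-! ### The components of the source graph and the segments of the forest -/

namespace Rooting

variable {V W : Type} {G : SimpleGraph V} {F : SimpleGraph W} (R : Rooting F) (f : V → W)

/-- The edges of the forest that are covered by the image of a component, each given by its lower
end. -/
def edgesOn (c : G.ConnectedComponent) : Set W :=
  {v | R.dep v ≠ 0 ∧ (∃ x, G.connectedComponentMk x = c ∧ f x = v) ∧
    ∃ y, G.connectedComponentMk y = c ∧ f y = R.par v}

/-- A component is bent if its image covers edges of two segments. -/
def IsBent (bot : W → W) (c : G.ConnectedComponent) : Prop :=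
  ∃ v ∈ R.edgesOn f c, ∃ v' ∈ R.edgesOn f c, bot v ≠ bot v'

variable {f}

theorem mem_edgesOn_of_below (hf : IsIdentificationMap G F f) {c : G.ConnectedComponent} {x y : V}
    (hx : G.connectedComponentMk x = c) (hy : G.connectedComponentMk y = c) {v : W}
    (hxv : R.Below (f x) v) (hyv : ¬ R.Below (f y) v) : v ∈ R.edgesOn f c := by
  obtain ⟨p⟩ := SimpleGraph.ConnectedComponent.exact (hx.trans hy.symm)
  obtain ⟨h0, x', y', h1, h2, h3, h4⟩ :=
    R.exists_adj_of_below (fun _ _ h => hf.adj_or_eq h) p hxv hyv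
  have hx' : G.connectedComponentMk x' = c :=
    (SimpleGraph.ConnectedComponent.sound h4).symm.trans hx
  exact ⟨h0, ⟨x', hx', h1⟩,
    y', (SimpleGraph.ConnectedComponent.sound h3.reachable).symm.trans hx', h2⟩

theorem exists_mem_edgesOn (hf : IsIdentificationMap G F f) {v : W} (hv : R.dep v ≠ 0) :
    ∃ c : G.ConnectedComponent, v ∈ R.edgesOn f c := by
  obtain ⟨x, y, h1, h2, h3⟩ := hf.exists_adj (R.adj_par v hv)
  exact ⟨G.connectedComponentMk x, hv, ⟨x, rfl, h1⟩,
    y, (SimpleGraph.ConnectedComponent.sound h3.reachable).symm, h2⟩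

/-- A bent component that covers an edge of a segment covers the part of the segment on one of the
two sides of that edge, because its image leaves the segment through one of its ends. -/
theorem IsBent.covers (hf : IsIdentificationMap G F f) {bot : W → W}
    (hbot : ∀ v, R.Below (bot v) v ∧ ∀ v', R.Below v' v → R.Below v' (bot v) ∨ bot v' = bot v)
    {c : G.ConnectedComponent} (hc : R.IsBent f bot c) {v : W} (hv : v ∈ R.edgesOn f c) :
    (∀ z, R.dep z ≠ 0 → bot z = bot v → R.dep v ≤ R.dep z → z ∈ R.edgesOn f c) ∨
      (∀ z, R.dep z ≠ 0 → bot z = bot v → R.dep z ≤ R.dep v → z ∈ R.edgesOn f c) := by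
  obtain ⟨v', hv', hne⟩ : ∃ v' ∈ R.edgesOn f c, bot v' ≠ bot v := by
    obtain ⟨v₁, h₁, v₂, h₂, hne⟩ := hc
    by_cases h : bot v₁ = bot v
    · exact ⟨v₂, h₂, fun h' => hne (h.trans h'.symm)⟩
    · exact ⟨v₁, h₁, h⟩
  obtain ⟨h0, ⟨x, hx, rfl⟩, y, hy, hyv⟩ := hv
  obtain ⟨-, ⟨x', hx', rfl⟩, -⟩ := hv'
  have hbx := (hbot (f x)).1
  by_cases hb : R.Below (f x') (f x)
  · left
    intro z hz hzb hd
    have hbz := (hbot z).1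
    rw [hzb] at hbz
    have h1 : R.Below (f x') (bot (f x)) := ((hbot (f x)).2 _ hb).resolve_right hne
    refine R.mem_edgesOn_of_below hf hx' hy (h1.trans R hbz) fun h2 => ?_
    have h3 := h2.1
    rw [hyv, R.dep_par] at h3
    omega
  · right
    intro z hz hzb hd
    have hbz := (hbot z).1
    rw [hzb] at hbz
    refine R.mem_edgesOn_of_below hf hx hx' (hbx.of_dep_le R hbz hd) fun h2 => ?_
    rcases (hbot z).2 _ h2 with h3 | h3
    · rw [hzb] at h3
      exact hb (h3.trans R hbx)
    · exact hne (h3.trans hzb)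

/-- Few bent components suffice to cover everything that is covered by bent components: for each
segment and each of its ends, one that reaches farthest from that end. -/
theorem exists_bent_selection [Finite V] [Fintype W] (hf : IsIdentificationMap G F f) {bot : W → W}
    (hend : ∀ v, bot v ∈ R.stops)
    (hbot : ∀ v, R.Below (bot v) v ∧ ∀ v', R.Below v' v → R.Below v' (bot v) ∨ bot v' = bot v) :
    ∃ A : Finset G.ConnectedComponent, A.card ≤ 2 * R.stops.card ∧
      (∀ c ∈ A, R.IsBent f bot c) ∧
      ∀ c : G.ConnectedComponent, R.IsBent f bot c → ∀ v ∈ R.edgesOn f c, ∃ c' ∈ A, v ∈ R.edgesOn f c' := by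
  classical
  have hsel : ∀ (μ : W → ℤ) (w : W), ∃ T : Finset G.ConnectedComponent, T.card ≤ 1 ∧
      (∀ c ∈ T, R.IsBent f bot c) ∧
      ∀ c : G.ConnectedComponent, R.IsBent f bot c → ∀ v ∈ R.edgesOn f c, bot v = w →
        (∀ z, R.dep z ≠ 0 → bot z = bot v → μ v ≤ μ z → z ∈ R.edgesOn f c) →
        ∃ c' ∈ T, v ∈ R.edgesOn f c' := by
    intro μ w
    let X := {p : G.ConnectedComponent × W // R.IsBent f bot p.1 ∧ p.2 ∈ R.edgesOn f p.1 ∧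
      bot p.2 = w ∧ ∀ z, R.dep z ≠ 0 → bot z = bot p.2 → μ p.2 ≤ μ z → z ∈ R.edgesOn f p.1}
    have : Finite G.ConnectedComponent := Quot.finite _
    by_cases hX : Nonempty X
    · obtain ⟨⟨⟨c₀, v₀⟩, h1, h2, h3, h4⟩, hmin⟩ := Finite.exists_min fun p : X => μ p.1.2
      refine ⟨{c₀}, by simp, by simpa using h1, fun c hc v hv hvw hcov => ⟨c₀, by simp, ?_⟩⟩
      exact h4 v hv.1 (hvw.trans h3.symm) (hmin ⟨(c, v), hc, hv, hvw, hcov⟩)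
    · refine ⟨∅, by simp, by simp, fun c hc v hv hvw hcov => ?_⟩
      exact absurd ⟨⟨(c, v), hc, hv, hvw, hcov⟩⟩ hX
  choose T hT1 hT2 hT3 using hsel
  let μ : Bool → W → ℤ := fun t w => if t then (R.dep w : ℤ) else -(R.dep w : ℤ)
  refine ⟨(R.stops ×ˢ Finset.univ).biUnion fun s => T (μ s.2) s.1, ?_, ?_, ?_⟩
  · refine (Finset.card_biUnion_le_card_mul _ _ 1 fun s _ => hT1 _ _).trans_eq ?_
    rw [Finset.card_product, Finset.card_univ, Fintype.card_bool]
    ring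
  · intro c hc
    obtain ⟨s, -, hs⟩ := Finset.mem_biUnion.mp hc
    exact hT2 _ _ c hs
  · intro c hc v hv
    rcases hc.covers R hf hbot hv with h | h
    · obtain ⟨c', hc', hv'⟩ := hT3 (μ true) (bot v) c hc v hv rfl fun z h0 hz hle =>
        h z h0 hz (by simpa [μ] using hle)
      exact ⟨c', Finset.mem_biUnion.mpr ⟨(bot v, true), by simp [hend], hc'⟩, hv'⟩
    · obtain ⟨c', hc', hv'⟩ := hT3 (μ false) (bot v) c hc v hv rfl fun z h0 hz hle =>
        h z h0 hz (by simpa [μ] using hle)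
      exact ⟨c', Finset.mem_biUnion.mpr ⟨(bot v, false), by simp [hend], hc'⟩, hv'⟩

/-- The edges covered by the image of a component are separated by the images of few vertices: one
with a highest image, and for each tip one with a lowest image among those above the tip. -/
theorem exists_anchors [Finite V] [Fintype W] (f : V → W) (c : G.ConnectedComponent) :
    ∃ P : Finset V, P.card ≤ R.tips.card + 1 ∧ (∀ x ∈ P, G.connectedComponentMk x = c) ∧
      ∀ v ∈ R.edgesOn f c, ∃ x ∈ P, ∃ y ∈ P, R.Below (f x) v ∧ ¬ R.Below (f y) v := by
  classical
  obtain ⟨x₀, hx₀⟩ := c.exists_rep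
  obtain ⟨⟨y, hy⟩, hmin⟩ := @Finite.exists_min {x : V // G.connectedComponentMk x = c} _ _
    ⟨⟨x₀, hx₀⟩⟩ _ fun x => R.dep (f x)
  have hlow : ∀ t : W, ∃ x, G.connectedComponentMk x = c ∧
      ∀ z, G.connectedComponentMk z = c → R.Below t (f z) →
        R.Below t (f x) ∧ R.dep (f z) ≤ R.dep (f x) := by
    intro t
    by_cases h : Nonempty {x : V // G.connectedComponentMk x = c ∧ R.Below t (f x)}
    · obtain ⟨⟨x, hx, hxt⟩, hmax⟩ := Finite.exists_max
        fun x : {x : V // G.connectedComponentMk x = c ∧ R.Below t (f x)} => R.dep (f x)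
      exact ⟨x, hx, fun z hz hzt => ⟨hxt, hmax ⟨z, hz, hzt⟩⟩⟩
    · exact ⟨y, hy, fun z hz hzt => absurd ⟨⟨z, hz, hzt⟩⟩ h⟩
  choose low hlow₁ hlow₂ using hlow
  refine ⟨insert y (R.tips.image low), (Finset.card_insert_le _ _).trans
    (Nat.succ_le_succ Finset.card_image_le), ?_, ?_⟩
  · intro x hx
    rcases Finset.mem_insert.mp hx with rfl | hx
    · exact hy
    · obtain ⟨t, -, rfl⟩ := Finset.mem_image.mp hx
      exact hlow₁ t
  · rintro v ⟨hv, ⟨z, hz, rfl⟩, z', hz', hzz'⟩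
    obtain ⟨t, ht, htz⟩ := R.exists_tip_below (f z)
    obtain ⟨h1, h2⟩ := hlow₂ t z hz htz
    refine ⟨low t, Finset.mem_insert_of_mem (Finset.mem_image_of_mem _ ht), y,
      Finset.mem_insert_self _ _, h1.of_dep_le R htz h2, fun h => ?_⟩
    have h3 := hmin ⟨z', hz'⟩
    have h4 := h.1
    simp only [hzz', R.dep_par] at h3
    omega

theorem exists_walk_map (hf : IsIdentificationMap G F f) {x y : V} (p : G.Walk x y) :
    ∃ q : F.Walk (f x) (f y), q.length ≤ p.length := by
  induction p with
  | nil => exact ⟨.nil, le_rfl⟩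
  | @cons x z y hxz p ih =>
    obtain ⟨q, hq⟩ := ih
    rcases hf.adj_or_eq hxz with h | h
    · exact ⟨q.copy h.symm rfl, by
        rw [SimpleGraph.Walk.length_copy, SimpleGraph.Walk.length_cons]; omega⟩
    · exact ⟨.cons h q, by simp only [SimpleGraph.Walk.length_cons]; omega⟩

theorem exists_walk_anc (x : W) {h : ℕ} (hx : h ≤ R.dep x) :
    ∃ p : F.Walk x (R.anc h x), p.length = R.dep x - h := by
  obtain ⟨d, hd⟩ : ∃ d, d = R.dep x - h := ⟨_, rfl⟩
  induction d generalizing h with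
  | zero =>
    have : h = R.dep x := by omega
    exact ⟨SimpleGraph.Walk.nil.copy rfl (by rw [this, R.anc_dep]), by
      rw [SimpleGraph.Walk.length_copy, SimpleGraph.Walk.length_nil]; omega⟩
  | succ d ih =>
    obtain ⟨p, hp⟩ := ih (h := h + 1) (by omega) (by omega)
    have hadj := R.adj_par (R.anc (h + 1) x) (by rw [R.dep_anc (by omega)]; omega)
    rw [R.par_anc (by omega)] at hadj
    exact ⟨p.concat hadj, by rw [SimpleGraph.Walk.length_concat]; omega⟩

theorem dist_anc (x : W) {h : ℕ} (hx : h ≤ R.dep x) :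
    F.dist x (R.anc h x) = R.dep x - h := by
  obtain ⟨p, hp⟩ := R.exists_walk_anc x hx
  obtain ⟨q, hq⟩ := p.reachable.exists_walk_length_eq_dist
  have h1 := SimpleGraph.dist_le p
  have h2 := R.dep_le_of_walk q
  rw [R.dep_anc hx] at h2
  omega

theorem eq_of_bot_eq {bot : W → W} (hbot : ∀ v, R.Below (bot v) v) {v w : W} (h : bot v = bot w)
    (hd : R.dep v = R.dep w) : v = w := by
  rw [← (hbot v).2, h, hd, (hbot w).2]

/-- An interval of a segment consists of the edges of a path. -/
theorem exists_path_of_interval [Fintype W] [Nonempty W] {bot : W → W}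
    (hbot : ∀ v, R.Below (bot v) v) (T : Finset W) (h0 : ∀ v ∈ T, R.dep v ≠ 0)
    (hT : ∀ v ∈ T, ∀ w ∈ T, bot v = bot w)
    (hconv : ∀ v ∈ T, ∀ w ∈ T, ∀ z, R.Below v z → R.Below z w → z ∈ T) :
    ∃ x y, F.Reachable x y ∧ F.dist x y = T.card ∧
      ∀ v ∈ T, R.Below x v ∧ F.Reachable y v ∧ ¬ R.Below y v := by
  rcases T.eq_empty_or_nonempty with rfl | hne
  · exact ⟨Classical.arbitrary W, Classical.arbitrary W, SimpleGraph.Reachable.refl _, by simp,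
      by simp⟩
  obtain ⟨v₁, hv₁, hmax⟩ := T.exists_max_image R.dep hne
  obtain ⟨v₂, hv₂, hmin⟩ := T.exists_min_image R.dep hne
  have hbelow : ∀ v ∈ T, ∀ w ∈ T, R.dep w ≤ R.dep v → R.Below v w := fun v hv w hw hd =>
    (hbot v).of_dep_le R (by rw [hT v hv w hw]; exact hbot w) hd
  have h12 := hbelow v₁ hv₁ v₂ hv₂ (hmin v₁ hv₁)
  have hpar : R.par v₂ = R.anc (R.dep v₂ - 1) v₁ := by
    have := h0 v₂ hv₂
    rw [← R.anc_anc (Nat.sub_le _ _) h12.1, h12.2, anc, show R.dep v₂ - (R.dep v₂ - 1) = 1 by omega]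
    rfl
  have hcard : T.card = R.dep v₁ + 1 - R.dep v₂ := by
    rw [← Nat.card_Icc]
    refine Finset.card_bij (fun v _ => R.dep v)
      (fun v hv => Finset.mem_Icc.mpr ⟨hmin v hv, hmax v hv⟩)
      (fun v hv w hw h => R.eq_of_bot_eq hbot (hT v hv w hw) h) fun h hh => ?_
    obtain ⟨h1, h2⟩ := Finset.mem_Icc.mp hh
    refine ⟨R.anc h v₁, hconv v₁ hv₁ v₂ hv₂ _ (R.below_anc h2) ?_, R.dep_anc h2⟩
    exact (R.below_anc h2).of_dep_le R h12 (by rwa [R.dep_anc h2])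
  refine ⟨v₁, R.par v₂, ?_, ?_, fun v hv => ⟨hbelow v₁ hv₁ v hv (hmax v hv), ?_, fun h => ?_⟩⟩
  · rw [hpar]; exact R.reachable_anc _ _
  · have := h0 v₂ hv₂
    have := h12.1
    rw [hpar, R.dist_anc v₁ (by omega)]
    omega
  · exact ((R.adj_par v₂ (h0 v₂ hv₂)).symm.reachable).trans
      (hbelow v hv v₂ hv₂ (hmin v hv)).reachable.symm
  · have h1 := h.1
    have h2 := hmin v hv
    have h3 := h0 v₂ hv₂
    rw [R.dep_par] at h1
    omega

end Rooting

/-! ### Completeness of certificates -/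

theorem Finset.exists_enumeration {α : Type} [Nonempty α] (S : Finset α) :
    ∃ u : ℕ → α, (∀ j < S.card, u j ∈ S) ∧ ∀ x ∈ S, ∃ j < S.card, u j = x := by
  classical
  refine ⟨fun j => if h : j < S.card then S.equivFin.symm ⟨j, h⟩ else Classical.arbitrary α,
    fun j hj => ?_, fun x hx => ⟨S.equivFin ⟨x, hx⟩, Fin.is_lt _, ?_⟩⟩
  · dsimp only
    rw [dif_pos hj]
    exact Finset.coe_mem _
  · dsimp only
    rw [dif_pos (Fin.is_lt _)]
    simp

theorem Finset.exists_numbering {α : Type} (S : Finset α) :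
    ∃ num : α → ℕ, (∀ x ∈ S, num x < S.card) ∧ Set.InjOn num S := by
  classical
  refine ⟨fun x => if h : x ∈ S then S.equivFin ⟨x, h⟩ else 0, fun x hx => ?_, fun x hx y hy h => ?_⟩
  · dsimp only
    rw [dif_pos hx]
    exact Fin.is_lt _
  · have hx' : x ∈ S := hx
    have hy' : y ∈ S := hy
    simp only [dif_pos hx', dif_pos hy'] at h
    simpa using S.equivFin.injective (Fin.ext h)

/-- Every component has a smallest vertex. -/
theorem SimpleGraph.exists_min_rep {n : ℕ} (G : SimpleGraph (Fin n)) :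
    ∃ rep : G.ConnectedComponent → Fin n, (∀ c, G.connectedComponentMk (rep c) = c) ∧
      ∀ i, rep (G.connectedComponentMk i) ≤ i := by
  have h : ∀ c : G.ConnectedComponent, ∃ r, G.connectedComponentMk r = c ∧
      ∀ i, G.connectedComponentMk i = c → r ≤ i := by
    intro c
    obtain ⟨x, hx⟩ := c.exists_rep
    obtain ⟨⟨r, hr⟩, hmin⟩ := @Finite.exists_min {x // G.connectedComponentMk x = c} _ _
      ⟨⟨x, hx⟩⟩ _ fun x => x.1
    exact ⟨r, hr, fun i hi => hmin ⟨i, hi⟩⟩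
  choose rep h1 h2 using h
  exact ⟨rep, h1, fun i => h2 _ i rfl⟩

/-- An identification map gives a certificate whose size is quadratic in the number of leaves: the
partial map consists of the anchors of the selected bent components and of a preimage of every
isolated vertex, and the paths are the parts of the segments that no bent component covers. -/
theorem IsIdentificationMap.exists_certificate {n k : ℕ} {G : SimpleGraph (Fin n)}
    {F : SimpleGraph (Fin k)} (R : Rooting F) (hk : k ≤ n) (hk0 : 0 < k)
    (hℓ : 0 < numLeaves F) {f : Fin n → Fin k} (hf : IsIdentificationMap G F f) :
    ∃ m₁ ≤ 9 * numLeaves F ^ 2, ∃ u a x y b δ,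
      IsOutline G F m₁ (9 * numLeaves F ^ 2) u a x y ∧
        IsDistribution G F m₁ (9 * numLeaves F ^ 2) u x y b δ := by
  classical
  have : Nonempty (Fin k) := ⟨⟨0, hk0⟩⟩
  have : Nonempty (Fin n) := ⟨⟨0, by omega⟩⟩
  have hG : ∀ {v w : Fin n}, truncDist n G v w < n ↔ G.Reachable v w :=
    truncDist_lt_iff_reachable le_rfl
  have hF : ∀ {v w : Fin k}, truncDist n F v w < n ↔ F.Reachable v w :=
    truncDist_lt_iff_reachable hk
  have htips := R.card_tips_le
  have hstops := R.card_stops_le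
  obtain ⟨ℓ, hℓ'⟩ : ∃ ℓ, ℓ = numLeaves F := ⟨_, rfl⟩
  rw [← hℓ'] at hℓ htips ⊢
  obtain ⟨bot, hbot⟩ := R.exists_bot
  have hbot₁ : ∀ v, R.Below (bot v) v := fun v => (hbot v).2.1
  obtain ⟨A, hA₁, hA₂, hA₃⟩ :=
    R.exists_bent_selection hf (fun v => (hbot v).1) fun v => (hbot v).2
  choose P hP₁ hP₂ hP₃ using R.exists_anchors (G := G) f
  choose g hg using hf.surjective
  obtain ⟨rep, hrep, hrep'⟩ := G.exists_min_rep
  -- the arguments of the partial map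
  let U : Finset (Fin n) :=
    A.biUnion P ∪ (Finset.univ.filter fun v => ∀ w, ¬ F.Adj v w).image g
  have hU : U.card ≤ 9 * ℓ ^ 2 := by
    have h1 : (A.biUnion P).card ≤ A.card * (ℓ + 1) :=
      Finset.card_biUnion_le_card_mul _ _ _ fun c _ => (hP₁ c).trans (by omega)
    have h2 : (Finset.univ.filter fun v => ∀ w, ¬ F.Adj v w).card ≤ ℓ := by
      rw [hℓ', numLeaves, ← Set.ncard_coe_finset]
      refine Set.ncard_le_ncard (fun v hv => ?_) (Set.toFinite _)
      have hv' : ∀ w, ¬ F.Adj v w := by simpa using hv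
      have : F.neighborSet v = ∅ := Set.eq_empty_iff_forall_notMem.mpr hv'
      simp [this]
    have h3 : A.card * (ℓ + 1) ≤ (4 * ℓ) * (2 * ℓ) := Nat.mul_le_mul (by omega) (by omega)
    have h4 : ℓ ≤ ℓ * ℓ := Nat.le_mul_of_pos_left _ hℓ
    calc U.card ≤ (A.biUnion P).card + _ := Finset.card_union_le _ _
      _ ≤ (4 * ℓ) * (2 * ℓ) + ℓ :=
        Nat.add_le_add (h1.trans h3) (Finset.card_image_le.trans h2)
      _ ≤ 9 * ℓ ^ 2 := by rw [pow_two, show 4 * ℓ * (2 * ℓ) = 8 * (ℓ * ℓ) by ring]; omega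
  have hm : 2 * ℓ ≤ 9 * ℓ ^ 2 := by nlinarith
  obtain ⟨u, hu₁, hu₂⟩ := U.exists_enumeration
  obtain ⟨num, hnum₁, hnum₂⟩ := R.stops.exists_numbering
  -- the edges that no bent component covers, and for each edge a component that covers it
  let E : Finset (Fin k) := Finset.univ.filter fun v => R.dep v ≠ 0 ∧
    ∀ c : G.ConnectedComponent, R.IsBent f bot c → v ∉ R.edgesOn f c
  have hE : ∀ {v}, v ∈ E ↔ R.dep v ≠ 0 ∧
      ∀ c : G.ConnectedComponent, R.IsBent f bot c → v ∉ R.edgesOn f c := by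
    intro v; simp [E]
  have hcomp : ∀ v, ∃ c : G.ConnectedComponent, R.dep v ≠ 0 → v ∈ R.edgesOn f c := by
    intro v
    by_cases h : R.dep v = 0
    · exact ⟨G.connectedComponentMk (Classical.arbitrary _), fun h' => absurd h h'⟩
    · obtain ⟨c, hc⟩ := R.exists_mem_edgesOn hf h
      exact ⟨c, fun _ => hc⟩
  choose comp hcomp using hcomp
  have hbent : ∀ v ∈ E, ¬ R.IsBent f bot (comp v) := fun v hv hb =>
    (hE.mp hv).2 _ hb (hcomp v (hE.mp hv).1)
  -- a component that is not bent covers edges of one segment only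
  have hsame : ∀ v ∈ E, ∀ w ∈ E, rep (comp v) = rep (comp w) → bot v = bot w := by
    intro v hv w hw h
    have hvw : comp v = comp w := by rw [← hrep (comp v), h, hrep]
    by_contra hne
    exact hbent v hv ⟨v, hcomp v (hE.mp hv).1, w, hvw ▸ hcomp w (hE.mp hw).1, hne⟩
  -- the uncovered edges of a segment form an interval
  have hconv : ∀ v ∈ E, ∀ w ∈ E, bot v = bot w → ∀ z, R.Below v z → R.Below z w →
      z ∈ E ∧ bot z = bot w := by
    intro v hv w hw hvw z hvz hzw
    have hz : bot z = bot w := by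
      rcases (hbot w).2.2 z hzw with h | h
      · have h1 := hbot₁ v
        rw [hvw] at h1
        have h2 : R.Below (bot w) z := h1.trans R hvz
        have h3 := R.below_antisymm h h2
        have h4 : z = v := R.below_antisymm (h3 ▸ h1) hvz
        rw [h4, hvw]
      · exact h
    have hz0 : R.dep z ≠ 0 := by
      have := (hE.mp hw).1
      have := hzw.1
      omega
    refine ⟨hE.mpr ⟨hz0, fun c hc hzc => ?_⟩, hz⟩
    rcases hc.covers R hf (fun v => (hbot v).2) hzc with h | h
    · exact (hE.mp hv).2 c hc (h v (hE.mp hv).1 (hvw.trans hz.symm) hvz.1)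
    · exact (hE.mp hw).2 c hc (h w (hE.mp hw).1 hz.symm hzw.1)
  have hpath : ∀ j : ℕ, ∃ x y, F.Reachable x y ∧
      F.dist x y = (E.filter fun v => num (bot v) = j).card ∧
      ∀ v ∈ E.filter fun v => num (bot v) = j,
        R.Below x v ∧ F.Reachable y v ∧ ¬ R.Below y v := by
    intro j
    have hb : ∀ v ∈ E.filter fun v => num (bot v) = j,
        ∀ w ∈ E.filter fun v => num (bot v) = j, bot v = bot w := fun v hv w hw =>
      hnum₂ (hbot v).1 (hbot w).1
        ((Finset.mem_filter.mp hv).2.trans (Finset.mem_filter.mp hw).2.symm)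
    refine R.exists_path_of_interval hbot₁ _ (fun v hv => (hE.mp (Finset.mem_filter.mp hv).1).1) hb
      fun v hv w hw z hvz hzw => ?_
    obtain ⟨h1, h2⟩ := hconv v (Finset.mem_filter.mp hv).1 w (Finset.mem_filter.mp hw).1
      (hb v hv w hw) z hvz hzw
    exact Finset.mem_filter.mpr ⟨h1, by rw [h2, (Finset.mem_filter.mp hw).2]⟩
  choose x y hxy₁ hxy₂ hxy₃ using hpath
  -- the component with the smallest vertex `i` is responsible for `δ i` edges of the path `b i`
  let δ : ℕ → ℕ := fun i => (E.filter fun v => (rep (comp v) : ℕ) = i).card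
  let b : ℕ → ℕ := fun i =>
    if h : ∃ v ∈ E, (rep (comp v) : ℕ) = i then num (bot h.choose) else 0
  have hb : ∀ v ∈ E, b (rep (comp v)) = num (bot v) := by
    intro v hv
    have h : ∃ w ∈ E, (rep (comp w) : ℕ) = rep (comp v) := ⟨v, hv, rfl⟩
    have h' := h.choose_spec
    simp only [b, dif_pos h]
    rw [hsame _ h'.1 v hv (Fin.ext h'.2)]
  refine ⟨U.card, hU, u, fun i => f (u i), x, y, b, δ, ⟨?_, ?_, ?_, ?_⟩, ⟨?_, ?_, ?_⟩⟩
  · intro i _ j _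
    by_cases hr : G.Reachable (u i) (u j)
    · obtain ⟨p, hp⟩ := hr.exists_walk_length_eq_dist
      obtain ⟨q, hq⟩ := Rooting.exists_walk_map hf p
      rw [truncDist_of_reachable hr, truncDist_of_reachable q.reachable, ← hp]
      exact (SimpleGraph.dist_le q).trans hq
    · rw [truncDist_of_not_reachable hr]
      by_cases hr' : F.Reachable (f (u i)) (f (u j))
      · exact (hF.mpr hr').le
      · rw [truncDist_of_not_reachable hr']
  · exact fun j _ => hF.mpr (hxy₁ j)
  -- every edge lies on a path, or is separated by anchors of a selected component
  · have key : ∀ v, R.dep v ≠ 0 →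
        IsCovered G F U.card (9 * ℓ ^ 2) u (fun i => f (u i)) x y v (R.par v) := by
      intro v hv
      by_cases hvE : v ∈ E
      · right
        obtain ⟨h1, h2, h3⟩ := hxy₃ (num (bot v)) v (Finset.mem_filter.mpr ⟨hvE, rfl⟩)
        exact ⟨num (bot v), (hnum₁ _ (hbot v).1).trans_le (by omega),
          (R.truncDist_lt_iff hv).mpr h1, (R.truncDist_lt_iff' hv).mpr ⟨h2, h3⟩⟩
      · left
        rw [hE] at hvE
        push Not at hvE
        obtain ⟨c, hc, hvc⟩ := hvE hv
        obtain ⟨c', hc', hvc'⟩ := hA₃ c hc v hvc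
        obtain ⟨p, hp, q, hq, h1, h2⟩ := hP₃ c' v hvc'
        have hpU : ∀ p ∈ P c', p ∈ U := fun p hp =>
          Finset.mem_union_left _ (Finset.mem_biUnion.mpr ⟨c', hc', hp⟩)
        obtain ⟨i, hi, rfl⟩ := hu₂ p (hpU p hp)
        obtain ⟨j, hj, rfl⟩ := hu₂ q (hpU q hq)
        have hr : G.Reachable (u i) (u j) :=
          SimpleGraph.ConnectedComponent.exact ((hP₂ c' _ hp).trans (hP₂ c' _ hq).symm)
        obtain ⟨w, -⟩ := hr.exists_walk_length_eq_dist
        obtain ⟨w', -⟩ := Rooting.exists_walk_map hf w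
        exact ⟨i, hi, j, hj, hG.mpr hr, (R.truncDist_lt_iff hv).mpr h1,
          (R.truncDist_lt_iff' hv).mpr ⟨w'.reachable.symm.trans h1.reachable, h2⟩⟩
    intro p q hpq
    rcases R.of_adj p q hpq with ⟨h1, h2⟩ | ⟨h1, h2⟩
    · right
      have := key q (by omega)
      rwa [h2] at this
    · left
      have := key p (by omega)
      rwa [h2] at this
  · intro v hv
    obtain ⟨i, hi, hiv⟩ := hu₂ (g v) (Finset.mem_union_right _
      (Finset.mem_image_of_mem g (Finset.mem_filter.mpr ⟨Finset.mem_univ _, hv⟩)))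
    exact ⟨i, hi, by rw [hiv, hg]⟩
  · intro i _
    simp only [b]
    split_ifs with h
    · exact (hnum₁ _ (hbot _).1).trans_le (by omega)
    · positivity
  · intro i
    by_cases h0 : δ i = 0
    · exact Or.inl h0
    right
    obtain ⟨v₀, hv₀⟩ := Finset.card_pos.mp (Nat.pos_of_ne_zero h0)
    have hmem : ∀ v ∈ E.filter fun v => (rep (comp v) : ℕ) = i,
        v ∈ E ∧ R.dep v ≠ 0 ∧ comp v = G.connectedComponentMk i := by
      intro v hv
      obtain ⟨h1, h2⟩ := Finset.mem_filter.mp hv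
      exact ⟨h1, (hE.mp h1).1, by rw [← Fin.ext h2, hrep]⟩
    refine ⟨fun j hj hr => ?_, fun i' hi' hr => ?_, ?_⟩
    · -- the component is neither bent nor mapped to an isolated vertex
      obtain ⟨hvE, hv0, hc⟩ := hmem v₀ hv₀
      have hr' := hG.mp hr
      have hcu : G.connectedComponentMk (u j) = comp v₀ :=
        (SimpleGraph.ConnectedComponent.sound hr').trans hc.symm
      rcases Finset.mem_union.mp (hu₁ j hj) with h | h
      · obtain ⟨c, hcA, hcP⟩ := Finset.mem_biUnion.mp h
        rw [hP₂ c _ hcP] at hcu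
        exact hbent v₀ hvE (hcu ▸ hA₂ c hcA)
      · obtain ⟨z, hz, hzu⟩ := Finset.mem_image.mp h
        obtain ⟨-, ⟨q, hq, hqv⟩, -⟩ := hcomp v₀ hv0
        obtain ⟨w⟩ := SimpleGraph.ConnectedComponent.exact (hcu.trans hq.symm)
        obtain ⟨w', -⟩ := Rooting.exists_walk_map hf w
        rw [← hzu, hg, hqv] at w'
        have hz' : ∀ w, ¬ F.Adj z w := (Finset.mem_filter.mp hz).2
        cases w' with
        | nil => exact hz' _ (R.adj_par _ hv0)
        | cons hadj _ => exact hz' _ hadj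
    · have h1 := hrep' i'
      rw [SimpleGraph.ConnectedComponent.sound (hG.mp hr)] at h1
      obtain ⟨-, -, hc⟩ := hmem v₀ hv₀
      have h2 := (Finset.mem_filter.mp hv₀).2
      rw [hc] at h2
      rw [Fin.ext h2] at h1
      exact absurd hi' (not_lt.mpr h1)
    · -- preimages of the ends of the interval of covered edges are far apart
      obtain ⟨v₁, hv₁, hmax⟩ := Finset.exists_max_image _ R.dep ⟨v₀, hv₀⟩
      obtain ⟨v₂, hv₂, hmin⟩ := Finset.exists_min_image _ R.dep ⟨v₀, hv₀⟩
      obtain ⟨-, h10, h1c⟩ := hmem v₁ hv₁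
      obtain ⟨-, h20, h2c⟩ := hmem v₂ hv₂
      obtain ⟨-, ⟨p, hp, hpv⟩, -⟩ := hcomp v₁ h10
      obtain ⟨-, -, q, hq, hqv⟩ := hcomp v₂ h20
      have hip : G.Reachable i p := SimpleGraph.ConnectedComponent.exact (h1c.symm.trans hp.symm)
      have hiq : G.Reachable i q := SimpleGraph.ConnectedComponent.exact (h2c.symm.trans hq.symm)
      refine ⟨p, q, hG.mpr hip, hG.mpr hiq, ?_⟩
      have hpq := hip.symm.trans hiq
      obtain ⟨w, hw⟩ := hpq.exists_walk_length_eq_dist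
      obtain ⟨w', hw'⟩ := Rooting.exists_walk_map hf w
      have hd := R.dep_le_of_walk w'
      have hd₁ : R.dep (f p) = R.dep v₁ := by rw [hpv]
      have hd₂ : R.dep (f q) = R.dep v₂ - 1 := by rw [hqv, R.dep_par]
      have hcard : δ i ≤ (Finset.Icc (R.dep v₂) (R.dep v₁)).card :=
        Finset.card_le_card_of_injOn R.dep
          (fun v hv => Finset.mem_coe.mpr (Finset.mem_Icc.mpr ⟨hmin v hv, hmax v hv⟩))
          fun v hv w hw h => R.eq_of_bot_eq hbot₁ (hsame v (hmem v hv).1 w (hmem w hw).1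
            (Fin.ext ((Finset.mem_filter.mp hv).2.trans (Finset.mem_filter.mp hw).2.symm))) h
      rw [Nat.card_Icc] at hcard
      rw [truncDist_of_reachable hpq]
      omega
  · intro j _
    rw [truncDist_of_reachable (hxy₁ j), hxy₂ j,
      Finset.card_eq_sum_card_fiberwise (f := fun v => (rep (comp v) : ℕ)) (t := Finset.range n)
        fun v _ => Finset.mem_coe.mpr (Finset.mem_range.mpr (Fin.is_lt _))]
    refine Finset.sum_congr rfl fun i _ => ?_
    rw [Finset.filter_filter]
    split_ifs with h
    · simp only [δ]
      congr 1
      refine Finset.filter_congr fun v hv => ⟨fun hi => ⟨?_, hi⟩, fun hi => hi.2⟩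
      rw [← hb v hv, hi, h]
    · symm
      rw [Finset.card_eq_zero, Finset.filter_eq_empty_iff]
      rintro v hv ⟨h1, h2⟩
      exact h (by rw [← h2, hb v hv, h1])

/-! ### The computations of the machine -/

/-- `i` belongs to the subset of `{0, …, c - 1}` that is encoded by `X`. Numbers that are too large
to be a code stand for the empty set. -/
def InSet (c X i : ℕ) : Prop := X < 2 ^ c ∧ X.testBit i = true

theorem inSet_bitSet {c j : ℕ} {P : ℕ → Prop} : InSet c (bitSet c P) j ↔ j < c ∧ P j := by
  rw [InSet, testBit_bitSet]
  exact and_iff_right (bitSet_lt c P)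

/-- The digit number `i` of `g` in base `c`. -/
def digit (c g i : ℕ) : ℕ := g / c ^ i % c

/-- The number of vertices of the first (`t = false`) or second graph of an instance. -/
def vertexCount (w : ℕ → ℕ) (t : Bool) : ℕ := if t then w 1 else w 0

/-- The adjacency matrix of the first (`t = false`) or second graph of an instance. -/
def AdjBit (w : ℕ → ℕ) (t : Bool) (i j : ℕ) : Prop :=
  if t then w (2 + (w 0 * w 0 + (w 1 * i + j))) = 1 else w (2 + (w 0 * i + j)) = 1

/-- The set of the vertices at distance at most `s` from `u`. -/
noncomputable def ballSet (w : ℕ → ℕ) (t : Bool) (u s : ℕ) : ℕ :=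
  iterFrom (bitSet (vertexCount w t) fun j => j = u)
    (fun _ X => bitSet (vertexCount w t) fun j => InSet (vertexCount w t) X j ∨
      ∃ i < vertexCount w t, InSet (vertexCount w t) X i ∧ AdjBit w t i j) s

/-- The distance of two vertices, truncated at the number of vertices of the first graph. -/
noncomputable def numDist (w : ℕ → ℕ) (t : Bool) (u v : ℕ) : ℕ :=
  ∑ s ∈ Finset.range (w 0), truth (¬ InSet (vertexCount w t) (ballSet w t u s) v)

/-- The number of vertices of degree at most `1` of the second graph. -/
noncomputable def leafCount (w : ℕ → ℕ) : ℕ :=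
  ∑ v ∈ Finset.range (w 1), truth (∑ u ∈ Finset.range (w 1), truth (AdjBit w true v u) ≤ 1)

/-- The inputs are pairs of nonempty graphs whose numbers of vertices are below the size. -/
class GraphPairInput (B : Type) [MachineInput B] : Prop where
  pos : ∀ (I : B) (t : Bool), 0 < vertexCount (word I) t
  lt : ∀ (I : B) (t : Bool), vertexCount (word I) t < size I

section

variable {B α : Type} [MachineInput B] [MachineCtx α B]

theorem PolyDecidable.inSet {c X i : α → ℕ} (hc : PolyComputable c) (hX : PolyComputable X)
    (hi : PolyComputable i) (hle : ∀ x, c x ≤ size (base x)) (hlt : ∀ x, i x < size (base x)) :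
    PolyDecidable (fun x => InSet (c x) (X x) (i x)) := by
  classical
  have h1 : PolyDecidable (fun x => X x < 2 ^ c x) := .lt hX (hc.two_pow hle)
  refine (h1.and (PolyDecidable.testBit (f := fun x => if X x < 2 ^ c x then X x else 0)
    (.ite h1 hX (.lit 0)) hi (fun x => ?_) hlt)).congr fun x => and_congr_right fun h => ?_
  · split_ifs with h
    · exact h.trans_le (Nat.pow_le_pow_right (by omega) (hle x))
    · positivity
  · rw [if_pos h]

theorem PolyComputable.digit {c g i : α → ℕ} (hc : PolyComputable c) (hg : PolyComputable g)
    (hi : PolyComputable i) (hpos : ∀ x, 0 < c x) (hc' : ∀ x, c x ≤ size (base x))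
    (hg' : ∀ x, g x ≤ size (base x)) (hi' : ∀ x, i x ≤ size (base x)) :
    PolyComputable (fun x => digit (c x) (g x) (i x)) :=
  (hg.div (hc.pow hi hc' hi') hg' fun x => pow_pos (hpos x) _).mod hc
    (fun x => (Nat.div_le_self _ _).trans (hg' x)) hpos

theorem PolyComputable.word_zero : PolyComputable (fun x : α => MachineInput.word (base x) 0) :=
  (lit 0).wordAt

theorem PolyComputable.word_one : PolyComputable (fun x : α => MachineInput.word (base x) 1) :=
  (lit 1).wordAt

theorem PolyComputable.vertexCount (t : Bool) :
    PolyComputable (fun x : α => vertexCount (MachineInput.word (base x)) t) := by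
  cases t
  · exact word_zero
  · exact word_one

variable [GraphPairInput B]

theorem word_zero_le (I : B) : word I 0 ≤ size I := (GraphPairInput.lt I false).le

theorem word_one_le (I : B) : word I 1 ≤ size I := (GraphPairInput.lt I true).le

theorem PolyDecidable.adjBit (t : Bool) {i j : α → ℕ} (hi : PolyComputable i)
    (hj : PolyComputable j) :
    PolyDecidable (fun x => AdjBit (MachineInput.word (base x)) t (i x) (j x)) := by
  cases t
  · exact .eq (((PolyComputable.lit 2).add ((PolyComputable.word_zero.mul hi
      fun x => word_zero_le _).add hj)).wordAt) (.lit 1)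
  · exact .eq (((PolyComputable.lit 2).add ((PolyComputable.word_zero.mul .word_zero
      fun x => word_zero_le _).add ((PolyComputable.word_one.mul hi
      fun x => word_one_le _).add hj))).wordAt) (.lit 1)

theorem PolyComputable.ballSet (t : Bool) {u s : α → ℕ} (hu : PolyComputable u)
    (hs : PolyComputable s) (hs' : ∀ x, s x ≤ MachineInput.size (base x)) :
    PolyComputable (fun x => ballSet (MachineInput.word (base x)) t (u x) (s x)) := by
  refine .iterFrom hs hs' ?_ ?_
  · exact .bitSet (.vertexCount t) (fun x => (GraphPairInput.lt _ t).le) (.eq .newBoundedVar hu.weakB)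
  · refine .bitSet (.vertexCount t) (fun x => (GraphPairInput.lt _ t).le) ?_
    refine .or (.inSet (.vertexCount t) (newVar.weakB) .newBoundedVar
      (fun x => (GraphPairInput.lt _ t).le) fun p => p.2.2.trans (GraphPairInput.lt _ t)) ?_
    refine .exists_lt (.vertexCount t) (fun x => (GraphPairInput.lt _ t).le) ?_
    exact .and (.inSet (.vertexCount t) (newVar.weakB.weakB) .newBoundedVar
      (fun x => (GraphPairInput.lt _ t).le) fun p => p.2.2.trans (GraphPairInput.lt _ t))
      (.adjBit t .newBoundedVar newBoundedVar.weakB)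

theorem PolyComputable.numDist (t : Bool) {u v : α → ℕ} (hu : PolyComputable u)
    (hv : PolyComputable v) (hv' : ∀ x, v x < MachineInput.size (base x)) :
    PolyComputable (fun x => numDist (MachineInput.word (base x)) t (u x) (v x)) :=
  sum word_zero
    (fun _ => word_zero_le _) (PolyDecidable.not (.inSet (.vertexCount t)
      (.ballSet t hu.weakB .newBoundedVar fun p => p.2.2.le.trans (word_zero_le _)) hv.weakB
      (fun _ => (GraphPairInput.lt _ t).le) fun p => hv' p.1))

theorem PolyComputable.leafCount :
    PolyComputable (fun x : α => leafCount (MachineInput.word (base x))) := by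
  refine sum word_one (fun _ => word_one_le _) ?_
  refine PolyDecidable.le (sum word_one (fun _ => word_one_le _) ?_)
    (.lit 1)
  exact PolyDecidable.adjBit true newBoundedVar.weakB .newBoundedVar

end

/-! ### The certificate as a predicate on numbers -/

/-- The bound `9 ℓ ^ 2` on the size of a certificate, where `ℓ` is the number of leaves. -/
noncomputable def outlineSize (w : ℕ → ℕ) : ℕ := leafCount w * (leafCount w * 9)

/-- The numerical form of `IsFreePiece`; the vertices `u j` are the digits of `g`. -/
def FreePieceNum (w : ℕ → ℕ) (m g i d : ℕ) : Prop :=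
  (∀ j < m, ¬ numDist w false (digit (w 0) g j) i < w 0) ∧
    (∀ i' < i, ¬ numDist w false i' i < w 0) ∧
      ∃ v < w 0, ∃ z < w 0, numDist w false i v < w 0 ∧ numDist w false i z < w 0 ∧
        d ≤ numDist w false v z

/-- The set of the codes `s < N` of the possible loads of the `m` paths after the first `t` vertices
have been considered: the digit `j` of `s` is the total length of the pieces on path `j`. -/
noncomputable def loadSet (w : ℕ → ℕ) (N m m₁ g t : ℕ) : ℕ :=
  iterFrom (bitSet N fun s => ∀ j < m, digit (w 0 + 1) s j = 0)
    (fun i X => bitSet N fun s' => ∃ s < N, InSet N X s ∧ ∃ j < m,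
      (∀ j' < m, j' = j ∨ digit (w 0 + 1) s' j' = digit (w 0 + 1) s j') ∧
      ∃ d < w 0 + 1, digit (w 0 + 1) s' j = digit (w 0 + 1) s j + d ∧
        (d = 0 ∨ FreePieceNum w m₁ g i d)) t

/-- The numerical form of `IsCovered`. -/
def CoveredNum (w : ℕ → ℕ) (m₁ m gu ga gx gy p q : ℕ) : Prop :=
  (∃ i < m₁, ∃ j < m₁, numDist w false (digit (w 0) gu i) (digit (w 0) gu j) < w 0 ∧
      numDist w true (digit (w 1) ga i) p < numDist w true (digit (w 1) ga i) q ∧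
      numDist w true (digit (w 1) ga j) q < numDist w true (digit (w 1) ga j) p) ∨
    ∃ j < m, numDist w true (digit (w 1) gx j) p < numDist w true (digit (w 1) gx j) q ∧
      numDist w true (digit (w 1) gy j) q < numDist w true (digit (w 1) gy j) p

/-- The numerical form of `IsOutline`; the values of `u`, `a`, `x` and `y` are the digits of `gu`,
`ga`, `gx` and `gy`. -/
def OutlineNum (w : ℕ → ℕ) (m₁ m gu ga gx gy : ℕ) : Prop :=
  (∀ i < m₁, ∀ j < m₁, numDist w true (digit (w 1) ga i) (digit (w 1) ga j) ≤
      numDist w false (digit (w 0) gu i) (digit (w 0) gu j)) ∧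
    (∀ j < m, numDist w true (digit (w 1) gx j) (digit (w 1) gy j) < w 0) ∧
    (∀ p < w 1, ∀ q < w 1, AdjBit w true p q →
      CoveredNum w m₁ m gu ga gx gy p q ∨ CoveredNum w m₁ m gu ga gx gy q p) ∧
    ∀ v < w 1, (∀ z < w 1, ¬ AdjBit w true v z) → ∃ i < m₁, digit (w 1) ga i = v

/-- The existence of a certificate, with all choices encoded by numbers below `N`. -/
def Accepts (w : ℕ → ℕ) (N : ℕ) : Prop :=
  ∃ m₁ < outlineSize w + 1, ∃ gu < N, ∃ ga < N, ∃ gx < N, ∃ gy < N,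
    OutlineNum w m₁ (outlineSize w) gu ga gx gy ∧
      ∃ s < N, InSet N (loadSet w N (outlineSize w) m₁ gu (w 0)) s ∧
        ∀ j < outlineSize w, digit (w 0 + 1) s j =
          numDist w true (digit (w 1) gx j) (digit (w 1) gy j)

section

variable {B α : Type} [MachineInput B] [MachineCtx α B] [GraphPairInput B]

theorem leafCount_le (w : ℕ → ℕ) : leafCount w ≤ w 1 :=
  (Finset.sum_le_sum fun _ _ => truth_le_one _).trans_eq (by simp)

theorem PolyComputable.outlineSize :
    PolyComputable (fun x : α => outlineSize (MachineInput.word (base x))) :=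
  leafCount.mul (leafCount.mul (lit 9) fun _ => (leafCount_le _).trans (word_one_le _))
    fun _ => (leafCount_le _).trans (word_one_le _)

theorem word_zero_lt (I : B) : word I 0 < size I := GraphPairInput.lt I false

theorem word_one_lt (I : B) : word I 1 < size I := GraphPairInput.lt I true

theorem word_zero_pos (I : B) : 0 < word I 0 := GraphPairInput.pos I false

theorem word_one_pos (I : B) : 0 < word I 1 := GraphPairInput.pos I true

theorem digit_lt {c : ℕ} (hc : 0 < c) (g i : ℕ) : digit c g i < c := Nat.mod_lt _ hc

theorem PolyComputable.digit_zero {g i : α → ℕ} (hg : PolyComputable g) (hi : PolyComputable i)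
    (hg' : ∀ x, g x < MachineInput.size (base x)) (hi' : ∀ x, i x < MachineInput.size (base x)) :
    PolyComputable (fun x => _root_.digit (MachineInput.word (base x) 0) (g x) (i x)) :=
  .digit .word_zero hg hi (fun _ => word_zero_pos _) (fun _ => word_zero_le _)
    (fun x => (hg' x).le) fun x => (hi' x).le

theorem PolyComputable.digit_zero_add {g i : α → ℕ} (hg : PolyComputable g)
    (hi : PolyComputable i)
    (hg' : ∀ x, g x < MachineInput.size (base x)) (hi' : ∀ x, i x < MachineInput.size (base x)) :
    PolyComputable (fun x => _root_.digit (MachineInput.word (base x) 0 + 1) (g x) (i x)) :=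
  .digit (.add .word_zero (.lit 1)) hg hi (fun _ => Nat.succ_pos _) (fun _ => word_zero_lt _)
    (fun x => (hg' x).le) fun x => (hi' x).le

theorem PolyComputable.digit_one {g i : α → ℕ} (hg : PolyComputable g) (hi : PolyComputable i)
    (hg' : ∀ x, g x < MachineInput.size (base x)) (hi' : ∀ x, i x < MachineInput.size (base x)) :
    PolyComputable (fun x => _root_.digit (MachineInput.word (base x) 1) (g x) (i x)) :=
  .digit .word_one hg hi (fun _ => word_one_pos _) (fun _ => word_one_le _)
    (fun x => (hg' x).le) fun x => (hi' x).le

theorem digit_zero_lt (I : B) (g i : ℕ) : digit (word I 0) g i < size I :=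
  (digit_lt (word_zero_pos I) g i).trans (word_zero_lt I)

theorem digit_one_lt (I : B) (g i : ℕ) : digit (word I 1) g i < size I :=
  (digit_lt (word_one_pos I) g i).trans (word_one_lt I)

theorem PolyDecidable.freePieceNum {m g i d : α → ℕ} (hm : PolyComputable m)
    (hg : PolyComputable g) (hi : PolyComputable i) (hd : PolyComputable d)
    (hm' : ∀ x, m x < size (base x)) (hg' : ∀ x, g x < size (base x))
    (hi' : ∀ x, i x < size (base x)) :
    PolyDecidable (fun x => FreePieceNum (word (base x)) (m x) (g x) (i x) (d x)) := by
  refine .and ?_ (.and ?_ ?_)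
  · exact .forall_lt hm (fun x => (hm' x).le) (.not (.lt (.numDist false
      (.digit_zero hg.weakB .newBoundedVar (fun p => hg' p.1) fun p => p.2.2.trans (hm' p.1))
      hi.weakB fun p => hi' p.1) .word_zero))
  · exact .forall_lt hi (fun x => (hi' x).le) (.not (.lt (.numDist false .newBoundedVar
      hi.weakB fun p => hi' p.1) .word_zero))
  · refine .exists_lt .word_zero (fun x => word_zero_le _) (.exists_lt .word_zero
      (fun x => word_zero_le _) (.and ?_ (.and ?_ ?_)))
    · exact .lt (.numDist false hi.weakB.weakB PolyComputable.newBoundedVar.weakB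
        fun p => p.1.2.2.trans (word_zero_lt _)) .word_zero
    · exact .lt (.numDist false hi.weakB.weakB .newBoundedVar
        fun p => p.2.2.trans (word_zero_lt _)) .word_zero
    · exact .le hd.weakB.weakB (.numDist false PolyComputable.newBoundedVar.weakB .newBoundedVar
        fun p => p.2.2.trans (word_zero_lt _))

theorem PolyComputable.loadSet {m m₁ g t : α → ℕ} (hm : PolyComputable m)
    (hm₁ : PolyComputable m₁) (hg : PolyComputable g) (ht : PolyComputable t)
    (hm' : ∀ x, m x < MachineInput.size (base x)) (hm₁' : ∀ x, m₁ x < MachineInput.size (base x))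
    (hg' : ∀ x, g x < MachineInput.size (base x)) (ht' : ∀ x, t x ≤ MachineInput.size (base x)) :
    PolyComputable (fun x => loadSet (MachineInput.word (base x)) (MachineInput.size (base x))
      (m x) (m₁ x) (g x) (t x)) := by
  refine .iterFrom ht ht' ?_ ?_
  · refine .bitSet .inputSize (fun _ => le_rfl) (.forall_lt hm.weakB (fun p => (hm' p.1).le) ?_)
    exact .eq (.digit_zero_add newBoundedVar.weakB .newBoundedVar (fun p => p.1.2.2)
      fun p => p.2.2.trans (hm' p.1.1)) (.lit 0)
  · refine .bitSet .inputSize (fun _ => le_rfl) (.exists_lt .inputSize (fun _ => le_rfl)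
      (.and ?_ ?_))
    · exact .inSet .inputSize newVar.weakB.weakB .newBoundedVar (fun _ => le_rfl) fun p => p.2.2
    · refine .exists_lt hm.weakB.weak.weakB.weakB (fun p => (hm' p.1.1.1.1).le) (.and ?_ ?_)
      · refine .forall_lt hm.weakB.weak.weakB.weakB.weakB (fun p => (hm' p.1.1.1.1.1).le)
          (.or (.eq .newBoundedVar newBoundedVar.weakB) ?_)
        exact .eq (.digit_zero_add newBoundedVar.weakB.weakB.weakB .newBoundedVar
            (fun p => p.1.1.1.2.2) fun p => p.2.2.trans (hm' _))
          (.digit_zero_add newBoundedVar.weakB.weakB .newBoundedVar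
            (fun p => p.1.1.2.2) fun p => p.2.2.trans (hm' _))
      · refine .exists_lt (word_zero.add (lit 1)) (fun p => word_zero_lt _) (.and ?_ ?_)
        · exact .eq (.digit_zero_add newBoundedVar.weakB.weakB.weakB newBoundedVar.weakB
              (fun p => p.1.1.1.2.2) fun p => p.1.2.2.trans (hm' _))
            (.add (.digit_zero_add newBoundedVar.weakB.weakB newBoundedVar.weakB
              (fun p => p.1.1.2.2) fun p => p.1.2.2.trans (hm' _)) .newBoundedVar)
        · refine .or (.eq .newBoundedVar (.lit 0)) (.freePieceNum
            hm₁.weakB.weak.weakB.weakB.weakB.weakB hg.weakB.weak.weakB.weakB.weakB.weakB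
            newBoundedVar.weak.weakB.weakB.weakB.weakB .newBoundedVar (fun p => hm₁' _)
            (fun p => hg' _) fun p => ?_)
          exact p.1.1.1.1.1.2.2.trans_le (ht' _)

theorem PolyDecidable.coveredNum {m₁ m gu ga gx gy p q : α → ℕ} (hm₁ : PolyComputable m₁)
    (hm : PolyComputable m) (hgu : PolyComputable gu) (hga : PolyComputable ga)
    (hgx : PolyComputable gx) (hgy : PolyComputable gy) (hp : PolyComputable p)
    (hq : PolyComputable q) (hm₁' : ∀ x, m₁ x < size (base x)) (hm' : ∀ x, m x < size (base x))
    (hgu' : ∀ x, gu x < size (base x)) (hga' : ∀ x, ga x < size (base x))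
    (hgx' : ∀ x, gx x < size (base x)) (hgy' : ∀ x, gy x < size (base x))
    (hp' : ∀ x, p x < size (base x)) (hq' : ∀ x, q x < size (base x)) :
    PolyDecidable (fun x => CoveredNum (word (base x)) (m₁ x) (m x) (gu x) (ga x) (gx x) (gy x)
      (p x) (q x)) := by
  refine .or (.exists_lt hm₁ (fun x => (hm₁' x).le) (.exists_lt hm₁.weakB
    (fun p => (hm₁' p.1).le) (.and ?_ (.and ?_ ?_)))) (.exists_lt hm (fun x => (hm' x).le)
    (.and ?_ ?_))
  · exact .lt (.numDist false (.digit_zero hgu.weakB.weakB PolyComputable.newBoundedVar.weakB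
        (fun _ => hgu' _) fun p => p.1.2.2.trans (hm₁' _))
      (.digit_zero hgu.weakB.weakB .newBoundedVar (fun _ => hgu' _)
        fun p => p.2.2.trans (hm₁' _)) fun _ => digit_zero_lt _ _ _) .word_zero
  · have h : PolyComputable (fun y : (y : (x : α) × Fin (m₁ x)) × Fin (m₁ y.1) =>
        digit (word (base y) 1) (ga y.1.1) y.1.2) :=
      .digit_one hga.weakB.weakB PolyComputable.newBoundedVar.weakB (fun _ => hga' _)
        fun p => p.1.2.2.trans (hm₁' _)
    exact .lt (.numDist true h hp.weakB.weakB fun _ => hp' _)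
      (.numDist true h hq.weakB.weakB fun _ => hq' _)
  · have h : PolyComputable (fun y : (y : (x : α) × Fin (m₁ x)) × Fin (m₁ y.1) =>
        digit (word (base y) 1) (ga y.1.1) y.2) :=
      .digit_one hga.weakB.weakB .newBoundedVar (fun _ => hga' _) fun p => p.2.2.trans (hm₁' _)
    exact .lt (.numDist true h hq.weakB.weakB fun _ => hq' _)
      (.numDist true h hp.weakB.weakB fun _ => hp' _)
  · have h : PolyComputable (fun y : (x : α) × Fin (m x) =>
        digit (word (base y) 1) (gx y.1) y.2) :=
      .digit_one hgx.weakB .newBoundedVar (fun _ => hgx' _) fun p => p.2.2.trans (hm' _)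
    exact .lt (.numDist true h hp.weakB fun _ => hp' _) (.numDist true h hq.weakB fun _ => hq' _)
  · have h : PolyComputable (fun y : (x : α) × Fin (m x) =>
        digit (word (base y) 1) (gy y.1) y.2) :=
      .digit_one hgy.weakB .newBoundedVar (fun _ => hgy' _) fun p => p.2.2.trans (hm' _)
    exact .lt (.numDist true h hq.weakB fun _ => hq' _) (.numDist true h hp.weakB fun _ => hp' _)

theorem PolyDecidable.outlineNum {m₁ m gu ga gx gy : α → ℕ} (hm₁ : PolyComputable m₁)
    (hm : PolyComputable m) (hgu : PolyComputable gu) (hga : PolyComputable ga)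
    (hgx : PolyComputable gx) (hgy : PolyComputable gy)
    (hm₁' : ∀ x, m₁ x < size (base x)) (hm' : ∀ x, m x < size (base x))
    (hgu' : ∀ x, gu x < size (base x)) (hga' : ∀ x, ga x < size (base x))
    (hgx' : ∀ x, gx x < size (base x)) (hgy' : ∀ x, gy x < size (base x)) :
    PolyDecidable (fun x => OutlineNum (word (base x)) (m₁ x) (m x) (gu x) (ga x) (gx x)
      (gy x)) := by
  refine .and ?_ (.and ?_ (.and ?_ ?_))
  · refine .forall_lt hm₁ (fun x => (hm₁' x).le) (.forall_lt hm₁.weakB (fun x => (hm₁' _).le) ?_)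
    exact .le
      (.numDist true (.digit_one hga.weakB.weakB PolyComputable.newBoundedVar.weakB
          (fun _ => hga' _) fun p => p.1.2.2.trans (hm₁' _))
        (.digit_one hga.weakB.weakB .newBoundedVar (fun _ => hga' _)
          fun p => p.2.2.trans (hm₁' _)) fun _ => digit_one_lt _ _ _)
      (.numDist false (.digit_zero hgu.weakB.weakB PolyComputable.newBoundedVar.weakB
          (fun _ => hgu' _) fun p => p.1.2.2.trans (hm₁' _))
        (.digit_zero hgu.weakB.weakB .newBoundedVar (fun _ => hgu' _)
          fun p => p.2.2.trans (hm₁' _)) fun _ => digit_zero_lt _ _ _)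
  · exact .forall_lt hm (fun x => (hm' x).le) (.lt (.numDist true
      (.digit_one hgx.weakB .newBoundedVar (fun _ => hgx' _) fun p => p.2.2.trans (hm' _))
      (.digit_one hgy.weakB .newBoundedVar (fun _ => hgy' _) fun p => p.2.2.trans (hm' _))
      fun _ => digit_one_lt _ _ _) .word_zero)
  · refine .forall_lt .word_one (fun _ => word_one_le _) (.forall_lt .word_one
      (fun _ => word_one_le _) (.imp (.adjBit true PolyComputable.newBoundedVar.weakB
        .newBoundedVar) (.or ?_ ?_)))
    · exact .coveredNum hm₁.weakB.weakB hm.weakB.weakB hgu.weakB.weakB hga.weakB.weakB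
        hgx.weakB.weakB hgy.weakB.weakB PolyComputable.newBoundedVar.weakB .newBoundedVar
        (fun _ => hm₁' _) (fun _ => hm' _) (fun _ => hgu' _) (fun _ => hga' _) (fun _ => hgx' _)
        (fun _ => hgy' _) (fun p => p.1.2.2.trans (word_one_lt _))
        fun p => p.2.2.trans (word_one_lt _)
    · exact .coveredNum hm₁.weakB.weakB hm.weakB.weakB hgu.weakB.weakB hga.weakB.weakB
        hgx.weakB.weakB hgy.weakB.weakB .newBoundedVar PolyComputable.newBoundedVar.weakB
        (fun _ => hm₁' _) (fun _ => hm' _) (fun _ => hgu' _) (fun _ => hga' _) (fun _ => hgx' _)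
        (fun _ => hgy' _) (fun p => p.2.2.trans (word_one_lt _))
        fun p => p.1.2.2.trans (word_one_lt _)
  · refine .forall_lt .word_one (fun _ => word_one_le _) (.imp (.forall_lt .word_one
      (fun _ => word_one_le _) (.not (.adjBit true PolyComputable.newBoundedVar.weakB
        .newBoundedVar))) (.exists_lt hm₁.weakB (fun _ => (hm₁' _).le) ?_))
    exact .eq (.digit_one hga.weakB.weakB .newBoundedVar (fun _ => hga' _)
      fun p => p.2.2.trans (hm₁' _)) PolyComputable.newBoundedVar.weakB

theorem PolyDecidable.accepts (hsize : ∀ I : B, outlineSize (word I) < size I) :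
    PolyDecidable (fun x : α => Accepts (word (base x)) (size (base x))) := by
  refine .exists_lt (PolyComputable.outlineSize.add (.lit 1)) (fun x => hsize _) ?_
  refine .exists_lt .inputSize (fun _ => le_rfl) (.exists_lt .inputSize (fun _ => le_rfl)
    (.exists_lt .inputSize (fun _ => le_rfl) (.exists_lt .inputSize (fun _ => le_rfl)
      (.and ?_ ?_))))
  · exact .outlineNum PolyComputable.newBoundedVar.weakB.weakB.weakB.weakB .outlineSize
      PolyComputable.newBoundedVar.weakB.weakB.weakB PolyComputable.newBoundedVar.weakB.weakB
      PolyComputable.newBoundedVar.weakB .newBoundedVar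
      (fun p => p.1.1.1.1.2.2.trans_le (hsize _)) (fun p => hsize _)
      (fun p => p.1.1.1.2.2) (fun p => p.1.1.2.2) (fun p => p.1.2.2) (fun p => p.2.2)
  · refine .exists_lt .inputSize (fun _ => le_rfl) (.and ?_ ?_)
    · exact .inSet .inputSize (.loadSet .outlineSize
        PolyComputable.newBoundedVar.weakB.weakB.weakB.weakB.weakB
        PolyComputable.newBoundedVar.weakB.weakB.weakB.weakB .word_zero (fun _ => hsize _)
        (fun p => p.1.1.1.1.1.2.2.trans_le (hsize _)) (fun p => p.1.1.1.1.2.2)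
        fun _ => word_zero_le _) .newBoundedVar (fun _ => le_rfl) fun p => p.2.2
    · refine .forall_lt .outlineSize (fun _ => (hsize _).le) (.eq ?_ (.numDist true ?_ ?_
        fun _ => digit_one_lt _ _ _))
      · exact .digit_zero_add PolyComputable.newBoundedVar.weakB .newBoundedVar
          (fun p => p.1.2.2) fun p => p.2.2.trans (hsize _)
      · exact .digit_one PolyComputable.newBoundedVar.weakB.weakB.weakB .newBoundedVar
          (fun p => p.1.1.1.2.2) fun p => p.2.2.trans (hsize _)
      · exact .digit_one PolyComputable.newBoundedVar.weakB.weakB .newBoundedVar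
          (fun p => p.1.1.2.2) fun p => p.2.2.trans (hsize _)

end

/-! ### The meaning of the computed numbers -/

theorem List.getD_flatMap {α : Type} {g : α → List ℕ} {m : ℕ} (hg : ∀ a, (g a).length = m)
    {l : List α} {i j : ℕ} (hi : i < l.length) (hj : j < m) :
    (l.flatMap g).getD (m * i + j) 0 = (g l[i]).getD j 0 := by
  induction l generalizing i with
  | nil => simp at hi
  | cons a l ih =>
    rw [List.flatMap_cons]
    cases i with
    | zero => rw [List.getD_append _ _ _ _ (by rw [hg]; omega)]; simp
    | succ i =>
      rw [List.getD_append_right _ _ _ _ (by rw [hg]; nlinarith), hg,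
        show m * (i + 1) + j - m = m * i + j by rw [Nat.mul_succ]; omega]
      simpa using ih (by simpa using hi)

theorem adjWord_length {n : ℕ} (G : SimpleGraph (Fin n)) : (adjWord G).length = n * n := by
  simp [adjWord, List.length_flatMap]

theorem adjWord_getD {n : ℕ} (G : SimpleGraph (Fin n)) (i j : Fin n) :
    (adjWord G).getD (n * i + j) 0 = 1 ↔ G.Adj i j := by
  rw [adjWord, List.getD_flatMap (m := n) (by simp) (by simp) j.2]
  simp

/-- The word `w` encodes the graphs `G` and `F`. -/
structure Encodes (w : ℕ → ℕ) {n k : ℕ} (G : SimpleGraph (Fin n)) (F : SimpleGraph (Fin k)) :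
    Prop where
  fst : w 0 = n
  snd : w 1 = k
  adj : ∀ i j : Fin n, AdjBit w false i j ↔ G.Adj i j
  adj' : ∀ i j : Fin k, AdjBit w true i j ↔ F.Adj i j

theorem IdInstance.encodes (I : IdInstance) : Encodes (fun i => I.encode.getD i 0) I.G I.F where
  fst := rfl
  snd := rfl
  adj i j := by
    have h : I.n * i + j < I.n * I.n := by
      have := i.2; have := j.2; nlinarith
    rw [← adjWord_getD, AdjBit, if_neg (by simp), Nat.add_comm 2]
    change (adjWord I.G ++ adjWord I.F).getD (I.n * i + j) 0 = 1 ↔ _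
    rw [List.getD_append _ _ _ _ (by rwa [adjWord_length])]
  adj' i j := by
    rw [← adjWord_getD, AdjBit, if_pos rfl, Nat.add_comm 2]
    change (adjWord I.G ++ adjWord I.F).getD (I.n * I.n + (I.k * i + j)) 0 = 1 ↔ _
    rw [List.getD_append_right _ _ _ _ (by rw [adjWord_length]; omega), adjWord_length,
      Nat.add_sub_cancel_left]

section

variable {w : ℕ → ℕ} {t : Bool} {c : ℕ} {H : SimpleGraph (Fin c)}

theorem inSet_ballSet (hc : vertexCount w t = c) (hadj : ∀ i j : Fin c, AdjBit w t i j ↔ H.Adj i j)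
    (u v : Fin c) (s : ℕ) :
    InSet c (ballSet w t u s) v ↔ ∃ p : H.Walk u v, p.length ≤ s := by
  induction s generalizing v with
  | zero =>
    rw [ballSet, iterFrom_zero, hc, inSet_bitSet]
    constructor
    · rintro ⟨-, h⟩
      obtain rfl := Fin.ext h
      exact ⟨.nil, le_rfl⟩
    · rintro ⟨p, hp⟩
      rw [SimpleGraph.Walk.eq_of_length_eq_zero (Nat.le_zero.mp hp)]
      exact ⟨v.2, rfl⟩
  | succ s ih =>
    rw [ballSet, iterFrom_succ, ← ballSet, hc, inSet_bitSet]
    constructor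
    · rintro ⟨-, h | ⟨i, hi, h, ha⟩⟩
      · obtain ⟨p, hp⟩ := (ih v).mp h
        exact ⟨p, hp.trans (Nat.le_succ s)⟩
      · obtain ⟨p, hp⟩ := (ih ⟨i, hi⟩).mp h
        exact ⟨p.concat ((hadj ⟨i, hi⟩ v).mp ha), by
          rw [SimpleGraph.Walk.length_concat]; omega⟩
    · rintro ⟨p, hp⟩
      refine ⟨v.2, ?_⟩
      rcases Nat.lt_or_ge p.length (s + 1) with hlt | hge
      · exact .inl ((ih v).mpr ⟨p, by omega⟩)
      · refine .inr ⟨p.penultimate, p.penultimate.2, (ih _).mpr ⟨p.dropLast, ?_⟩, ?_⟩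
        · have := p.length_dropLast_add_one (by rw [← SimpleGraph.Walk.length_eq_zero_iff]; omega)
          omega
        · exact (hadj _ _).mpr (p.adj_penultimate (by
            rw [← SimpleGraph.Walk.length_eq_zero_iff]; omega))

theorem sum_truth_lt (d N : ℕ) : ∑ s ∈ Finset.range N, truth (s < d) = min N d := by
  induction N with
  | zero => simp
  | succ N ih =>
    rw [Finset.sum_range_succ, ih]
    by_cases h : N < d
    · rw [truth_true h]; omega
    · rw [truth_false h]; omega

theorem numDist_eq (hc : vertexCount w t = c) (hadj : ∀ i j : Fin c, AdjBit w t i j ↔ H.Adj i j)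
    (hle : c ≤ w 0) (u v : Fin c) : numDist w t u v = truncDist (w 0) H u v := by
  by_cases hr : H.Reachable u v
  · rw [truncDist_of_reachable hr]
    have hd := hr.dist_lt_card
    rw [Fintype.card_fin] at hd
    rw [← min_eq_right (hd.le.trans hle), ← sum_truth_lt, numDist]
    refine Finset.sum_congr rfl fun s _ => truth_congr ?_
    rw [hc, inSet_ballSet hc hadj, ← not_le, not_iff_not]
    constructor
    · rintro ⟨p, hp⟩
      exact (SimpleGraph.dist_le p).trans hp
    · intro h
      obtain ⟨p, hp⟩ := hr.exists_walk_length_eq_dist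
      exact ⟨p, hp.trans_le h⟩
  · rw [truncDist_of_not_reachable hr, numDist, Finset.sum_congr rfl fun s _ => truth_true ?_]
    · simp
    · rw [hc, inSet_ballSet hc hadj]
      rintro ⟨p, -⟩
      exact hr p.reachable

end

theorem sum_truth_eq_ncard {c : ℕ} (P : Fin c → Prop) (Q : ℕ → Prop) (h : ∀ i : Fin c, Q i ↔ P i) :
    ∑ i ∈ Finset.range c, truth (Q i) = {i | P i}.ncard := by
  classical
  rw [Finset.sum_range, Set.ncard_eq_toFinset_card', Finset.card_eq_sum_ones, Set.toFinset_ofPred,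
    Finset.sum_filter]
  refine Finset.sum_congr rfl fun i _ => ?_
  rw [truth_congr (h i)]
  unfold truth
  congr

theorem digit_mul_add {c g r : ℕ} (hr : r < c) (i : ℕ) : digit c (c * g + r) (i + 1) = digit c g i := by
  rw [digit, digit, pow_succ', ← Nat.div_div_eq_div_mul, Nat.mul_add_div (by omega),
    Nat.div_eq_of_lt hr, add_zero]

/-- Every sequence of `m` digits is the sequence of digits of a number. -/
theorem exists_digit_eq {c m : ℕ} (f : ℕ → ℕ) (hf : ∀ j < m, f j < c) :
    ∃ g < c ^ m, ∀ j < m, digit c g j = f j := by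
  induction m generalizing f with
  | zero => exact ⟨0, by simp, by simp⟩
  | succ m ih =>
    obtain ⟨g, hg, h⟩ := ih (fun j => f (j + 1)) fun j hj => hf (j + 1) (by omega)
    have h0 := hf 0 (by omega)
    refine ⟨c * g + f 0, ?_, fun j hj => ?_⟩
    · rw [pow_succ']
      nlinarith [Nat.mul_le_mul_left c (Nat.succ_le_of_lt hg)]
    · cases j with
      | zero => rw [digit, pow_zero, Nat.div_one, Nat.mul_add_mod, Nat.mod_eq_of_lt h0]
      | succ j => rw [digit_mul_add h0, h j (by omega)]

/-- The elements of `loadSet` come from distributions of the pieces to the paths. -/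
theorem exists_of_inSet_loadSet {w : ℕ → ℕ} {N m m₁ g t s : ℕ}
    (h : InSet N (loadSet w N m m₁ g t) s) : ∃ b δ : ℕ → ℕ, (∀ i < t, b i < m) ∧
      (∀ i < t, δ i = 0 ∨ FreePieceNum w m₁ g i (δ i)) ∧
        ∀ j < m, ∑ i ∈ Finset.range t, (if b i = j then δ i else 0) = digit (w 0 + 1) s j := by
  induction t generalizing s with
  | zero =>
    rw [loadSet, iterFrom_zero, inSet_bitSet] at h
    exact ⟨0, 0, by simp, by simp, fun j hj => by simp [h.2 j hj]⟩
  | succ t ih =>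
    rw [loadSet, iterFrom_succ, ← loadSet, inSet_bitSet] at h
    obtain ⟨-, s₀, -, hs₀, j₀, hj₀, hne, d, -, hd, hfree⟩ := h
    obtain ⟨b, δ, hb, hδ, hsum⟩ := ih hs₀
    refine ⟨Function.update b t j₀, Function.update δ t d, fun i hi => ?_, fun i hi => ?_,
      fun j hj => ?_⟩
    · rcases Nat.lt_succ_iff_lt_or_eq.mp hi with hi | rfl
      · rw [Function.update_of_ne hi.ne]; exact hb i hi
      · rwa [Function.update_self]
    · rcases Nat.lt_succ_iff_lt_or_eq.mp hi with hi | rfl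
      · rw [Function.update_of_ne hi.ne]; exact hδ i hi
      · rwa [Function.update_self]
    · rw [Finset.sum_range_succ, Finset.sum_congr rfl fun i hi => by
        rw [Function.update_of_ne (Finset.mem_range.mp hi).ne,
          Function.update_of_ne (Finset.mem_range.mp hi).ne], hsum j hj, Function.update_self,
        Function.update_self]
      split_ifs with hjj
      · rw [← hjj, hd]
      · rw [add_zero]
        exact ((hne j hj).resolve_left (Ne.symm hjj)).symm

/-- The loads of a distribution of the pieces to the paths are an element of `loadSet`, provided
that `N` is large enough for the codes of the loads. -/
theorem inSet_loadSet {w : ℕ → ℕ} {N m m₁ g t s : ℕ} {b δ : ℕ → ℕ} (hN : (w 0 + 1) ^ m ≤ N)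
    (hb : ∀ i < t, b i < m) (hδ : ∀ i < t, δ i = 0 ∨ FreePieceNum w m₁ g i (δ i))
    (hlt : ∀ j < m, ∑ i ∈ Finset.range t, (if b i = j then δ i else 0) < w 0 + 1) (hs : s < N)
    (hsum : ∀ j < m, ∑ i ∈ Finset.range t, (if b i = j then δ i else 0) = digit (w 0 + 1) s j) :
    InSet N (loadSet w N m m₁ g t) s := by
  induction t generalizing s with
  | zero =>
    rw [loadSet, iterFrom_zero, inSet_bitSet]
    exact ⟨hs, fun j hj => by simp [← hsum j hj]⟩
  | succ t ih =>
    rw [loadSet, iterFrom_succ, ← loadSet, inSet_bitSet]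
    simp only [Finset.sum_range_succ] at hlt hsum
    obtain ⟨s₀, hs₀, h₀⟩ := exists_digit_eq (c := w 0 + 1) (m := m)
      (fun j => ∑ i ∈ Finset.range t, (if b i = j then δ i else 0))
      fun j hj => (Nat.le_add_right _ _).trans_lt (hlt j hj)
    have hbt := hb t (Nat.lt_succ_self t)
    have hlt' := hlt _ hbt
    have hsum' := hsum _ hbt
    rw [if_pos rfl] at hlt' hsum'
    refine ⟨hs, s₀, hs₀.trans_le hN, ih (fun i hi => hb i (by omega)) (fun i hi => hδ i (by omega))
      (fun j hj => (Nat.le_add_right _ _).trans_lt (hlt j hj)) (hs₀.trans_le hN)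
      (fun j hj => (h₀ j hj).symm), b t, hbt, fun j hj => ?_, δ t, by omega, ?_,
      hδ t (Nat.lt_succ_self t)⟩
    · rw [or_iff_not_imp_left]
      intro hne
      rw [h₀ j hj, ← hsum j hj, if_neg (Ne.symm hne), add_zero]
    · rw [h₀ _ hbt, hsum']

namespace Encodes

variable {w : ℕ → ℕ} {n k : ℕ} {G : SimpleGraph (Fin n)} {F : SimpleGraph (Fin k)}

theorem numDist_false (E : Encodes w G F) (u v : Fin n) :
    numDist w false u v = truncDist n G u v := by
  rw [numDist_eq (t := false) (H := G) E.fst E.adj E.fst.ge, E.fst]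

theorem numDist_true (E : Encodes w G F) (hk : k ≤ n) (u v : Fin k) :
    numDist w true u v = truncDist n F u v := by
  rw [numDist_eq (t := true) (H := F) E.snd E.adj' (by rwa [E.fst]), E.fst]

theorem leafCount_eq (E : Encodes w G F) : leafCount w = numLeaves F := by
  rw [leafCount, E.snd]
  refine sum_truth_eq_ncard _ _ fun i => ?_
  rw [sum_truth_eq_ncard (fun j => F.Adj i j) _ (E.adj' i)]
  rfl

theorem outlineSize_eq (E : Encodes w G F) : outlineSize w = 9 * numLeaves F ^ 2 := by
  rw [outlineSize, E.leafCount_eq]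
  ring

theorem freePieceNum_iff (E : Encodes w G F) {m g : ℕ} {u : ℕ → Fin n}
    (hu : ∀ j < m, digit n g j = u j) (i : Fin n) (d : ℕ) :
    FreePieceNum w m g i d ↔ IsFreePiece G m u i d := by
  have h1 : (∀ j < m, ¬ numDist w false (digit (w 0) g j) i < w 0) ↔
      ∀ j < m, ¬ truncDist n G (u j) i < n := by
    refine forall₂_congr fun j hj => ?_
    rw [E.fst, hu j hj, E.numDist_false]
  have h2 : (∀ i' < (i : ℕ), ¬ numDist w false i' i < w 0) ↔
      ∀ i' < i, ¬ truncDist n G i' i < n := by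
    refine ⟨fun h i' hi' => ?_, fun h i' hi' => ?_⟩
    · have := h i' hi'
      rwa [E.numDist_false, E.fst] at this
    · have := h ⟨i', hi'.trans i.2⟩ hi'
      rw [← E.numDist_false] at this
      rwa [E.fst]
  have h3 : (∃ v < w 0, ∃ z < w 0, numDist w false i v < w 0 ∧ numDist w false i z < w 0 ∧
      d ≤ numDist w false v z) ↔
      ∃ v z, truncDist n G i v < n ∧ truncDist n G i z < n ∧ d ≤ truncDist n G v z := by
    simp only [← E.numDist_false, E.fst, Fin.exists_iff, exists_prop]
  rw [FreePieceNum, h1, h2, h3]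
  exact ⟨fun h => ⟨h.1, h.2.1, h.2.2⟩, fun h => ⟨h.1, h.2, h.3⟩⟩

theorem coveredNum_iff (E : Encodes w G F) (hk : k ≤ n) {m₁ m gu ga gx gy : ℕ} {u : ℕ → Fin n}
    {a x y : ℕ → Fin k} (hu : ∀ j < m₁, digit n gu j = u j)
    (ha : ∀ j < m₁, digit k ga j = a j) (hx : ∀ j < m, digit k gx j = x j)
    (hy : ∀ j < m, digit k gy j = y j) (p q : Fin k) :
    CoveredNum w m₁ m gu ga gx gy p q ↔ IsCovered G F m₁ m u a x y p q := by
  refine or_congr (exists_congr fun i => and_congr_right fun hi => exists_congr fun j =>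
    and_congr_right fun hj => ?_) (exists_congr fun j => and_congr_right fun hj => ?_)
  · rw [E.fst, E.snd, hu i hi, hu j hj, ha i hi, ha j hj, E.numDist_false]
    simp only [E.numDist_true hk]
    rfl
  · rw [E.snd, hx j hj, hy j hj]
    simp only [E.numDist_true hk]
    rfl

theorem outlineNum_iff (E : Encodes w G F) (hk : k ≤ n) {m₁ m gu ga gx gy : ℕ} {u : ℕ → Fin n}
    {a x y : ℕ → Fin k} (hu : ∀ j < m₁, digit n gu j = u j)
    (ha : ∀ j < m₁, digit k ga j = a j) (hx : ∀ j < m, digit k gx j = x j)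
    (hy : ∀ j < m, digit k gy j = y j) :
    OutlineNum w m₁ m gu ga gx gy ↔ IsOutline G F m₁ m u a x y := by
  have h1 : (∀ i < m₁, ∀ j < m₁, numDist w true (digit (w 1) ga i) (digit (w 1) ga j) ≤
      numDist w false (digit (w 0) gu i) (digit (w 0) gu j)) ↔
      ∀ i < m₁, ∀ j < m₁, truncDist n F (a i) (a j) ≤ truncDist n G (u i) (u j) := by
    refine forall₂_congr fun i hi => forall₂_congr fun j hj => ?_
    rw [E.fst, E.snd, hu i hi, hu j hj, ha i hi, ha j hj, E.numDist_false, E.numDist_true hk]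
  have h2 : (∀ j < m, numDist w true (digit (w 1) gx j) (digit (w 1) gy j) < w 0) ↔
      ∀ j < m, truncDist n F (x j) (y j) < n := by
    refine forall₂_congr fun j hj => ?_
    rw [E.snd, hx j hj, hy j hj, E.numDist_true hk, E.fst]
  have h3 : (∀ p < w 1, ∀ q < w 1, AdjBit w true p q →
      CoveredNum w m₁ m gu ga gx gy p q ∨ CoveredNum w m₁ m gu ga gx gy q p) ↔
      ∀ p q, F.Adj p q →
        IsCovered G F m₁ m u a x y p q ∨ IsCovered G F m₁ m u a x y q p := by
    simp only [← E.coveredNum_iff hk hu ha hx hy, ← E.adj', E.snd, Fin.forall_iff]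
  have h4 : (∀ v < w 1, (∀ z < w 1, ¬ AdjBit w true v z) → ∃ i < m₁, digit (w 1) ga i = v) ↔
      ∀ v, (∀ z, ¬ F.Adj v z) → ∃ i < m₁, a i = v := by
    simp only [← E.adj', E.snd, Fin.forall_iff]
    refine forall₂_congr fun v _ => imp_congr_right fun _ => exists_congr fun i =>
      and_congr_right fun hi => ?_
    rw [ha i hi, Fin.ext_iff]
  rw [OutlineNum, h1, h2, h3, h4]
  exact ⟨fun h => ⟨h.1, h.2.1, h.2.2.1, h.2.2.2⟩, fun h => ⟨h.1, h.2, h.3, h.4⟩⟩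

/-- The predicate that the machine evaluates is correct as soon as `N` exceeds all codes. -/
theorem accepts_iff (E : Encodes w G F) (hF : F.IsAcyclic) (hk : k ≤ n) (hk0 : 0 < k)
    (hℓ : 0 < numLeaves F) {N : ℕ} (hN : (n + 1) ^ outlineSize w ≤ N) :
    Accepts w N ↔ ∃ f : Fin n → Fin k, IsIdentificationMap G F f := by
  obtain ⟨R⟩ := hF.exists_rooting
  constructor
  · rintro ⟨m₁, -, gu, -, ga, -, gx, -, gy, -, h, s, -, hs, hsum⟩
    have hu : ∀ j < m₁, digit n gu j = (⟨digit n gu j, Nat.mod_lt _ (by omega)⟩ : Fin n) :=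
      fun j _ => rfl
    have hv : ∀ g m, ∀ j < m, digit k g j = (⟨digit k g j, Nat.mod_lt _ hk0⟩ : Fin k) :=
      fun g m j _ => rfl
    rw [E.outlineNum_iff hk hu (hv ga m₁) (hv gx _) (hv gy _)] at h
    obtain ⟨b, δ, hb, hδ, hload⟩ := exists_of_inSet_loadSet hs
    rw [E.fst] at hb hδ hload
    refine h.exists_isIdentificationMap (b := b) (δ := δ) R hk hk0 ⟨hb, fun i => ?_, fun j hj => ?_⟩
    · exact (hδ i i.2).imp_right (E.freePieceNum_iff hu i _).mp
    · have := hsum j hj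
      rw [E.fst, E.snd, hv gx _ j hj, hv gy _ j hj, E.numDist_true hk] at this
      rw [hload j hj, this]
  · rintro ⟨f, hf⟩
    obtain ⟨m₁, hm₁, u, a, x, y, b, δ, ho, hd⟩ := hf.exists_certificate R hk hk0 hℓ
    rw [← E.outlineSize_eq] at hm₁ ho hd
    have hcode : ∀ {c m : ℕ}, c ≤ n → m ≤ outlineSize w → ∀ z : ℕ → Fin c,
        ∃ g < N, ∀ j < m, digit c g j = z j := by
      intro c m hc hm z
      obtain ⟨g, hg, h⟩ := exists_digit_eq (m := m) (fun j => (z j : ℕ)) fun j _ => (z j).2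
      refine ⟨g, hg.trans_le (le_trans ?_ hN), h⟩
      exact (Nat.pow_le_pow_left (by omega) m).trans (Nat.pow_le_pow_right (by omega) hm)
    obtain ⟨gu, hgu, hu⟩ := hcode le_rfl hm₁ u
    obtain ⟨ga, hga, ha⟩ := hcode hk hm₁ a
    obtain ⟨gx, hgx, hx⟩ := hcode hk le_rfl x
    obtain ⟨gy, hgy, hy⟩ := hcode hk le_rfl y
    obtain ⟨s, hs, hsum⟩ := exists_digit_eq (c := n + 1) (m := outlineSize w)
      (fun j => truncDist n F (x j) (y j)) fun j hj => (ho.path j hj).trans (Nat.lt_succ_self n)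
    refine ⟨m₁, by omega, gu, hgu, ga, hga, gx, hgx, gy, hgy,
      (E.outlineNum_iff hk hu ha hx hy).mpr ho, s, hs.trans_le hN, ?_, fun j hj => ?_⟩
    · refine inSet_loadSet (b := b) (δ := δ) (by rwa [E.fst]) (by rw [E.fst]; exact hd.lt) ?_ ?_
        (hs.trans_le hN) ?_
      · intro i hi
        rw [E.fst] at hi
        exact (hd.free ⟨i, hi⟩).imp_right (E.freePieceNum_iff hu ⟨i, hi⟩ _).mpr
      · intro j hj
        rw [E.fst, hd.sum j hj]
        exact (ho.path j hj).trans (Nat.lt_succ_self n)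
      · intro j hj
        rw [E.fst, hd.sum j hj, hsum j hj]
    · rw [E.fst, E.snd, hsum j hj, hx j hj, hy j hj, E.numDist_true hk]

end Encodes

/-! ### The machine -/

theorem numLeaves_pos {k : ℕ} {F : SimpleGraph (Fin k)} (hF : F.IsAcyclic) (hk : 0 < k) :
    0 < numLeaves F := by
  obtain ⟨R⟩ := hF.exists_rooting
  obtain ⟨t, ht, -⟩ := R.exists_tip_below ⟨0, hk⟩
  exact (Finset.card_pos.mpr ⟨t, ht⟩).trans_le R.card_tips_le

/-- The contents of the memory at the beginning. -/
noncomputable def IdInstance.memory (I : IdInstance) (i : ℕ) : ℕ := I.encode.getD i 0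

/-- A bound on the codes of all parts of a certificate. -/
noncomputable def IdInstance.codeBound (I : IdInstance) : ℕ := (I.n + 1) ^ outlineSize I.memory

theorem IdInstance.codeBound_eq (I : IdInstance) :
    I.codeBound = (I.n + 1) ^ (9 * numLeaves I.F ^ 2) := by
  rw [codeBound]
  exact congrArg _ I.encodes.outlineSize_eq

/-- An instance for which the search of a certificate is meaningful, with the size parameter `σ`. The
machine runs first with a size that it can compute directly, and then with a bound on the codes. -/
structure SizedInstance (σ : IdInstance → ℕ) extends IdInstance where
  pos : 0 < k
  le : k ≤ n
  lt : n < σ toIdInstance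

noncomputable instance {σ : IdInstance → ℕ} : MachineInput (SizedInstance σ) where
  size I := σ I.toIdInstance
  word I := I.toIdInstance.memory
  size_pos I := (Nat.zero_le _).trans_lt I.lt

instance {σ : IdInstance → ℕ} : GraphPairInput (SizedInstance σ) where
  pos I t := by
    cases t
    · exact I.pos.trans_le I.le
    · exact I.pos
  lt I t := by
    cases t
    · exact I.lt
    · exact I.le.trans_lt I.lt

/-- Multiplication by `c` is computed in polynomial time, in every context. -/
def MulComputable {B : Type} [MachineInput B] (c : B → ℕ) : Prop :=
  ∀ (α : Type) [MachineCtx α B] (X : α → ℕ), PolyComputable X →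
    PolyComputable (fun x => c (base x) * X x)

/-- Multiplication by a power is repeated multiplication. Here `c` may exceed the size. -/
theorem MulComputable.pow {B : Type} [MachineInput B] {c e : B → ℕ} (hc : MulComputable c)
    (he : PolyComputable e) (hle : ∀ I, e I ≤ size I) : MulComputable (fun I => c I ^ e I) := by
  intro α _ X hX
  have he' : PolyComputable (fun x : α => e (base x)) :=
    he.extend base (Nat.zero_le _) (fun _ => rfl) fun _ i hi => absurd hi (Nat.not_lt_zero i)
  refine (PolyComputable.iterFrom (f := fun x _ Y => c (base x) * Y) he' (fun x => hle _) hX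
    (hc _ _ .newVar)).congr fun x => ?_
  change c (base x) ^ e (base x) * X x = _
  generalize e (base x) = n
  induction n with
  | zero => simp
  | succ n ih => rw [iterFrom_succ, ← ih, pow_succ', mul_assoc]

/-- The exponent `9 ℓ ^ 2` may exceed the size `n + 9`, so the power is computed by three nested
loops. -/
theorem polyComputable_codeBound :
    PolyComputable (fun I : SizedInstance (fun I => I.n + 9) => I.codeBound) := by
  have h : MulComputable (fun I : SizedInstance (fun I => I.n + 9) => word I 0 + 1) :=
    fun α _ X hX => (PolyComputable.word_zero.add (.lit 1)).mul hX fun x => word_zero_lt _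
  have hℓ : PolyComputable (fun I : SizedInstance (fun I => I.n + 9) => leafCount (word I)) :=
    .leafCount
  have hℓ' : ∀ I : SizedInstance (fun I => I.n + 9), leafCount (word I) ≤ size I :=
    fun I => (leafCount_le _).trans (word_one_le I)
  refine (((h.pow hℓ hℓ').pow (.lit 9) fun I => Nat.le_add_left 9 _).pow hℓ hℓ' _ _
    (.lit 1)).congr fun I => ?_
  change _ = (((I.n + 1) ^ leafCount I.memory) ^ 9) ^ leafCount I.memory * 1
  rw [mul_one, ← pow_mul, ← pow_mul, mul_comm 9]
  rfl

theorem polyDecidable_accepts : PolyDecidable (fun I : SizedInstance IdInstance.codeBound =>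
    Accepts I.memory I.codeBound) :=
  PolyDecidable.accepts (B := SizedInstance IdInstance.codeBound) fun I => by
    have h1 : 0 < I.n := I.pos.trans_le I.le
    exact Nat.lt_pow_self (by omega)

/-- The instances for which the search of a certificate is not meaningful. -/
theorem exists_isIdentificationMap_iff_of_trivial {n k : ℕ} {G : SimpleGraph (Fin n)}
    {F : SimpleGraph (Fin k)} (h : k = 0 ∨ n ≤ 1 ∧ k ≠ 0 ∨ n < k) :
    (∃ f : Fin n → Fin k, IsIdentificationMap G F f) ↔ n = k := by
  constructor
  · rintro ⟨f, hf⟩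
    have h1 : k ≤ n := by simpa using Fintype.card_le_of_surjective f hf.surjective
    have h2 : k = 0 → n = 0 := by
      rintro rfl
      by_contra hn
      exact (f ⟨0, by omega⟩).elim0
    omega
  · rintro rfl
    have : Subsingleton (Fin n) := Fin.subsingleton_iff_le_one.mpr (by omega)
    exact ⟨id, Function.surjective_id, fun _ _ _ => .inl (Subsingleton.elim _ _),
      fun p q hpq => absurd (Subsingleton.elim p q) hpq.ne⟩

/-- The answer if one of the graphs is very small or the second graph is larger. -/
def compareProg : RamProg :=
  .assign 0 (.sub (.lit 1) (.add (.sub (.load (.lit 0)) (.load (.lit 1)))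
    (.sub (.load (.lit 1)) (.load (.lit 0)))))

/-- The program that decides Identification for forests, from programs `p` that computes the bound
on the codes and `q` that looks for a certificate, each with its result in register `1`. -/
def identificationProg (p q : RamProg) : RamProg :=
  .cond (.load (.lit 1))
    (.cond (.sub (.load (.lit 0)) (.lit 1))
      (.cond (.sub (.load (.lit 1)) (.load (.lit 0))) compareProg
        (.seq (.assign 0 (.add (.load (.lit 0)) (.lit 9)))
          (.seq p (.seq (.assign 0 (.reg 1)) (.seq q (.assign 0 (.reg 1)))))))
      compareProg)
    compareProg

theorem exists_exec_compareProg (I : IdInstance)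
    (h : I.k = 0 ∨ I.n ≤ 1 ∧ I.k ≠ 0 ∨ I.n < I.k) :
    ∃ s, RamExec compareProg (.init I.encode) s 14 ∧
      s.regs 0 = truth (∃ f : Fin I.n → Fin I.k, IsIdentificationMap I.G I.F f) := by
  refine ⟨_, .assign _ _ _, ?_⟩
  rw [truth_congr (exists_isIdentificationMap_iff_of_trivial h)]
  change Function.update (fun _ => 0) 0 (1 - (I.n - I.k + (I.k - I.n))) 0 = _
  rw [Function.update_self]
  by_cases hnk : I.n = I.k
  · rw [truth_true hnk]; omega
  · rw [truth_false hnk]; omega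

/-- The time of the computation as a function of `n` and `L = ℓ ^ 2`. The constant comes from
`n + 10 ≤ n ^ 4` and `(n + 1) ^ (9 * L) + 1 ≤ n ^ (19 * L)`. -/
theorem add_pow_add_pow_le {n L C₁ D₁ C₂ D₂ : ℕ} (hn : 2 ≤ n) (hL : 1 ≤ L) :
    28 + C₁ * (n + 9 + 1) ^ D₁ + C₂ * ((n + 1) ^ (9 * L) + 1) ^ D₂ ≤
      (28 + C₁ + C₂ + 4 * D₁ + 19 * D₂) * n ^ ((28 + C₁ + C₂ + 4 * D₁ + 19 * D₂) * L) := by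
  set c := 28 + C₁ + C₂ + 4 * D₁ + 19 * D₂ with hc
  have hcL : c ≤ c * L := Nat.le_mul_of_pos_right c hL
  have h1 : (n + 9 + 1) ^ D₁ ≤ n ^ (c * L) := by
    have : n + 9 + 1 ≤ n ^ 4 := by
      have : 2 ^ 3 ≤ n ^ 3 := Nat.pow_le_pow_left hn 3
      rw [pow_succ]
      nlinarith
    calc (n + 9 + 1) ^ D₁ ≤ (n ^ 4) ^ D₁ := Nat.pow_le_pow_left this D₁
      _ = n ^ (4 * D₁) := (pow_mul _ _ _).symm
      _ ≤ n ^ (c * L) := Nat.pow_le_pow_right (by omega) (by omega)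
  have h2 : ((n + 1) ^ (9 * L) + 1) ^ D₂ ≤ n ^ (c * L) := by
    have : (n + 1) ^ (9 * L) + 1 ≤ n ^ (19 * L) := by
      have hs : (n + 1) ^ (9 * L) ≤ (n ^ 2) ^ (9 * L) := Nat.pow_le_pow_left (by nlinarith) _
      have hp : 0 < (n ^ 2) ^ (9 * L) := by positivity
      calc (n + 1) ^ (9 * L) + 1 ≤ (n ^ 2) ^ (9 * L) * n := by nlinarith
        _ = n ^ (18 * L + 1) := by rw [← pow_mul, ← pow_succ]; congr 1; ring
        _ ≤ n ^ (19 * L) := Nat.pow_le_pow_right (by omega) (by omega)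
    calc ((n + 1) ^ (9 * L) + 1) ^ D₂ ≤ (n ^ (19 * L)) ^ D₂ := Nat.pow_le_pow_left this D₂
      _ = n ^ (19 * D₂ * L) := by rw [← pow_mul]; congr 1; ring
      _ ≤ n ^ (c * L) := Nat.pow_le_pow_right (by omega) (Nat.mul_le_mul_right L (by omega))
  have h3 : 1 ≤ n ^ (c * L) := Nat.one_le_pow _ _ (by omega)
  calc _ ≤ 28 * n ^ (c * L) + C₁ * n ^ (c * L) + C₂ * n ^ (c * L) := by gcongr; omega
    _ = (28 + C₁ + C₂) * n ^ (c * L) := by ring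
    _ ≤ _ := Nat.mul_le_mul_right _ (by omega)

theorem mainTheorem4 :
    ∃ c : ℕ, SolvableInTime IdInstance.encode
      (fun I => I.F.IsAcyclic)
      (fun I => CanBeIdentifiedTo I.G I.F)
      (fun I => c * max I.n 1 ^ (c * numLeaves I.F ^ 2)) := by
  obtain ⟨C₁, D₁, h₁⟩ := polyComputable_codeBound
  obtain ⟨C₂, D₂, h₂⟩ := polyDecidable_accepts
  obtain ⟨p, hp⟩ := h₁ (fun _ => 0) 1 one_pos fun _ _ => one_pos
  obtain ⟨q, hq⟩ := h₂ (fun _ => 0) 1 one_pos fun _ _ => one_pos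
  refine ⟨28 + C₁ + C₂ + 4 * D₁ + 19 * D₂, identificationProg p q, fun I hI => ?_⟩
  suffices h : ∃ s t, RamExec (identificationProg p q) (.init I.encode) s t ∧
      t ≤ (28 + C₁ + C₂ + 4 * D₁ + 19 * D₂) *
        max I.n 1 ^ ((28 + C₁ + C₂ + 4 * D₁ + 19 * D₂) * numLeaves I.F ^ 2) ∧
      s.regs 0 = truth (∃ f : Fin I.n → Fin I.k, IsIdentificationMap I.G I.F f) by
    obtain ⟨s, t, hex, ht, hs⟩ := h
    refine ⟨s, t, hex, ht, fun hy => ?_, fun hy => ?_⟩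
    · rw [hs, truth_true (canBeIdentifiedTo_iff.mp hy)]
    · rw [hs, truth_false (mt canBeIdentifiedTo_iff.mpr hy)]
  have hconst : ∀ t, t ≤ 28 → t ≤ (28 + C₁ + C₂ + 4 * D₁ + 19 * D₂) *
      max I.n 1 ^ ((28 + C₁ + C₂ + 4 * D₁ + 19 * D₂) * numLeaves I.F ^ 2) := fun t ht =>
    le_trans (by omega) (Nat.le_mul_of_pos_right _ (by positivity))
  rcases Nat.eq_zero_or_pos I.k with hk0 | hk0
  · obtain ⟨s, hs, hs'⟩ := exists_exec_compareProg I (.inl hk0)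
    exact ⟨s, _, .cond_false hk0 hs, hconst _ (by simp [RamExpr.cost]), hs'⟩
  rcases Nat.lt_or_ge 1 I.n with hn | hn
  swap
  · obtain ⟨s, hs, hs'⟩ := exists_exec_compareProg I (.inr (.inl ⟨hn, hk0.ne'⟩))
    exact ⟨s, _, .cond_true hk0.ne' (.cond_false (Nat.sub_eq_zero_of_le hn) hs),
      hconst _ (by simp [RamExpr.cost]), hs'⟩
  have hn' : (RamExpr.sub (.load (.lit 0)) (.lit 1)).value (.init I.encode) ≠ 0 :=
    Nat.sub_ne_zero_of_lt hn
  rcases Nat.lt_or_ge I.n I.k with hk | hk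
  · obtain ⟨s, hs, hs'⟩ := exists_exec_compareProg I (.inr (.inr hk))
    exact ⟨s, _, .cond_true hk0.ne' (.cond_true hn' (.cond_true (Nat.sub_ne_zero_of_lt hk) hs)),
      hconst _ (by simp [RamExpr.cost]), hs'⟩
  have hℓ := numLeaves_pos hI hk0
  have hL : 1 ≤ numLeaves I.F ^ 2 := Nat.one_le_pow _ _ hℓ
  have hlt : I.n < I.codeBound := by
    rw [I.codeBound_eq]
    exact (Nat.lt_succ_self _).trans_le (Nat.le_self_pow (by omega) _)
  let s₀ : RamState := ⟨Function.update (fun _ => 0) 0 (I.n + 9), I.memory⟩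
  have hs₀ : s₀.regs 0 = I.n + 9 := by simp [s₀]
  obtain ⟨r, t, hex, -, hr, ht⟩ := hp ⟨I, hk0, hk, by omega⟩ s₀ hs₀ rfl
    (fun i hi => absurd hi (Nat.not_lt_zero i))
  let s₁ : RamState := ⟨Function.update r 0 (r 1), I.memory⟩
  have hs₁ : s₁.regs 0 = r 1 := by simp [s₁]
  obtain ⟨r', t', hex', -, hr', ht'⟩ := hq ⟨I, hk0, hk, hlt⟩ s₁
    (hs₁.trans hr) rfl (fun i hi => absurd hi (Nat.not_lt_zero i))
  refine ⟨_, _, .cond_true hk0.ne' (.cond_true hn' (.cond_false (Nat.sub_eq_zero_of_le hk)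
    (.seq (.assign _ _ _) (.seq hex (.seq (.assign _ _ _) (.seq hex' (.assign _ _ _))))))), ?_, ?_⟩
  · rw [max_eq_left (by omega)]
    refine le_trans ?_ (add_pow_add_pow_le (C₁ := C₁) (D₁ := D₁) (C₂ := C₂) (D₂ := D₂) hn hL)
    rw [← I.codeBound_eq]
    have ht₁ : t ≤ C₁ * (I.n + 9 + 1) ^ D₁ := ht
    have ht₂ : t' ≤ C₂ * (I.codeBound + 1) ^ D₂ := ht'
    simp only [RamExpr.cost]
    omega
  · change Function.update r' 0 (r' 1) 0 = _
    rw [Function.update_self, hr']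
    exact truth_congr (I.encodes.accepts_iff hI hk hk0 hℓ le_rfl)
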